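/- All manifolds and maps are smooth; manifolds are finite-dimensional, Hausdorff and second countable. **Setting.** Let $\mathcal Q$ be a manifold and $(\mathcal V,\partial^+,\partial^-)$ a discrete tangent bundle of $\mathcal Q$: $\mathcal V$ is a manifold with $\dim\mathcal V=2\dim\mathcal Q$, the maps $\partial^\pm\colon\mathcal V\to\mathcal Q$ are submersions with $\ker T\partial^+\cap\ker T\partial^-=0$, and for each $m\in\mathcal Q$ there is exactly one $v\in\mathcal V$ with $\partial^+(v)=\partial^-(v)=m$. A discrete constrained Lagrangian system (DCLS) $(\mathcal V,\sigma_d,\mathcal D_d,\mathcal E_d)$ consists of such a $\mathcal V$, a one-form $\sigma_d$ on $\mathcal V$, an (embedded) submanifold $\mathcal D_d\subseteq\mathcal V$ such that $\partial^\pm|\mathcal D_d$ are submersions, and a subbundle $\mathcal E_d$ of $(\partial^+|\mathcal D_d)^*T\mathcal Q$. It has linear constraints, with constraint distribution $\mathcal D_d^{\mathcal Q}$ (a distribution on $\mathcal Q$ of constant fiber dimension $r$), if for all $v\in\mathcal D_d$ one has $(\mathcal E_d)_v=(\mathcal D_d^{\mathcal Q})_{\partial^+(v)}$, the points $\partial^-(v)$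 and $\partial^+(v)$ can be joined by a piecewise smooth curve with velocities in $\mathcal D_d^{\mathcal Q}$, and $\dim\mathcal D_d=\dim\mathcal Q+r$. For $N\ge 1$, put $$\mathcal C_{d,N}=\{w\in\mathcal V^N:\partial^+(w(k))=\partial^-(w(k+1)),\ 1\le k<N\},\qquad \mathcal N_{d,N}=\{w\in\mathcal C_{d,N}: w(k)\in\mathcal D_d\text{ for all }k\},$$ and, for $w\in\mathcal N_{d,N}$, $$(\mathcal W_{d,N})_w=\{\delta w\in T_w\mathcal C_{d,N}: T\partial^-(\delta w(1))=0,\ T\partial^+(\delta w(N))=0,\ T\partial^+(\delta w(k))\in(\mathcal E_d)_{w(k)}\text{ for all }k\}.$$ A distribution is involutive if the Lie bracket of any two local vector fields with values in it again has values in it; for $\mathcal W_{d,N}$, which is given only at the points of $\mathcal N_{d,N}$, this means: if $X,Y$ are local vector fields on $\mathcal C_{d,N}$ with $X(w),Y(w)\in(\mathcal W_{d,N})_w$ at all points $w\in\mathcal N_{d,N}$ of their domain, then $[X,Y](w)\in(\mathcal W_{d,N})_w$ at these points. **Theorem.** Consider a DCLS with linear constraint distribution $\mathcal D_d^{\mathcal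 Q}$, such that for every $q\in\mathcal Q$ there are $v,\tilde v\in\mathcal D_d$ with $\partial^+(v)=q=\partial^-(\tilde v)$, and let $N\ge2$. The following are equivalent: 1. $\mathcal D_d^{\mathcal Q}$ is involutive; 2. $\mathcal W_{d,N}$ is involutive; 3. $\mathcal W_{d,N}=\{\delta w\in T\mathcal N_{d,N}: T\partial^-(\delta w(1))=0,\ T\partial^+(\delta w(N))=0\}$; 4. $\mathcal W_{d,N}\subseteq T\mathcal N_{d,N}$, i.e. the discrete problem (find points of $\mathcal N_{d,N}$ where $\Sigma_{d,N}(w)\,\delta w=\sum_{k=1}^N\sigma_d(w(k))\,\delta w(k)$ annihilates $\mathcal W_{d,N}$) is variational, in the sense that the tangent bundle of the constraint contains the distribution of variations. -/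

import Mathlib

open scoped Manifold ContDiff Topology

noncomputable section

namespace DiscreteMechanics

section Power

variable {E : Type*} [NormedAddCommGroup E] [NormedSpace ℝ E]
  {V : Type*} [TopologicalSpace V] [ChartedSpace E V]

/-- The model with corners of the finite power `V[1,N] = V × ⋯ × V` (`N` factors). -/
abbrev powModel (E : Type*) [NormedAddCommGroup E] [NormedSpace ℝ E] (N : ℕ) :
    ModelWithCorners ℝ (Fin N → E) (ModelPi fun _ : Fin N => E) :=
  ModelWithCorners.pi fun _ : Fin N => 𝓘(ℝ, E)

/-- A finite power of a smooth manifold is a smooth manifold. -/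
instance instIsManifoldPow (N : ℕ) (n : WithTop ℕ∞) [IsManifold 𝓘(ℝ, E) n V] :
    IsManifold (powModel E N) n (Fin N → V) := by
  apply isManifold_of_contDiffOn
  rintro e e' ⟨f, hf, rfl⟩ ⟨f', hf', rfl⟩
  refine contDiffOn_pi.2 fun i => ?_
  have h := (contDiffGroupoid n 𝓘(ℝ, E)).compatible (hf i trivial) (hf' i trivial)
  rw [contDiffGroupoid, mem_groupoid_of_pregroupoid] at h
  have h1 : ContDiffOn ℝ n ((f i).symm ≫ₕ f' i) ((f i).symm ≫ₕ f' i).source := by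
    simpa [contDiffPregroupoid] using h.1
  have h2 : ContDiff ℝ n (fun x : Fin N → E => x i) := contDiff_apply ℝ E i
  refine h1.comp h2.contDiffOn ?_
  rintro x ⟨⟨hx1, hx2⟩, -⟩
  exact ⟨hx1 i trivial, hx2 i trivial⟩

end Power

section Tangent

variable {E : Type*} [NormedAddCommGroup E] [NormedSpace ℝ E]
  {H : Type*} [TopologicalSpace H] (I : ModelWithCorners ℝ E H)
  {M : Type*} [TopologicalSpace M] [ChartedSpace H M]

/-- The velocity at time `0` of a curve `c` in `M`, as a point of the tangent bundle. -/
def velocity (c : ℝ → M) : TangentBundle I M :=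
  ⟨c 0, mfderiv 𝓘(ℝ, ℝ) I c 0 (1 : ℝ)⟩

/-- The tangent vectors to a subset `S` of `M`: velocities of curves in `S`. For an embedded
submanifold `S` this is the tangent bundle `TS`, as a subset of `TM`. -/
def tangentTo (S : Set M) : Set (TangentBundle I M) :=
  {δ | ∃ c : ℝ → M, MDifferentiableAt 𝓘(ℝ, ℝ) I c 0 ∧ (∀ᶠ t in 𝓝 (0 : ℝ), c t ∈ S) ∧
    velocity I c = δ}

/-- The vector field `X` is smooth on the set `U`. -/
def SmoothFieldOn [IsManifold I 1 M] (X : ∀ x : M, TangentSpace I x) (U : Set M) : Prop :=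
  ContMDiffOn I I.tangent ∞ (fun x => (⟨x, X x⟩ : TangentBundle I M)) U

/-- `F` is a smooth distribution (subbundle of `TM`) of fiber dimension `r`. -/
def IsSmoothDistribution [IsManifold I 1 M] (F : ∀ x : M, Submodule ℝ (TangentSpace I x))
    (r : ℕ) : Prop :=
  ∀ x₀ : M, ∃ U : Set M, IsOpen U ∧ x₀ ∈ U ∧ ∃ X : Fin r → ∀ x : M, TangentSpace I x,
    (∀ i, SmoothFieldOn I (X i) U) ∧
    ∀ x ∈ U, LinearIndependent ℝ (fun i => X i x) ∧
      Submodule.span ℝ (Set.range fun i => X i x) = F x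

/-- The distribution `F` on `M` is involutive: the Lie bracket of (local) smooth vector fields
with values in `F` has values in `F`. -/
def IsInvolutive [IsManifold I 1 M] (F : ∀ x : M, Submodule ℝ (TangentSpace I x)) : Prop :=
  ∀ U : Set M, IsOpen U → ∀ X Y : ∀ x : M, TangentSpace I x,
    SmoothFieldOn I X U → SmoothFieldOn I Y U →
    (∀ x ∈ U, X x ∈ F x) → (∀ x ∈ U, Y x ∈ F x) →
    ∀ x ∈ U, VectorField.mlieBracket I X Y x ∈ F x

/-- Involutivity of a family `W` of tangent vectors to a submanifold `C` of `M` which is given only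
at the points of a subset `S` of `C`: the Lie bracket of (local) smooth vector fields on `C` with
values in `W` (at the points of `S`, where `W` is given) has values in `W`. A vector field on `C`
is written as the restriction of a vector field on `M` that is tangent to `C`. -/
def IsInvolutiveAlong [IsManifold I 1 M] (C S : Set M) (W : Set (TangentBundle I M)) : Prop :=
  ∀ U : Set M, IsOpen U → ∀ X Y : ∀ x : M, TangentSpace I x,
    SmoothFieldOn I X U → SmoothFieldOn I Y U →
    (∀ x ∈ U ∩ C, (⟨x, X x⟩ : TangentBundle I M) ∈ tangentTo I C) →
    (∀ x ∈ U ∩ C, (⟨x, Y x⟩ : TangentBundle I M) ∈ tangentTo I C) →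
    (∀ x ∈ U ∩ S, (⟨x, X x⟩ : TangentBundle I M) ∈ W) →
    (∀ x ∈ U ∩ S, (⟨x, Y x⟩ : TangentBundle I M) ∈ W) →
    ∀ x ∈ U ∩ S, (⟨x, VectorField.mlieBracket I X Y x⟩ : TangentBundle I M) ∈ W

/-- There is a smooth curve segment from `x` to `y` whose velocities lie in `F`. -/
def SmoothArc (F : ∀ x : M, Submodule ℝ (TangentSpace I x)) (x y : M) : Prop :=
  ∃ (a b : ℝ) (c : ℝ → M), a < b ∧ ContMDiffOn 𝓘(ℝ, ℝ) I ∞ c (Set.Icc a b) ∧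
    (∀ t ∈ Set.Icc a b, mfderivWithin 𝓘(ℝ, ℝ) I c (Set.Icc a b) t (1 : ℝ) ∈ F (c t)) ∧
    c a = x ∧ c b = y

/-- `y` is `F`-reachable from `x`: there is a piecewise smooth curve from `x` to `y` (a finite
concatenation of smooth curve segments) whose velocities lie in `F`. -/
def Reachable (F : ∀ x : M, Submodule ℝ (TangentSpace I x)) : M → M → Prop :=
  Relation.ReflTransGen (SmoothArc I F)

end Tangent

/-- `S` is an embedded smooth submanifold of `M` of dimension `d`: near each of its points there
is a chart of `M` that straightens `S` to a `d`-dimensional linear subspace. -/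
def IsEmbeddedSubmanifold {E : Type*} [NormedAddCommGroup E] [NormedSpace ℝ E]
    {M : Type*} [TopologicalSpace M] [ChartedSpace E M] (S : Set M) (d : ℕ) : Prop :=
  ∀ x ∈ S, ∃ φ ∈ IsManifold.maximalAtlas 𝓘(ℝ, E) ∞ M, x ∈ φ.source ∧
    ∃ L : Submodule ℝ E, Module.finrank ℝ L = d ∧ ∀ y ∈ φ.source, y ∈ S ↔ φ y ∈ L

section Discrete

variable (A : Type*) [NormedAddCommGroup A] [NormedSpace ℝ A]
  (Q : Type*) [TopologicalSpace Q] [ChartedSpace A Q] [IsManifold 𝓘(ℝ, A) ∞ Q]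
  (B : Type*) [NormedAddCommGroup B] [NormedSpace ℝ B]
  (V : Type*) [TopologicalSpace V] [ChartedSpace B V] [IsManifold 𝓘(ℝ, B) ∞ V]

/-- A discrete tangent bundle `(V, ∂⁺, ∂⁻)` of the manifold `Q`. The manifolds `Q` and `V` are
modelled on the (finite-dimensional) spaces `A` and `B`. -/
structure DiscreteTangentBundle where
  /-- the map `∂⁺` -/
  dPlus : V → Q
  /-- the map `∂⁻` -/
  dMinus : V → Q
  dim_eq : Module.finrank ℝ B = 2 * Module.finrank ℝ A
  smooth_dPlus : ContMDiff 𝓘(ℝ, B) 𝓘(ℝ, A) ∞ dPlus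
  smooth_dMinus : ContMDiff 𝓘(ℝ, B) 𝓘(ℝ, A) ∞ dMinus
  submersion_dPlus : ∀ v, Function.Surjective (mfderiv 𝓘(ℝ, B) 𝓘(ℝ, A) dPlus v)
  submersion_dMinus : ∀ v, Function.Surjective (mfderiv 𝓘(ℝ, B) 𝓘(ℝ, A) dMinus v)
  ker_inf_ker : ∀ (v : V) (δ : TangentSpace 𝓘(ℝ, B) v),
    mfderiv 𝓘(ℝ, B) 𝓘(ℝ, A) dPlus v δ = 0 → mfderiv 𝓘(ℝ, B) 𝓘(ℝ, A) dMinus v δ = 0 → δ = 0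
  existsUnique_zero : ∀ m : Q, ∃! v : V, dPlus v = m ∧ dMinus v = m

/-- A discrete constrained Lagrangian system `(V, σ_d, D_d, E_d)`. -/
structure DCLS extends DiscreteTangentBundle A Q B V where
  /-- the one-form `σ_d` on `V` -/
  σ : ∀ v : V, TangentSpace 𝓘(ℝ, B) v →L[ℝ] ℝ
  smooth_σ : ContMDiff 𝓘(ℝ, B).tangent 𝓘(ℝ, ℝ) ∞
    (fun δ : TangentBundle 𝓘(ℝ, B) V => σ δ.1 δ.2)
  /-- the discrete velocity constraint `D_d` -/
  D : Set V
  /-- the dimension of `D_d` -/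
  dimD : ℕ
  submanifold_D : IsEmbeddedSubmanifold (E := B) D dimD
  /-- the restriction of `∂⁺` to `D_d` is a submersion -/
  submersion_dPlus_D : ∀ v ∈ D, ∀ u : TangentSpace 𝓘(ℝ, A) (dPlus v),
    ∃ δ : TangentSpace 𝓘(ℝ, B) v,
      (⟨v, δ⟩ : TangentBundle 𝓘(ℝ, B) V) ∈ tangentTo 𝓘(ℝ, B) D ∧
      mfderiv 𝓘(ℝ, B) 𝓘(ℝ, A) dPlus v δ = u
  /-- the restriction of `∂⁻` to `D_d` is a submersion -/
  submersion_dMinus_D : ∀ v ∈ D, ∀ u : TangentSpace 𝓘(ℝ, A) (dMinus v),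
    ∃ δ : TangentSpace 𝓘(ℝ, B) v,
      (⟨v, δ⟩ : TangentBundle 𝓘(ℝ, B) V) ∈ tangentTo 𝓘(ℝ, B) D ∧
      mfderiv 𝓘(ℝ, B) 𝓘(ℝ, A) dMinus v δ = u
  /-- the variation constraint `E_d`, a subspace of the tangent space at `∂⁺(v)` for `v ∈ D_d` -/
  E : ∀ v : D, Submodule ℝ (TangentSpace 𝓘(ℝ, A) (dPlus v))
  /-- the fiber dimension of `E_d` -/
  rankE : ℕ
  /-- `E_d` is a smooth subbundle of the pullback of `TQ` by the restriction of `∂⁺` to `D_d` -/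
  subbundle_E : ∀ v₀ ∈ D, ∃ U : Set V, IsOpen U ∧ v₀ ∈ U ∧
    ∃ X : Fin rankE → ∀ v : V, TangentSpace 𝓘(ℝ, A) (dPlus v),
      (∀ i, ContMDiffOn 𝓘(ℝ, B) 𝓘(ℝ, A).tangent ∞
        (fun v => (⟨dPlus v, X i v⟩ : TangentBundle 𝓘(ℝ, A) Q)) (U ∩ D)) ∧
      ∀ v : D, (v : V) ∈ U → LinearIndependent ℝ (fun i => X i v) ∧
        Submodule.span ℝ (Set.range fun i => X i v) = E v

variable {A Q B V}

namespace DCLS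

variable (S : DCLS A Q B V) (N : ℕ)

/-- The system has linear constraints, with constraint distribution `F` of fiber dimension `r`
(as a manifold, `F` has dimension `dim Q + r`). -/
structure HasLinearConstraints (F : ∀ q : Q, Submodule ℝ (TangentSpace 𝓘(ℝ, A) q)) (r : ℕ) :
    Prop where
  smooth : IsSmoothDistribution 𝓘(ℝ, A) F r
  E_eq : ∀ v : S.D, S.E v = F (S.dPlus v)
  reachable : ∀ v ∈ S.D, Reachable 𝓘(ℝ, A) F (S.dMinus v) (S.dPlus v)
  dim_eq : S.dimD = Module.finrank ℝ A + r

/-- The first order sequences `C_{d,N}` in `V[1,N]`. Sequences are indexed by `Fin N`, so that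
the index `k` stands for the position `k + 1`. -/
def firstOrder : Set (Fin N → V) :=
  {w | ∀ k l : Fin N, (l : ℕ) = k + 1 → S.dPlus (w k) = S.dMinus (w l)}

/-- The constrained first order sequences `N_{d,N}`. -/
def constrained : Set (Fin N → V) :=
  {w | w ∈ S.firstOrder N ∧ ∀ k, w k ∈ S.D}

variable {N}

/-- The entry `δv(k)`, tangent to `V` at `v(k)`, of a tangent vector `δv` to `V[1,N]` at `v`. -/
def entry (δ : TangentBundle (powModel B N) (Fin N → V)) (k : Fin N) :
    TangentSpace 𝓘(ℝ, B) (δ.1 k) :=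
  mfderiv (powModel B N) 𝓘(ℝ, B) (fun w : Fin N → V => w k) δ.1 δ.2

/-- `T∂⁺(δv(k))` -/
def tPlus (δ : TangentBundle (powModel B N) (Fin N → V)) (k : Fin N) :
    TangentSpace 𝓘(ℝ, A) (S.dPlus (δ.1 k)) :=
  mfderiv 𝓘(ℝ, B) 𝓘(ℝ, A) S.dPlus (δ.1 k) (entry δ k)

/-- `T∂⁻(δv(k))` -/
def tMinus (δ : TangentBundle (powModel B N) (Fin N → V)) (k : Fin N) :
    TangentSpace 𝓘(ℝ, A) (S.dMinus (δ.1 k)) :=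
  mfderiv 𝓘(ℝ, B) 𝓘(ℝ, A) S.dMinus (δ.1 k) (entry δ k)

variable (N)

/-- The tangent vectors to `V[1,N]` with fixed endpoint projections: `T∂⁻(δv(1)) = 0` and
`T∂⁺(δv(N)) = 0`. -/
def fixedEndpoints : Set (TangentBundle (powModel B N) (Fin N → V)) :=
  {δ | (∀ k : Fin N, (k : ℕ) = 0 → S.tMinus δ k = 0) ∧
    ∀ k : Fin N, (k : ℕ) + 1 = N → S.tPlus δ k = 0}

/-- The variation distribution `W_{d,N}`: at the points of `N_{d,N}` (where all entries lie in
`D_d`, the base of `E_d`), the tangent vectors to `C_{d,N}` with fixed endpoint projections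
and with `T∂⁺(δv(k)) ∈ (E_d)_{v(k)}` for all `k`. -/
def variations : Set (TangentBundle (powModel B N) (Fin N → V)) :=
  {δ | δ ∈ tangentTo (powModel B N) (S.firstOrder N) ∧ δ ∈ S.fixedEndpoints N ∧
    ∃ h : δ.1 ∈ S.constrained N, ∀ k, S.tPlus δ k ∈ S.E ⟨δ.1 k, h.2 k⟩}

end DCLS

end Discrete

end DiscreteMechanics

end

namespace DiscreteMechanics

/-!
Suppose first that `F = D_d^Q` is involutive. By Frobenius' theorem it has local first integrals.
They can be built from flow arcs of commuting fields, using Grönwall's inequality instead of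
the smooth dependence of flows on parameters. A path tangent to `F` stays in a leaf, and since a
leaf meets each local domain in countably many plaques, a first integral is constant along any
curve whose points lie in a single leaf. For `v ∈ D_d` the points `∂⁻(v)` and `∂⁺(v)` lie in one
leaf. Hence, if `c` is a curve in `D_d` and `∂⁻ ∘ c` is tangent to `F`, then `∂⁺ ∘ c` stays in a
leaf and is tangent to `F`: the constraint is transported along `D_d`.

Since `(T∂⁻, T∂⁺)` is an isomorphism and `dim D_d = dim Q + r`, transport of the constraint is
equivalent to the inclusion `T∂⁻⁻¹ F ∩ T∂⁺⁻¹ F ⊆ T D_d`. The vectors of `W_{d,N}` are the chains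
with vanishing outer endpoints whose inner endpoints move along `F`, so this inclusion is also
equivalent to conditions 3 and 4. Under it, `W_{d,N}` is cut out of `T N_{d,N}` by fixing the
endpoints, and brackets respect this. Conversely, since `(∂⁻, ∂⁺)` is a local diffeomorphism, a
local field with values in `F` lifts to a field on `C_{d,N}` with values in `W_{d,N}` that moves
only the inner endpoint `∂⁺(w(1)) = ∂⁻(w(2))`; brackets of such lifts project to the brackets on
`Q`.
-/

noncomputable section

open Set Metric

section FlatFrame

variable {E : Type*} [NormedAddCommGroup E] [NormedSpace ℝ E]
  {H : Type*} [NormedAddCommGroup H] [NormedSpace ℝ H]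

lemma gronwallBound_le_exp_mul {δ K ε s : ℝ} (hδ : 0 ≤ δ) (hK : 1 ≤ K) (hε : 0 ≤ ε)
    (hs : s ∈ Icc (0 : ℝ) 1) : gronwallBound δ K ε s ≤ Real.exp K * (δ + ε) := by
  have hK0 : 0 < K := by linarith
  rw [gronwallBound_of_K_ne_0 hK0.ne']
  have hexp : Real.exp (K * s) ≤ Real.exp K :=
    Real.exp_le_exp.2 (mul_le_of_le_one_right hK0.le hs.2)
  have hone : 1 ≤ Real.exp (K * s) := Real.one_le_exp (mul_nonneg hK0.le hs.1)
  calc δ * Real.exp (K * s) + ε / K * (Real.exp (K * s) - 1)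
      ≤ δ * Real.exp K + ε * Real.exp K := by
        gcongr
        · exact div_le_self hε hK
        · linarith
    _ = Real.exp K * (δ + ε) := by ring

lemma norm_le_exp_mul_of_norm_deriv_le {f f' : ℝ → E} {K ε : ℝ} (hK : 1 ≤ K) (hε : 0 ≤ ε)
    (hf : ∀ s ∈ Icc (0 : ℝ) 1, HasDerivWithinAt f (f' s) (Icc 0 1) s)
    (hf' : ∀ s ∈ Icc (0 : ℝ) 1, ‖f' s‖ ≤ K * ‖f s‖ + ε) {s : ℝ} (hs : s ∈ Icc (0 : ℝ) 1) :
    ‖f s‖ ≤ Real.exp K * (‖f 0‖ + ε) := by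
  have hgronwall : ‖f s‖ ≤ gronwallBound ‖f 0‖ K ε (s - 0) :=
    norm_le_gronwallBound_of_norm_deriv_right_le (f' := f') (b := 1)
      (fun x hx => (hf x hx).continuousWithinAt)
      (fun x hx => (hf x ⟨hx.1, hx.2.le⟩).mono_of_mem_nhdsWithin (Icc_mem_nhdsGE_of_mem hx))
      le_rfl (fun x hx => hf' x ⟨hx.1, hx.2.le⟩) s hs
  rw [sub_zero] at hgronwall
  exact hgronwall.trans (gronwallBound_le_exp_mul (norm_nonneg _) hK hε hs)

lemma eq_left_of_hasDerivWithinAt_zero {f : ℝ → E} {a b : ℝ}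
    (hf : ∀ s ∈ Icc a b, HasDerivWithinAt f 0 (Icc a b) s) {s : ℝ} (hs : s ∈ Icc a b) :
    f s = f a :=
  constant_of_has_deriv_right_zero (fun s hs => (hf s hs).continuousWithinAt)
    (fun s hs => (hf s ⟨hs.1, hs.2.le⟩).mono_of_mem_nhdsWithin (Icc_mem_nhdsGE_of_mem hs)) s hs

lemma exists_integralCurve_mem_closedBall [CompleteSpace E] {f : ℝ → E → E} {T : ℝ} (hT : 0 ≤ T)
    {x : E} {a L K : NNReal}
    (hf : IsPicardLindelof f (tmin := 0) (tmax := T) ⟨0, le_rfl, hT⟩ x a 0 L K) :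
    ∃ c : ℝ → E, c 0 = x ∧ ∀ s ∈ Icc 0 T, c s ∈ closedBall x a ∧
      HasDerivWithinAt c (f s (c s)) (Icc 0 T) s := by
  obtain ⟨α, hα⟩ := ODE.FunSpace.exists_isFixedPt_next hf (mem_closedBall_self le_rfl)
  have hmem : ∀ s, α.compProj s ∈ closedBall x a :=
    fun s => α.compProj_mem_closedBall hf.mul_max_le
  have hstart : α.compProj ((⟨0, le_rfl, hT⟩ : Icc (0 : ℝ) T) : ℝ) = x := by
    rw [ODE.FunSpace.compProj_val, ← hα, ODE.FunSpace.next_apply₀]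
  refine ⟨α.compProj, hstart, fun s hs => ⟨hmem s, ?_⟩⟩
  refine (ODE.hasDerivWithinAt_picard_Icc (t₀ := 0) ⟨le_rfl, hT⟩ hf.continuousOn_uncurry
    α.continuous_compProj.continuousOn (fun _ _ => hmem _) x hs).congr_of_mem (fun t ht => ?_) hs
  nth_rw 1 [← hα]
  rw [ODE.FunSpace.compProj_of_mem ht, ODE.FunSpace.next_apply]

/-- A frame `z ↦ G z` of a distribution on the set `B` in the vector space `E`, normalized by
`p ∘ G z = id`, whose coefficient fields `z ↦ G z h` commute. The constant `M` bounds `G`, its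
derivative, and the Lipschitz constant of the derivative. -/
structure IsFlatFrame (p : E →L[ℝ] H) (G : E → H →L[ℝ] E) (B : Set E) (M : ℝ) : Prop where
  one_le : 1 ≤ M
  differentiableAt : ∀ z ∈ B, DifferentiableAt ℝ G z
  norm_le : ∀ z ∈ B, ‖G z‖ ≤ M
  norm_fderiv_le : ∀ z ∈ B, ‖fderiv ℝ G z‖ ≤ M
  norm_fderiv_sub_le : ∀ z₁ ∈ B, ∀ z₂ ∈ B, ‖fderiv ℝ G z₂ - fderiv ℝ G z₁‖ ≤ M * ‖z₂ - z₁‖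
  right_inv : ∀ z ∈ B, ∀ h, p (G z h) = h
  symm : ∀ z ∈ B, ∀ h k, fderiv ℝ G z (G z h) k = fderiv ℝ G z (G z k) h

/-- `c` is, on the unit interval, an integral curve in `B` of the coefficient field `z ↦ G z h`. -/
structure IsFlowArc (G : E → H →L[ℝ] E) (B : Set E) (h : H) (c : ℝ → E) : Prop where
  mem : ∀ s ∈ Icc (0 : ℝ) 1, c s ∈ B
  hasDerivWithinAt : ∀ s ∈ Icc (0 : ℝ) 1, HasDerivWithinAt c (G (c s) h) (Icc 0 1) s

lemma IsFlowArc.reverse {G : E → H →L[ℝ] E} {B : Set E} {h : H} {c : ℝ → E}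
    (hc : IsFlowArc G B h c) : IsFlowArc G B (-h) fun s => c (1 - s) := by
  have hmaps : MapsTo (fun s : ℝ => 1 - s) (Icc 0 1) (Icc 0 1) :=
    fun s hs => ⟨by linarith [hs.2], by linarith [hs.1]⟩
  refine ⟨fun s hs => hc.mem _ (hmaps hs), fun s hs => ?_⟩
  simpa [Function.comp_def] using (hc.hasDerivWithinAt _ (hmaps hs)).scomp s
    ((hasDerivWithinAt_id s (Icc (0 : ℝ) 1)).const_sub 1) hmaps

namespace IsFlatFrame

variable {p : E →L[ℝ] H} {G : E → H →L[ℝ] E} {B : Set E} {M : ℝ} {h₁ h₂ : H} {c₁ c₂ : ℝ → E}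

lemma norm_sub_le (hG : IsFlatFrame p G B M) (hB : Convex ℝ B) {z₁ z₂ : E} (hz₁ : z₁ ∈ B)
    (hz₂ : z₂ ∈ B) : ‖G z₂ - G z₁‖ ≤ M * ‖z₂ - z₁‖ :=
  hB.norm_image_sub_le_of_norm_fderiv_le hG.differentiableAt hG.norm_fderiv_le hz₁ hz₂

lemma norm_taylor_le (hG : IsFlatFrame p G B M) (hB : Convex ℝ B) {z₁ z₂ : E} (hz₁ : z₁ ∈ B)
    (hz₂ : z₂ ∈ B) : ‖G z₂ - G z₁ - fderiv ℝ G z₁ (z₂ - z₁)‖ ≤ M * ‖z₂ - z₁‖ ^ 2 := by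
  have hseg : segment ℝ z₁ z₂ ⊆ B := hB.segment_subset hz₁ hz₂
  refine ((convex_segment z₁ z₂).norm_image_sub_le_of_norm_fderiv_le' (𝕜 := ℝ)
    (C := M * ‖z₂ - z₁‖) (fun z hz => hG.differentiableAt z (hseg hz)) (fun z hz => ?_)
    (left_mem_segment ℝ z₁ z₂) (right_mem_segment ℝ z₁ z₂)).trans_eq (by ring)
  have hM := hG.one_le
  refine (hG.norm_fderiv_sub_le z₁ hz₁ z (hseg hz)).trans ?_
  gcongr
  exact norm_sub_le_of_mem_segment hz

/-- Commuting coefficient fields allow the derivative terms at `z₁` to be collected into a single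
one, applied to the defect `z₂ - z₁ - G z₁ k`. -/
lemma norm_variation_deriv_le (hG : IsFlatFrame p G B M) (hB : Convex ℝ B) {z₁ z₂ : E}
    (hz₁ : z₁ ∈ B) (hz₂ : z₂ ∈ B) (hh₁ : ‖h₁‖ ≤ 1) (k : H) {δ : ℝ} (hz : ‖z₂ - z₁‖ ≤ δ)
    (hh : ‖h₂ - h₁‖ ≤ δ) :
    ‖G z₂ h₂ - G z₁ h₁ - (fderiv ℝ G z₁ (G z₁ h₁) k + G z₁ (h₂ - h₁))‖ ≤
      M * ‖z₂ - z₁ - G z₁ k‖ + 2 * M * δ ^ 2 := by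
  have hM := hG.one_le
  have hδ : 0 ≤ δ := (norm_nonneg _).trans hz
  have hsplit : G z₂ h₂ - G z₁ h₁ - (fderiv ℝ G z₁ (G z₁ h₁) k + G z₁ (h₂ - h₁)) =
      fderiv ℝ G z₁ (z₂ - z₁ - G z₁ k) h₁ + ((G z₂ - G z₁) (h₂ - h₁) +
        (G z₂ - G z₁ - fderiv ℝ G z₁ (z₂ - z₁)) h₁) := by
    rw [hG.symm _ hz₁ h₁ k]
    simp only [map_sub, sub_apply]
    abel
  have hlinear : ‖fderiv ℝ G z₁ (z₂ - z₁ - G z₁ k) h₁‖ ≤ M * ‖z₂ - z₁ - G z₁ k‖ :=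
    calc _ ≤ ‖fderiv ℝ G z₁‖ * ‖z₂ - z₁ - G z₁ k‖ * ‖h₁‖ := (fderiv ℝ G z₁).le_opNorm₂ _ _
      _ ≤ M * ‖z₂ - z₁ - G z₁ k‖ * 1 := by gcongr; exact hG.norm_fderiv_le _ hz₁
      _ = _ := mul_one _
  have hmixed : ‖(G z₂ - G z₁) (h₂ - h₁)‖ ≤ M * δ * δ :=
    (ContinuousLinearMap.le_opNorm _ _).trans
      (by gcongr; exact (hG.norm_sub_le hB hz₁ hz₂).trans (by gcongr))
  have htaylor : ‖(G z₂ - G z₁ - fderiv ℝ G z₁ (z₂ - z₁)) h₁‖ ≤ M * δ ^ 2 * 1 :=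
    (ContinuousLinearMap.le_opNorm _ _).trans
      (by gcongr; exact (hG.norm_taylor_le hB hz₁ hz₂).trans (by gcongr))
  rw [hsplit]
  exact (norm_add_le_of_le hlinear (norm_add_le_of_le hmixed htaylor)).trans_eq (by ring)

lemma norm_flowArc_sub_le (hG : IsFlatFrame p G B M) (hB : Convex ℝ B)
    (hc₁ : IsFlowArc G B h₁ c₁) (hc₂ : IsFlowArc G B h₂ c₂) (hh₂ : ‖h₂‖ ≤ 1)
    {s : ℝ} (hs : s ∈ Icc (0 : ℝ) 1) :
    ‖c₂ s - c₁ s‖ ≤ Real.exp M * (‖c₂ 0 - c₁ 0‖ + M * ‖h₂ - h₁‖) := by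
  have hM := hG.one_le
  refine norm_le_exp_mul_of_norm_deriv_le (f := fun s => c₂ s - c₁ s) hM (by positivity)
    (fun s hs => (hc₂.hasDerivWithinAt s hs).sub (hc₁.hasDerivWithinAt s hs)) (fun s hs => ?_) hs
  calc ‖G (c₂ s) h₂ - G (c₁ s) h₁‖ = ‖(G (c₂ s) - G (c₁ s)) h₂ + G (c₁ s) (h₂ - h₁)‖ := by simp
    _ ≤ ‖G (c₂ s) - G (c₁ s)‖ * ‖h₂‖ + ‖G (c₁ s)‖ * ‖h₂ - h₁‖ :=
      (norm_add_le _ _).trans (add_le_add (ContinuousLinearMap.le_opNorm _ _)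
        (ContinuousLinearMap.le_opNorm _ _))
    _ ≤ M * ‖c₂ s - c₁ s‖ * 1 + M * ‖h₂ - h₁‖ := by
      gcongr
      · exact hG.norm_sub_le hB (hc₁.mem s hs) (hc₂.mem s hs)
      · exact hG.norm_le _ (hc₁.mem s hs)
    _ = M * ‖c₂ s - c₁ s‖ + M * ‖h₂ - h₁‖ := by rw [mul_one]

/-- Variations which are tangent to the distribution stay tangent along flow arcs, up to an error
of second order. -/
lemma norm_variation_le (hG : IsFlatFrame p G B M) (hB : Convex ℝ B) (hc₁ : IsFlowArc G B h₁ c₁)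
    (hc₂ : IsFlowArc G B h₂ c₂) (hh₁ : ‖h₁‖ ≤ 1) (hh₂ : ‖h₂‖ ≤ 1) {δ : ℝ}
    (hc : ‖c₂ 0 - c₁ 0‖ ≤ δ) (hh : ‖h₂ - h₁‖ ≤ δ) (u : H) :
    ‖c₂ 1 - c₁ 1 - G (c₁ 1) (u + (h₂ - h₁))‖ ≤
      Real.exp M * (‖c₂ 0 - c₁ 0 - G (c₁ 0) u‖ + 2 * M * (Real.exp M * (1 + M) * δ) ^ 2) := by
  have hM := hG.one_le
  have hδ : 0 ≤ δ := (norm_nonneg _).trans hc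
  have hδ' : δ ≤ Real.exp M * (1 + M) * δ := by
    have := Real.one_le_exp (zero_le_one.trans hM)
    exact le_mul_of_one_le_left hδ (one_le_mul_of_one_le_of_one_le this (by linarith))
  have hdist : ∀ s ∈ Icc (0 : ℝ) 1, ‖c₂ s - c₁ s‖ ≤ Real.exp M * (1 + M) * δ := fun s hs =>
    calc _ ≤ Real.exp M * (‖c₂ 0 - c₁ 0‖ + M * ‖h₂ - h₁‖) :=
          hG.norm_flowArc_sub_le hB hc₁ hc₂ hh₂ hs
      _ ≤ Real.exp M * (δ + M * δ) := by gcongr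
      _ = _ := by ring
  have hderiv : ∀ s ∈ Icc (0 : ℝ) 1, HasDerivWithinAt
      (fun s => c₂ s - c₁ s - G (c₁ s) (u + s • (h₂ - h₁)))
      (G (c₂ s) h₂ - G (c₁ s) h₁ - (fderiv ℝ G (c₁ s) (G (c₁ s) h₁) (u + s • (h₂ - h₁)) +
        G (c₁ s) (h₂ - h₁))) (Icc 0 1) s := fun s hs => by
    have hGc := (hG.differentiableAt _ (hc₁.mem s hs)).hasFDerivAt.comp_hasDerivWithinAt s
      (hc₁.hasDerivWithinAt s hs)
    have hline : HasDerivWithinAt (fun s : ℝ => u + s • (h₂ - h₁)) (h₂ - h₁) (Icc 0 1) s := by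
      simpa using ((hasDerivWithinAt_id s (Icc (0 : ℝ) 1)).smul_const (h₂ - h₁)).const_add u
    exact ((hc₂.hasDerivWithinAt s hs).sub (hc₁.hasDerivWithinAt s hs)).sub (hGc.clm_apply hline)
  simpa using norm_le_exp_mul_of_norm_deriv_le hM (by positivity) hderiv
    (fun s hs => hG.norm_variation_deriv_le hB (hc₁.mem s hs) (hc₂.mem s hs) hh₁
      (u + s • (h₂ - h₁)) (hdist s hs) (hh.trans hδ')) (right_mem_Icc.2 zero_le_one)

lemma exists_flowArc [CompleteSpace E] {z₀ : E} {ρ : ℝ}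
    (hG : IsFlatFrame p G (closedBall z₀ ρ) M) {z : E} (hz : z ∈ closedBall z₀ (ρ / 2)) {h : H}
    (hh : ‖h‖ ≤ 1) (hMh : M * ‖h‖ ≤ ρ / 2) :
    ∃ c, IsFlowArc G (closedBall z₀ ρ) h c ∧ c 0 = z ∧
      ∀ s ∈ Icc (0 : ℝ) 1, ‖c s - z‖ ≤ M * ‖h‖ := by
  have hM := hG.one_le
  lift M to NNReal using by linarith
  have hsub : closedBall z (M * ‖h‖) ⊆ closedBall z₀ ρ :=
    closedBall_subset_closedBall' (by rw [mem_closedBall] at hz; linarith)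
  have hPL : IsPicardLindelof (fun _ x => G x h) (tmin := 0) (tmax := 1)
      ⟨0, le_rfl, zero_le_one⟩ z (M * ‖h‖₊) 0 (M * ‖h‖₊) M := by
    refine IsPicardLindelof.of_time_independent (fun x hx => ?_) ?_ (by simp)
    · exact (G x).le_of_opNorm_le (hG.norm_le x (hsub hx)) h
    · refine LipschitzOnWith.of_dist_le_mul fun x hx y hy => ?_
      rw [dist_eq_norm, dist_eq_norm, ← sub_apply]
      calc ‖(G x - G y) h‖ ≤ ‖G x - G y‖ * ‖h‖ := (G x - G y).le_opNorm h
        _ ≤ M * ‖x - y‖ * 1 := by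
          gcongr
          exact hG.norm_sub_le (convex_closedBall z₀ ρ) (hsub hy) (hsub hx)
        _ = M * ‖x - y‖ := mul_one _
  obtain ⟨c, hc0, hc⟩ := exists_integralCurve_mem_closedBall zero_le_one hPL
  exact ⟨c, ⟨fun s hs => hsub (hc s hs).1, fun s hs => (hc s hs).2⟩, hc0,
    fun s hs => mem_closedBall_iff_norm.1 (hc s hs).1⟩

end IsFlatFrame

end FlatFrame

section FirstIntegral

variable {E : Type*} [NormedAddCommGroup E] [NormedSpace ℝ E]
  {H : Type*} [NormedAddCommGroup H] [NormedSpace ℝ H]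
  {p : E →L[ℝ] H} {G : E → H →L[ℝ] E}

theorem exists_isFlatFrame {z₀ : E} (hG : ContDiffAt ℝ 2 G z₀)
    (hp : ∀ᶠ z in 𝓝 z₀, ∀ h, p (G z h) = h)
    (hsymm : ∀ᶠ z in 𝓝 z₀, ∀ h k, fderiv ℝ G z (G z h) k = fderiv ℝ G z (G z k) h) :
    ∃ ρ > 0, ∃ M : ℝ, IsFlatFrame p G (closedBall z₀ ρ) M := by
  have hG' : ContDiffAt ℝ 1 (fderiv ℝ G) z₀ := hG.fderiv_right (by norm_num)
  obtain ⟨K, s, hs, hK⟩ := hG'.exists_lipschitzOnWith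
  have hdiff : ∀ᶠ z in 𝓝 z₀, DifferentiableAt ℝ G z :=
    (hG.eventually (by simp)).mono fun z hz => hz.differentiableAt (by simp)
  have hbound : ∀ᶠ z in 𝓝 z₀, ‖G z‖ < ‖G z₀‖ + 1 :=
    hG.continuousAt.norm.eventually_lt_const (lt_add_one _)
  have hbound' : ∀ᶠ z in 𝓝 z₀, ‖fderiv ℝ G z‖ < ‖fderiv ℝ G z₀‖ + 1 :=
    ((continuous_norm (E := E →L[ℝ] H →L[ℝ] E)).continuousAt.tendsto.comp
      hG'.continuousAt).eventually_lt_const (lt_add_one _)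
  obtain ⟨ρ, hρ, hball⟩ := nhds_basis_closedBall.eventually_iff.1
    (hdiff.and (hbound.and (hbound'.and (hp.and (hsymm.and hs)))))
  have hnorm := norm_nonneg (G z₀)
  have hnorm' := norm_nonneg (fderiv ℝ G z₀)
  refine ⟨ρ, hρ, 1 + K + ‖G z₀‖ + ‖fderiv ℝ G z₀‖, by linarith [K.2], fun z hz => (hball hz).1,
    fun z hz => ?_, fun z hz => ?_, fun z₁ hz₁ z₂ hz₂ => ?_, fun z hz => (hball hz).2.2.2.1,
    fun z hz => (hball hz).2.2.2.2.1⟩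
  · linarith [(hball hz).2.1, K.2]
  · linarith [(hball hz).2.2.1, K.2]
  · refine (hK.norm_sub_le (hball hz₂).2.2.2.2.2 (hball hz₁).2.2.2.2.2).trans ?_
    gcongr
    linarith

lemma eventually_norm_map_sub_lt (p : E →L[ℝ] H) (z₀ : E) {η : ℝ} (hη : 0 < η) :
    ∀ᶠ z in 𝓝 z₀, ‖p (z - z₀)‖ < η := by
  have hcont : ContinuousAt (fun z => ‖p (z - z₀)‖) z₀ := by fun_prop
  exact hcont.tendsto.eventually_lt_const (by simpa using hη)

/-- A first integral `π` of the distribution with frame `G`, in a quantitative form: `π` is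
constant to second order in the directions of the distribution, and its level sets are tangent to
second order to the distribution. -/
structure IsQuantitativeFirstIntegral (p : E →L[ℝ] H) (G : E → H →L[ℝ] E) (π : E → E) (U : Set E)
    (C : ℝ) : Prop where
  pos : 0 < C
  norm_sub_le : ∀ z₁ ∈ U, ∀ z₂ ∈ U,
    ‖π z₂ - π z₁‖ ≤ C * (‖z₂ - z₁ - G z₁ (p (z₂ - z₁))‖ + ‖z₂ - z₁‖ ^ 2)
  norm_le_of_eq : ∀ z₁ ∈ U, ∀ z₂ ∈ U, π z₂ = π z₁ →
    ‖z₂ - z₁ - G z₁ (p (z₂ - z₁))‖ ≤ C * ‖z₂ - z₁‖ ^ 2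

namespace IsFlatFrame

variable [CompleteSpace E] {z₀ : E} {ρ M : ℝ}

lemma exists_flowArc_to_transversal (hρ : 0 < ρ) (hG : IsFlatFrame p G (closedBall z₀ ρ) M) :
    ∃ (U : Set E) (c : E → ℝ → E), IsOpen U ∧ z₀ ∈ U ∧ ∀ z ∈ U, z ∈ closedBall z₀ (ρ / 2) ∧
      ‖p (z - z₀)‖ ≤ 1 ∧ IsFlowArc G (closedBall z₀ ρ) (-p (z - z₀)) (c z) ∧ c z 0 = z := by
  have hM : 0 < M := zero_lt_one.trans_le hG.one_le
  obtain ⟨U, hsub, hU, hz₀⟩ := _root_.mem_nhds_iff.1 ((eventually_norm_map_sub_lt p _ one_pos).and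
    ((eventually_norm_map_sub_lt p _ (show 0 < ρ / 2 / M by positivity)).and
      (closedBall_mem_nhds z₀ (half_pos hρ))))
  have harc : ∀ z ∈ U, ∃ c, IsFlowArc G (closedBall z₀ ρ) (-p (z - z₀)) c ∧ c 0 = z :=
    fun z hz => by
      obtain ⟨h_one, hz_M, hz_ball⟩ := hsub hz
      obtain ⟨c, hc, hc0, -⟩ := hG.exists_flowArc hz_ball (h := -p (z - z₀))
        (by rw [norm_neg]; exact h_one.le)
        (by rw [norm_neg, mul_comm]; exact ((lt_div_iff₀ hM).1 hz_M).le)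
      exact ⟨c, hc, hc0⟩
  choose! c hc hc0 using harc
  exact ⟨U, c, hU, hz₀, fun z hz => ⟨(hsub hz).2.2, (hsub hz).1.le, hc z hz, hc0 z hz⟩⟩

/-- The first integral sends `z` to the endpoint of the flow arc from `z` to the affine subspace
`z₀ + ker p`, which is transversal to the distribution. -/
theorem exists_isQuantitativeFirstIntegral (hρ : 0 < ρ)
    (hG : IsFlatFrame p G (closedBall z₀ ρ) M) :
    ∃ (π : E → E) (U : Set E) (C : ℝ), IsOpen U ∧ z₀ ∈ U ∧ U ⊆ closedBall z₀ (ρ / 2) ∧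
      IsQuantitativeFirstIntegral p G π U C := by
  have hM := hG.one_le
  obtain ⟨U, c, hU, hz₀, hc⟩ := hG.exists_flowArc_to_transversal hρ
  set Y : ℝ := 2 * M * (Real.exp M * (1 + M) * (‖p‖ + 1)) ^ 2 with hY
  have hY0 : 0 ≤ Y := by positivity
  have hconst : ∀ a d : ℝ, 0 ≤ a → Real.exp M * (a + 2 * M * (Real.exp M * (1 + M) *
      ((‖p‖ + 1) * d)) ^ 2) ≤ Real.exp M * (1 + Y) * (a + d ^ 2) := fun a d ha =>
    calc _ = Real.exp M * (a + Y * d ^ 2) := by rw [hY]; ring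
      _ ≤ Real.exp M * (a + Y * d ^ 2 + (Y * a + d ^ 2)) := by
        exact mul_le_mul_of_nonneg_left (le_add_of_nonneg_right
          (add_nonneg (mul_nonneg hY0 ha) (sq_nonneg d))) (Real.exp_pos M).le
      _ = _ := by ring
  have hdist : ∀ z₁ z₂ : E, ‖z₂ - z₁‖ ≤ (‖p‖ + 1) * ‖z₂ - z₁‖ := fun z₁ z₂ =>
    le_mul_of_one_le_left (norm_nonneg _) (by linarith [norm_nonneg p])
  have hparam : ∀ z₁ z₂ : E, ‖p (z₂ - z₀) - p (z₁ - z₀)‖ ≤ (‖p‖ + 1) * ‖z₂ - z₁‖ :=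
    fun z₁ z₂ => by
      rw [← map_sub, sub_sub_sub_cancel_right]
      exact p.le_of_opNorm_le (by linarith) _
  refine ⟨fun z => c z 1, U, Real.exp M * (1 + Y), hU, hz₀, fun z hz => (hc z hz).1,
    by positivity, fun z₁ hz₁ z₂ hz₂ => ?_, fun z₁ hz₁ z₂ hz₂ heq => ?_⟩
  · obtain ⟨-, hp₁, harc₁, hstart₁⟩ := hc z₁ hz₁
    obtain ⟨-, hp₂, harc₂, hstart₂⟩ := hc z₂ hz₂
    have hvar := hG.norm_variation_le (convex_closedBall _ _) harc₁ harc₂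
      (by rwa [norm_neg]) (by rwa [norm_neg]) (δ := (‖p‖ + 1) * ‖z₂ - z₁‖)
      (by rw [hstart₁, hstart₂]; exact hdist z₁ z₂)
      (by rw [← neg_sub', norm_neg]; exact hparam z₁ z₂) (p (z₂ - z₁))
    rw [← neg_sub', ← map_sub, sub_sub_sub_cancel_right, add_neg_cancel, map_zero, sub_zero,
      hstart₁, hstart₂] at hvar
    exact hvar.trans (hconst _ _ (norm_nonneg _))
  · obtain ⟨-, hp₁, harc₁, hstart₁⟩ := hc z₁ hz₁
    obtain ⟨-, hp₂, harc₂, hstart₂⟩ := hc z₂ hz₂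
    have hvar := hG.norm_variation_le (convex_closedBall _ _) harc₁.reverse harc₂.reverse
      (by rwa [neg_neg]) (by rwa [neg_neg]) (δ := (‖p‖ + 1) * ‖z₂ - z₁‖)
      (by simp only [sub_zero, heq, sub_self, norm_zero]; positivity)
      (by rw [neg_neg, neg_neg]; exact hparam z₁ z₂) 0
    simp only [neg_neg, sub_self, sub_zero, ← map_sub, sub_sub_sub_cancel_right, zero_add,
      hstart₁, hstart₂, heq, map_zero, norm_zero] at hvar
    rw [← zero_add (2 * M * _)] at hvar
    exact (hvar.trans (hconst 0 _ le_rfl)).trans_eq (by rw [zero_add])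

end IsFlatFrame

lemma isLittleO_sq_norm_of_hasDerivWithinAt {f : ℝ → E} {w : E} {s : Set ℝ} {t : ℝ}
    (hf : HasDerivWithinAt f w s t) :
    (fun τ => ‖f τ - f t‖ ^ 2) =o[𝓝[s] t] fun τ => τ - t := by
  have hO : (fun τ => f τ - f t) =O[𝓝[s] t] fun τ => τ - t := hf.hasFDerivWithinAt.isBigO_sub
  have ho : (fun τ => f τ - f t) =o[𝓝[s] t] fun _ => (1 : ℝ) := by
    rw [Asymptotics.isLittleO_one_iff]
    simpa only [sub_self] using hf.continuousWithinAt.tendsto.sub_const (f t)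
  simpa [pow_two] using hO.norm_left.mul_isLittleO ho.norm_left

lemma hasDerivWithinAt_sub_apply {f : ℝ → E} {w : E} {s : Set ℝ} {t : ℝ}
    (hf : HasDerivWithinAt f w s t) (L : E →L[ℝ] E) :
    HasDerivWithinAt (fun τ => f τ - f t - L (f τ - f t)) (w - L w) s t :=
  (hf.sub_const _).sub (L.hasFDerivAt.comp_hasDerivWithinAt t (hf.sub_const _))

namespace IsQuantitativeFirstIntegral

variable {π : E → E} {U : Set E} {C : ℝ}

lemma hasDerivWithinAt_zero (hπ : IsQuantitativeFirstIntegral p G π U C) {f : ℝ → E} {w : E}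
    {s : Set ℝ} {t : ℝ} (hf : HasDerivWithinAt f w s t) (hU : U ∈ 𝓝 (f t))
    (hw : G (f t) (p w) = w) : HasDerivWithinAt (π ∘ f) 0 s t := by
  have hdefect := hasDerivWithinAt_sub_apply hf ((G (f t)).comp p)
  simp only [ContinuousLinearMap.comp_apply, hw, sub_self, hasDerivWithinAt_iff_isLittleO,
    map_zero, sub_zero, smul_zero] at hdefect
  simp only [hasDerivWithinAt_iff_isLittleO, smul_zero, sub_zero, Function.comp_apply]
  refine Asymptotics.IsBigO.trans_isLittleO (Asymptotics.IsBigO.of_bound C ?_)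
    (hdefect.norm_left.add (isLittleO_sq_norm_of_hasDerivWithinAt hf))
  filter_upwards [hf.continuousWithinAt.eventually_mem hU] with τ hτ
  rw [Real.norm_of_nonneg (by positivity)]
  exact hπ.norm_sub_le _ (mem_of_mem_nhds hU) _ hτ

lemma apply_eq_of_eventually_eq (hπ : IsQuantitativeFirstIntegral p G π U C) {f : ℝ → E} {w : E}
    {t : ℝ} (hf : HasDerivAt f w t) (hU : U ∈ 𝓝 (f t)) (hconst : ∀ᶠ τ in 𝓝 t, π (f τ) = π (f t)) :
    G (f t) (p w) = w := by
  rw [← hasDerivWithinAt_univ] at hf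
  have hdefect := hasDerivWithinAt_sub_apply hf ((G (f t)).comp p)
  have hzero : HasDerivWithinAt (fun τ => f τ - f t - (G (f t)).comp p (f τ - f t)) 0 univ t := by
    simp only [hasDerivWithinAt_iff_isLittleO, sub_self, map_zero, sub_zero, smul_zero]
    refine Asymptotics.IsBigO.trans_isLittleO (Asymptotics.IsBigO.of_bound C ?_)
      (isLittleO_sq_norm_of_hasDerivWithinAt hf)
    rw [nhdsWithin_univ]
    filter_upwards [hconst, (hasDerivWithinAt_univ.1 hf).continuousAt.eventually_mem hU]
      with τ hτ hτU
    simpa using hπ.norm_le_of_eq _ (mem_of_mem_nhds hU) _ hτU hτ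
  exact (sub_eq_zero.1 ((hasDerivWithinAt_univ.1 hdefect).unique
    (hasDerivWithinAt_univ.1 hzero))).symm

lemma continuousAt (hπ : IsQuantitativeFirstIntegral p G π U C) {z : E} (hU : U ∈ 𝓝 z) :
    ContinuousAt π z := by
  rw [ContinuousAt, tendsto_iff_norm_sub_tendsto_zero]
  have hbound : Filter.Tendsto (fun x => C * (‖x - z - G z (p (x - z))‖ + ‖x - z‖ ^ 2)) (𝓝 z)
      (𝓝 0) := by
    have hcont : ContinuousAt (fun x => C * (‖x - z - G z (p (x - z))‖ + ‖x - z‖ ^ 2)) z := by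
      fun_prop
    simpa using hcont.tendsto
  refine squeeze_zero' (.of_forall fun _ => norm_nonneg _) ?_ hbound
  filter_upwards [hU] with x hx using hπ.norm_sub_le _ (mem_of_mem_nhds hU) _ hx

lemma eq_of_flowArc (hπ : IsQuantitativeFirstIntegral p G π U C) (hU : IsOpen U)
    (hG : ∀ z ∈ U, ∀ h, p (G z h) = h) {h : H} {c : ℝ → E} (hc : IsFlowArc G U h c) :
    π (c 1) = π (c 0) :=
  eq_left_of_hasDerivWithinAt_zero (f := π ∘ c) (fun s hs =>
    hπ.hasDerivWithinAt_zero (hc.hasDerivWithinAt s hs) (hU.mem_nhds (hc.mem s hs))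
      (by rw [hG _ (hc.mem s hs)])) (right_mem_Icc.2 zero_le_one)

lemma eq_of_apply_eq (hπ : IsQuantitativeFirstIntegral p G π U C) {z₁ z₂ : E} (hz₁ : z₁ ∈ U)
    (hz₂ : z₂ ∈ U) (heq : π z₂ = π z₁) (hp : p (z₂ - z₁) = 0) (hC : C * ‖z₂ - z₁‖ < 1) :
    z₂ = z₁ := by
  have hsq := hπ.norm_le_of_eq z₁ hz₁ z₂ hz₂ heq
  rw [hp, map_zero, sub_zero] at hsq
  refine sub_eq_zero.1 (norm_eq_zero.1 ?_)
  nlinarith [norm_nonneg (z₂ - z₁)]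

end IsQuantitativeFirstIntegral

lemma IsFlowArc.sub_eq {B : Set E} {h : H} {c : ℝ → E} (hc : IsFlowArc G B h c)
    (hG : ∀ z ∈ B, ∀ h, p (G z h) = h) : p (c 1 - c 0) = h := by
  have hderiv : ∀ s ∈ Icc (0 : ℝ) 1, HasDerivWithinAt (fun s => p (c s) - s • h) 0 (Icc 0 1) s :=
    fun s hs => by
      simpa [hG _ (hc.mem s hs)] using! (p.hasFDerivAt.comp_hasDerivWithinAt s
        (hc.hasDerivWithinAt s hs)).sub ((hasDerivWithinAt_id s (Icc (0 : ℝ) 1)).smul_const h)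
  have hconst := eq_left_of_hasDerivWithinAt_zero hderiv (right_mem_Icc.2 zero_le_one)
  rw [one_smul, zero_smul, sub_zero, sub_eq_iff_eq_add] at hconst
  rw [map_sub, hconst, add_sub_cancel_left]

/-- The flow arc from `z₁` with parameter `p (z₂ - z₁)` ends in the level set of `z₂`, at a point
which cannot be told from `z₂` by `p`; close to `z₁` this point can only be `z₂`. -/
theorem IsFlatFrame.eventually_exists_flowArc [CompleteSpace E] {π : E → E} {U : Set E} {C M ρ : ℝ}
    {z₀ z₁ : E} (hG : IsFlatFrame p G (closedBall z₀ ρ) M)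
    (hπ : IsQuantitativeFirstIntegral p G π U C) (hρ : 0 < ρ) (hU : IsOpen U)
    (hUρ : U ⊆ closedBall z₀ (ρ / 2)) (hz₁ : z₁ ∈ U) {O : Set E} (hO : O ∈ 𝓝 z₁) :
    ∀ᶠ z₂ in 𝓝 z₁, π z₂ = π z₁ → ∃ h c, IsFlowArc G O h c ∧ c 0 = z₁ ∧ c 1 = z₂ := by
  have hM : 0 < M := zero_lt_one.trans_le hG.one_le
  have hC := hπ.pos
  have hright : ∀ z ∈ U, ∀ h, p (G z h) = h := fun z hz =>
    hG.right_inv z (closedBall_subset_closedBall (half_le_self hρ.le) (hUρ hz))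
  obtain ⟨ε, hε, hball⟩ := Metric.mem_nhds_iff.1 (Filter.inter_mem (Filter.inter_mem hO
    (hU.mem_nhds hz₁)) (ball_mem_nhds z₁ (show 0 < 1 / C / 2 by positivity)))
  filter_upwards [eventually_norm_map_sub_lt p _ one_pos,
    eventually_norm_map_sub_lt p _ (show 0 < ρ / 2 / M by positivity),
    eventually_norm_map_sub_lt p _ (show 0 < ε / M by positivity), ball_mem_nhds z₁ hε]
    with z₂ h_one h_rho h_eps hz₂ heq
  obtain ⟨c, hc, hc0, hcM⟩ := hG.exists_flowArc (hUρ hz₁) h_one.le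
    (by rw [mul_comm]; exact ((lt_div_iff₀ hM).1 h_rho).le)
  have hc_near : ∀ s ∈ Icc (0 : ℝ) 1, c s ∈ ball z₁ ε := fun s hs => by
    rw [mem_ball_iff_norm]
    exact (hcM s hs).trans_lt (by rw [mul_comm]; exact (lt_div_iff₀ hM).1 h_eps)
  have hone : (1 : ℝ) ∈ Icc (0 : ℝ) 1 := right_mem_Icc.2 zero_le_one
  have hcU : IsFlowArc G U (p (z₂ - z₁)) c :=
    ⟨fun s hs => (hball (hc_near s hs)).1.2, hc.hasDerivWithinAt⟩
  refine ⟨_, c, ⟨fun s hs => (hball (hc_near s hs)).1.1, hc.hasDerivWithinAt⟩, hc0, ?_⟩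
  have hdist : ‖z₂ - c 1‖ < 1 / C := by
    rw [← dist_eq_norm]
    have h₁ := mem_ball.1 (hball (hc_near 1 hone)).2
    have h₂ := mem_ball.1 (hball hz₂).2
    linarith [dist_triangle_right z₂ (c 1) z₁]
  refine (hπ.eq_of_apply_eq (hball (hc_near 1 hone)).1.2 (hball hz₂).1.2 ?_ ?_ ?_).symm
  · rw [heq, hπ.eq_of_flowArc hU hright hcU, hc0]
  · rw [← sub_sub_sub_cancel_right z₂ (c 1) z₁, map_sub, sub_eq_zero, ← hc0,
      hcU.sub_eq hright, hc0]
  · rw [mul_comm]; exact (lt_div_iff₀ hC).1 hdist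

end FirstIntegral

section FieldDeriv

variable {E : Type*} [NormedAddCommGroup E] [NormedSpace ℝ E]
  {G : Type*} [NormedAddCommGroup G] [NormedSpace ℝ G]

lemma fderiv_lieBracket {X Y : E → E} {g : E → G} {x : E} (hX : DifferentiableAt ℝ X x)
    (hY : DifferentiableAt ℝ Y x) (hg : ContDiffAt ℝ 2 g x) :
    fderiv ℝ g x (VectorField.lieBracket ℝ X Y x) =
      fderiv ℝ (fun y => fderiv ℝ g y (Y y)) x (X x) -
        fderiv ℝ (fun y => fderiv ℝ g y (X y)) x (Y x) := by
  have hdiff : DifferentiableAt ℝ (fderiv ℝ g) x :=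
    (hg.fderiv_right (m := 1) (by norm_num)).differentiableAt (by norm_num)
  have hsymm : IsSymmSndFDerivAt ℝ g x := hg.isSymmSndFDerivAt (by simp)
  rw [fderiv_clm_apply hdiff hY, fderiv_clm_apply hdiff hX, VectorField.lieBracket]
  simp only [add_apply, ContinuousLinearMap.comp_apply, ContinuousLinearMap.flip_apply, map_sub]
  rw [hsymm.eq (X x) (Y x)]
  abel

variable {H : Type*} [TopologicalSpace H] (I : ModelWithCorners ℝ E H)
  {M : Type*} [TopologicalSpace M] [ChartedSpace H M]

/-- The derivative of the vector valued function `g` along the vector field `X`. -/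
def fieldDeriv (g : M → G) (X : ∀ x : M, TangentSpace I x) (x : M) : G :=
  mfderiv I 𝓘(ℝ, G) g x (X x)

/-- The coordinates of the vector field `X` in the preferred chart at `x`. -/
def chartField (x : M) (X : ∀ x : M, TangentSpace I x) : E → E :=
  VectorField.mpullbackWithin 𝓘(ℝ, E) I (extChartAt I x).symm X (range I)

variable {I}

lemma fieldDeriv_congr {g g' : M → G} {x : M} (h : g =ᶠ[𝓝 x] g')
    (X : ∀ x : M, TangentSpace I x) : fieldDeriv I g X x = fieldDeriv I g' X x :=
  congrArg (fun f : E →L[ℝ] G => f (X x)) h.mfderiv_eq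

lemma fieldDeriv_comp {E' : Type*} [NormedAddCommGroup E'] [NormedSpace ℝ E'] {f : M → E'}
    {g : E' → G} {x : M} (hg : DifferentiableAt ℝ g (f x)) (hf : MDifferentiableAt I 𝓘(ℝ, E') f x)
    (X : ∀ x : M, TangentSpace I x) :
    fieldDeriv I (g ∘ f) X x = fderiv ℝ g (f x) (fieldDeriv I f X x) := by
  have hcomp := mfderiv_comp (I := I) (I' := 𝓘(ℝ, E')) (I'' := 𝓘(ℝ, G)) x hg.mdifferentiableAt hf
  rw [mfderiv_eq_fderiv] at hcomp
  exact congrArg (fun T : E →L[ℝ] G => T (X x)) hcomp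

lemma differentiableAt_chartField [I.Boundaryless] [IsManifold I 2 M] [CompleteSpace E]
    {X : ∀ x : M, TangentSpace I x} {x : M}
    (hX : MDifferentiableAt I I.tangent (fun x => (⟨x, X x⟩ : TangentBundle I M)) x) :
    DifferentiableAt ℝ (chartField I x X) (extChartAt I x x) := by
  have hpull : DifferentiableWithinAt ℝ (chartField I x X)
      ((extChartAt I x).symm ⁻¹' univ ∩ range I) (extChartAt I x x) :=
    (mdifferentiableWithinAt_univ.2 hX).differentiableWithinAt_mpullbackWithin_vectorField
  rwa [preimage_univ, I.range_eq_univ, univ_inter, differentiableWithinAt_univ] at hpull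

variable [IsManifold I ∞ M]

lemma contMDiffOn_mfderiv_apply {E' : Type*} [NormedAddCommGroup E'] [NormedSpace ℝ E']
    {H' : Type*} [TopologicalSpace H'] {J : ModelWithCorners ℝ E' H'}
    {P : Type*} [TopologicalSpace P] [ChartedSpace H' P] {f : P → M}
    {a : ∀ y : P, TangentSpace I (f y)} {g : M → G} {U : Set M} {W : Set P} (hU : IsOpen U)
    (hg : ContMDiffOn I 𝓘(ℝ, G) ∞ g U)
    (ha : ContMDiffOn J I.tangent ∞ (fun y => (⟨f y, a y⟩ : TangentBundle I M)) W)
    (hf : MapsTo f W U) :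
    ContMDiffOn J 𝓘(ℝ, G) ∞ (fun y => (mfderiv I 𝓘(ℝ, G) g (f y) (a y) : G)) W := by
  have htangent :=
    (hg.contMDiffOn_tangentMapWithin (m := ∞) (by simp) hU.uniqueMDiffOn).comp ha hf
  refine ((contMDiff_snd_tangentBundle_modelSpace G 𝓘(ℝ, G)).comp_contMDiffOn htangent).congr
    fun y hy => ?_
  exact congrArg (fun T : E →L[ℝ] G => T (a y)) (mfderivWithin_of_isOpen hU (hf hy)).symm

lemma contMDiffOn_fieldDeriv {g : M → G} {X : ∀ x : M, TangentSpace I x} {U : Set M}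
    (hU : IsOpen U) (hg : ContMDiffOn I 𝓘(ℝ, G) ∞ g U) (hX : SmoothFieldOn I X U) :
    ContMDiffOn I 𝓘(ℝ, G) ∞ (fieldDeriv I g X) U :=
  contMDiffOn_mfderiv_apply hU hg hX (mapsTo_id U)

variable [I.Boundaryless]

lemma mdifferentiableAt_extChartAt_symm' {x : M} {z : E} (hz : z ∈ (extChartAt I x).target) :
    MDifferentiableAt 𝓘(ℝ, E) I (extChartAt I x).symm z := by
  have hwithin := mdifferentiableWithinAt_extChartAt_symm hz (I := I)
  rwa [I.range_eq_univ, mdifferentiableWithinAt_univ] at hwithin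

lemma fderiv_comp_extChartAt_symm {g : M → G} {x : M} {z : E} (hz : z ∈ (extChartAt I x).target)
    (hg : MDifferentiableAt I 𝓘(ℝ, G) g ((extChartAt I x).symm z))
    (X : ∀ x : M, TangentSpace I x) :
    fderiv ℝ (g ∘ (extChartAt I x).symm) z (chartField I x X z) =
      fieldDeriv I g X ((extChartAt I x).symm z) := by
  have hinv := isInvertible_mfderivWithin_extChartAt_symm (I := I) hz
  have hcomp := mfderiv_comp (I := 𝓘(ℝ, E)) (I' := I) (I'' := 𝓘(ℝ, G)) z hg
    (mdifferentiableAt_extChartAt_symm' hz)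
  rw [mfderiv_eq_fderiv] at hcomp
  rw [chartField, VectorField.mpullbackWithin_apply]
  rw [I.range_eq_univ, mfderivWithin_univ] at hinv ⊢
  exact (congrArg (fun f : E →L[ℝ] G => f _) hcomp).trans
    (congrArg _ (hinv.self_apply_inverse _))

lemma contDiffAt_comp_extChartAt_symm {g : M → G} {x : M} {n : ℕ∞}
    (hg : ContMDiffAt I 𝓘(ℝ, G) n g x) :
    ContDiffAt ℝ n (g ∘ (extChartAt I x).symm) (extChartAt I x x) := by
  have hsymm := contMDiffWithinAt_extChartAt_symm_range (n := n) (I := I) x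
    (mem_extChartAt_target x)
  rw [I.range_eq_univ, contMDiffWithinAt_univ] at hsymm
  rw [← contMDiffAt_iff_contDiffAt]
  exact ContMDiffAt.comp _ (by rwa [extChartAt_to_inv x]) hsymm

lemma fieldDeriv_extChartAt_mlieBracket {X Y : ∀ x : M, TangentSpace I x} (x : M) :
    fieldDeriv I (extChartAt I x) (VectorField.mlieBracket I X Y) x =
      VectorField.lieBracket ℝ (chartField I x X) (chartField I x Y) (extChartAt I x x) := by
  set L : E := VectorField.lieBracket ℝ (chartField I x X) (chartField I x Y) (extChartAt I x x)
  have hbracket : VectorField.mlieBracket I X Y x =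
      (mfderiv I 𝓘(ℝ, E) (extChartAt I x) x).inverse L := by
    rw [← VectorField.mlieBracketWithin_univ, VectorField.mlieBracketWithin_apply]
    have hwithin : VectorField.lieBracketWithin ℝ (chartField I x X) (chartField I x Y)
        ((extChartAt I x).symm ⁻¹' univ ∩ range I) (extChartAt I x x) = L := by
      rw [preimage_univ, I.range_eq_univ, univ_inter, VectorField.lieBracketWithin_univ]
    exact congrArg _ hwithin
  rw [fieldDeriv, hbracket]
  exact (isInvertible_mfderiv_extChartAt (mem_extChartAt_source x)).self_apply_inverse _

lemma fieldDeriv_eq_fderiv_extChartAt {g : M → G} {x : M} (hg : ContMDiffAt I 𝓘(ℝ, G) ∞ g x)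
    (X : ∀ x : M, TangentSpace I x) :
    fieldDeriv I g X x = fderiv ℝ (g ∘ (extChartAt I x).symm) (extChartAt I x x)
      (fieldDeriv I (extChartAt I x) X x) := by
  have hchart : g =ᶠ[𝓝 x] (g ∘ (extChartAt I x).symm) ∘ extChartAt I x := by
    filter_upwards [extChartAt_source_mem_nhds (I := I) x] with y hy
    simp only [Function.comp_apply, (extChartAt I x).left_inv hy]
  rw [fieldDeriv_congr hchart]
  exact fieldDeriv_comp ((contDiffAt_comp_extChartAt_symm hg).differentiableAt (by simp))
    (mdifferentiableAt_extChartAt (mem_chart_source H x)) X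

theorem fieldDeriv_mlieBracket [CompleteSpace E] {g : M → G} {X Y : ∀ x : M, TangentSpace I x}
    {U : Set M} (hU : IsOpen U) (hg : ContMDiffOn I 𝓘(ℝ, G) ∞ g U) (hX : SmoothFieldOn I X U)
    (hY : SmoothFieldOn I Y U) {x : M} (hx : x ∈ U) :
    fieldDeriv I g (VectorField.mlieBracket I X Y) x =
      fieldDeriv I (fieldDeriv I g Y) X x - fieldDeriv I (fieldDeriv I g X) Y x := by
  have hx0 : (extChartAt I x).symm (extChartAt I x x) = x := extChartAt_to_inv x
  have hgx : ContMDiffAt I 𝓘(ℝ, G) ∞ g x := (hg x hx).contMDiffAt (hU.mem_nhds hx)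
  have hnear : ∀ᶠ z in 𝓝 (extChartAt I x x),
      z ∈ (extChartAt I x).target ∧ (extChartAt I x).symm z ∈ U :=
    Filter.Eventually.and (extChartAt_target_mem_nhds x)
      ((continuousAt_extChartAt_symm x).eventually_mem (by rw [hx0]; exact hU.mem_nhds hx))
  have hfield : ∀ Z : ∀ x : M, TangentSpace I x, SmoothFieldOn I Z U →
      DifferentiableAt ℝ (chartField I x Z) (extChartAt I x x) := fun Z hZ => by
    have : IsManifold I 2 M := .of_le (n := ∞) (by norm_cast)
    exact differentiableAt_chartField
      (((hZ x hx).contMDiffAt (hU.mem_nhds hx)).mdifferentiableAt (by simp))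
  have hderiv : ∀ Z : ∀ x : M, TangentSpace I x,
      (fun z => fderiv ℝ (g ∘ (extChartAt I x).symm) z (chartField I x Z z))
        =ᶠ[𝓝 (extChartAt I x x)] fieldDeriv I g Z ∘ (extChartAt I x).symm := fun Z => by
    filter_upwards [hnear] with z hz
    exact fderiv_comp_extChartAt_symm hz.1
      (((hg _ hz.2).contMDiffAt (hU.mem_nhds hz.2)).mdifferentiableAt (by simp)) Z
  have hderiv' : ∀ Z Z' : ∀ x : M, TangentSpace I x, SmoothFieldOn I Z U →
      fderiv ℝ (fieldDeriv I g Z ∘ (extChartAt I x).symm) (extChartAt I x x)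
        (chartField I x Z' (extChartAt I x x)) = fieldDeriv I (fieldDeriv I g Z) Z' x :=
    fun Z Z' hZ => by
      have hsmooth : MDifferentiableAt I 𝓘(ℝ, G) (fieldDeriv I g Z)
          ((extChartAt I x).symm (extChartAt I x x)) := by
        rw [hx0]
        exact ((contMDiffOn_fieldDeriv hU hg hZ x hx).contMDiffAt
          (hU.mem_nhds hx)).mdifferentiableAt (by simp)
      rw [fderiv_comp_extChartAt_symm (mem_extChartAt_target x) hsmooth, hx0]
  rw [fieldDeriv_eq_fderiv_extChartAt hgx, fieldDeriv_extChartAt_mlieBracket,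
    fderiv_lieBracket (hfield X hX) (hfield Y hY)
      ((contDiffAt_comp_extChartAt_symm hgx).of_le (by norm_cast)),
    (hderiv X).fderiv_eq, (hderiv Y).fderiv_eq, hderiv' Y X hY, hderiv' X Y hX]

end FieldDeriv

section Velocity

variable {E : Type*} [NormedAddCommGroup E] [NormedSpace ℝ E]
  {H : Type*} [TopologicalSpace H] (I : ModelWithCorners ℝ E H)
  {M : Type*} [TopologicalSpace M] [ChartedSpace H M]

/-- The curve `c` has the velocity `u` at time `t`, within the set `s` of times. -/
def HasVelocity (c : ℝ → M) (s : Set ℝ) (t : ℝ) (u : E) : Prop :=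
  ContinuousWithinAt c s t ∧ HasDerivWithinAt (extChartAt I (c t) ∘ c) u s t

variable {I} {c : ℝ → M} {s : Set ℝ} {t : ℝ} {u : E}
  {E' : Type*} [NormedAddCommGroup E'] [NormedSpace ℝ E']
  {H' : Type*} [TopologicalSpace H'] {I' : ModelWithCorners ℝ E' H'}
  {M' : Type*} [TopologicalSpace M'] [ChartedSpace H' M']

lemma HasVelocity.mono {s' : Set ℝ} (h : HasVelocity I c s t u) (hs : s' ⊆ s) :
    HasVelocity I c s' t u :=
  ⟨h.1.mono hs, h.2.mono hs⟩

lemma HasVelocity.unique {u' : E} (h : HasVelocity I c univ t u) (h' : HasVelocity I c univ t u') :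
    u = u' :=
  (hasDerivWithinAt_univ.1 h.2).unique (hasDerivWithinAt_univ.1 h'.2)

lemma HasVelocity.congr {c' : ℝ → M} (h : HasVelocity I c univ t u) (hc : c' =ᶠ[𝓝 t] c) :
    HasVelocity I c' univ t u := by
  refine ⟨(((continuousWithinAt_univ _ _).1 h.1).congr hc.symm).continuousWithinAt, ?_⟩
  rw [hc.eq_of_nhds]
  exact ((hasDerivWithinAt_univ.1 h.2).congr_of_eventuallyEq (hc.fun_comp _)).hasDerivWithinAt

lemma hasVelocity_vector {c : ℝ → E} :
    HasVelocity 𝓘(ℝ, E) c s t u ↔ HasDerivWithinAt c u s t := by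
  rw [HasVelocity, extChartAt_model_space_eq_id]
  exact ⟨fun h => h.2, fun h => ⟨h.continuousWithinAt, h⟩⟩

lemma hasMFDerivWithinAt_real_iff {f' : ℝ →L[ℝ] E} :
    HasMFDerivWithinAt 𝓘(ℝ, ℝ) I c s t f' ↔
      ContinuousWithinAt c s t ∧ HasFDerivWithinAt (extChartAt I (c t) ∘ c) f' s t := by
  have hset : (extChartAt 𝓘(ℝ, ℝ) t).symm ⁻¹' s ∩ range 𝓘(ℝ, ℝ) = s := by
    rw [extChartAt_model_space_eq_id, ModelWithCorners.range_eq_univ, inter_univ]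
    rfl
  unfold HasMFDerivWithinAt writtenInExtChartAt
  rw [hset, extChartAt_model_space_eq_id]
  rfl

lemma HasVelocity.hasMFDerivWithinAt (h : HasVelocity I c s t u) :
    HasMFDerivWithinAt 𝓘(ℝ, ℝ) I c s t (ContinuousLinearMap.toSpanSingleton ℝ u : ℝ →L[ℝ] E) :=
  hasMFDerivWithinAt_real_iff.2 ⟨h.1, h.2.hasFDerivWithinAt⟩

lemma hasVelocity_of_hasMFDerivWithinAt {f' : ℝ →L[ℝ] E}
    (h : HasMFDerivWithinAt 𝓘(ℝ, ℝ) I c s t f') : HasVelocity I c s t (f' 1) :=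
  ⟨(hasMFDerivWithinAt_real_iff.1 h).1, (hasMFDerivWithinAt_real_iff.1 h).2.hasDerivWithinAt⟩

lemma hasVelocity_mfderivWithin (h : MDifferentiableWithinAt 𝓘(ℝ, ℝ) I c s t) :
    HasVelocity I c s t (mfderivWithin 𝓘(ℝ, ℝ) I c s t (1 : ℝ)) :=
  hasVelocity_of_hasMFDerivWithinAt h.hasMFDerivWithinAt

lemma HasVelocity.comp {f : M → M'} (h : HasVelocity I c s t u)
    (hf : MDifferentiableAt I I' f (c t)) :
    HasVelocity I' (f ∘ c) s t (mfderiv I I' f (c t) u) := by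
  have hcomp := hasVelocity_of_hasMFDerivWithinAt
    (hf.hasMFDerivAt.comp_hasMFDerivWithinAt t h.hasMFDerivWithinAt)
  have hone : (mfderiv I I' f (c t) ((1 : ℝ) • u) : E') = mfderiv I I' f (c t) u :=
    congrArg (mfderiv I I' f (c t)) (one_smul ℝ u)
  rw [← hone]
  exact hcomp

lemma HasVelocity.comp_of_eq {f : M → M'} {x : M} (h : HasVelocity I c s t u) (hx : c t = x)
    (hf : MDifferentiableAt I I' f x) : HasVelocity I' (f ∘ c) s t (mfderiv I I' f x u) := by
  subst hx
  exact h.comp hf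

lemma mem_tangentTo_iff {S : Set M} {x : M} {u : E} :
    (⟨x, u⟩ : TangentBundle I M) ∈ tangentTo I S ↔
      ∃ c : ℝ → M, c 0 = x ∧ HasVelocity I c univ 0 u ∧ ∀ᶠ t in 𝓝 (0 : ℝ), c t ∈ S := by
  constructor
  · rintro ⟨c, hc, hS, hv⟩
    obtain rfl : c 0 = x := congrArg Bundle.TotalSpace.proj hv
    have hvel := hasVelocity_mfderivWithin (mdifferentiableWithinAt_univ.2 hc)
    have hu : (mfderiv 𝓘(ℝ, ℝ) I c 0 (1 : ℝ) : E) = u :=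
      eq_of_heq ((Bundle.TotalSpace.mk.injEq _ _ _ _).mp hv).2
    rw [mfderivWithin_univ, hu] at hvel
    exact ⟨c, rfl, hvel, hS⟩
  · rintro ⟨c, rfl, hv, hS⟩
    have hderiv := hasMFDerivWithinAt_univ.1 hv.hasMFDerivWithinAt
    refine ⟨c, hderiv.mdifferentiableAt, hS, ?_⟩
    rw [velocity, hderiv.mfderiv]
    congr 1
    exact one_smul ℝ u

lemma base_mem_of_mem_tangentTo {S : Set M} {δ : TangentBundle I M} (h : δ ∈ tangentTo I S) :
    δ.1 ∈ S := by
  obtain ⟨c, -, hS, rfl⟩ := h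
  exact hS.self_of_nhds

end Velocity

section Power

variable {B : Type*} [NormedAddCommGroup B] [NormedSpace ℝ B]
  {V : Type*} [TopologicalSpace V] [ChartedSpace B V] {N : ℕ}

instance instBoundarylessPow : (powModel B N).Boundaryless :=
  ⟨by simp [powModel, ModelWithCorners.pi]⟩

lemma hasVelocity_pow {c : ℝ → Fin N → V} {s : Set ℝ} {t : ℝ} {δ : Fin N → B} :
    HasVelocity (powModel B N) c s t δ ↔
      ∀ k, HasVelocity 𝓘(ℝ, B) (fun t => c t k) s t (δ k) := by
  unfold HasVelocity
  rw [continuousWithinAt_pi, hasDerivWithinAt_pi]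
  exact forall_and.symm

lemma eval_comp_extChartAt_symm (k : Fin N) (w : Fin N → V) :
    extChartAt 𝓘(ℝ, B) (w k) ∘ (fun w : Fin N → V => w k) ∘ (extChartAt (powModel B N) w).symm
      =ᶠ[𝓝 (extChartAt (powModel B N) w w)] (ContinuousLinearMap.proj k : (Fin N → B) →L[ℝ] B) := by
  filter_upwards [extChartAt_target_mem_nhds (I := powModel B N) w] with z hz
  refine (extChartAt 𝓘(ℝ, B) (w k)).right_inv ?_
  rw [extChartAt_target] at hz ⊢
  exact ⟨hz.1 k trivial, by simp⟩

lemma contMDiff_eval (k : Fin N) :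
    ContMDiff (powModel B N) 𝓘(ℝ, B) ∞ (fun w : Fin N → V => w k) := by
  intro w
  rw [contMDiffAt_iff]
  refine ⟨continuousAt_apply k w, ?_⟩
  rw [(powModel B N).range_eq_univ, contDiffWithinAt_univ]
  exact (ContinuousLinearMap.contDiff _).contDiffAt.congr_of_eventuallyEq
    (eval_comp_extChartAt_symm k w)

lemma mfderiv_eval (k : Fin N) (w : Fin N → V) :
    mfderiv (powModel B N) 𝓘(ℝ, B) (fun w : Fin N → V => w k) w =
      (ContinuousLinearMap.proj k : (Fin N → B) →L[ℝ] B) := by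
  have hproj := (ContinuousLinearMap.proj k : (Fin N → B) →L[ℝ] B).hasFDerivAt.congr_of_eventuallyEq
    (eval_comp_extChartAt_symm k w)
  exact HasMFDerivAt.mfderiv ⟨continuousAt_apply k w, hproj.hasFDerivWithinAt⟩

lemma entry_mk (w : Fin N → V) (δ : Fin N → B) (k : Fin N) :
    (DCLS.entry (⟨w, δ⟩ : TangentBundle (powModel B N) (Fin N → V)) k : B) = δ k :=
  congrArg (fun f : (Fin N → B) →L[ℝ] B => f δ) (mfderiv_eval k w)

end Power

section Lift

variable {E : Type*} [NormedAddCommGroup E] [NormedSpace ℝ E]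
  {F : Type*} [NormedAddCommGroup F] [NormedSpace ℝ F] [FiniteDimensional ℝ F]

/-- With `R` a right inverse of `f'`, the map `(t, a) ↦ (t, f (x + t ξ + R (a - t f' ξ)))` has
the identity as its derivative at `0`, hence a local inverse. -/
lemma exists_localSection {f : E → F} {f' : E →L[ℝ] F} {x : E} (hf : HasStrictFDerivAt f f' x)
    (hsurj : Function.Surjective f') (ξ : E) :
    ∃ (σ : ℝ × F → E) (σ' : ℝ × F →L[ℝ] E), HasFDerivAt σ σ' (0, f x) ∧ σ (0, f x) = x ∧
      σ' (1, f' ξ) = ξ ∧ ∀ᶠ q in 𝓝 (0, f x), f (σ q) = q.2 ∧ ContinuousAt σ q := by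
  obtain ⟨R, hR⟩ := f'.exists_rightInverse_of_surjective (LinearMap.range_eq_top.2 hsurj)
  have hRa : ∀ a, f' (R a) = a := fun a => congrArg (fun T : F →L[ℝ] F => T a) hR
  let g : ℝ × F →L[ℝ] E := (ContinuousLinearMap.fst ℝ ℝ F).smulRight ξ +
    R.comp (.snd ℝ ℝ F - (ContinuousLinearMap.fst ℝ ℝ F).smulRight (f' ξ))
  have hfg : f'.comp g = .snd ℝ ℝ F := by ext <;> simp [g, hRa]
  have hcomp : HasStrictFDerivAt (fun q => f (x + g q)) (.snd ℝ ℝ F) 0 := by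
    rw [← hfg]
    refine HasStrictFDerivAt.comp (g := f) 0 ?_ (g.hasStrictFDerivAt.const_add x)
    rwa [map_zero, add_zero]
  have hΘ : HasStrictFDerivAt (fun q : ℝ × F => (q.1, f (x + g q)))
      (ContinuousLinearEquiv.refl ℝ (ℝ × F) : ℝ × F →L[ℝ] ℝ × F) 0 :=
    (ContinuousLinearMap.fst ℝ ℝ F).hasStrictFDerivAt.prodMk hcomp
  set e := hΘ.toOpenPartialHomeomorph
  have he0 : e 0 = (0, f x) := by
    change ((0 : ℝ × F).1, f (x + g 0)) = _
    rw [map_zero, add_zero, Prod.fst_zero]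
  have hsource : (0 : ℝ × F) ∈ e.source := hΘ.mem_toOpenPartialHomeomorph_source
  have hinv : HasFDerivAt e.symm (.id ℝ (ℝ × F)) (0, f x) := by
    rw [← he0]
    exact hΘ.to_localInverse.hasFDerivAt
  refine ⟨fun q => x + g (e.symm q), g, (g.hasFDerivAt.comp _ hinv).const_add x, ?_, ?_, ?_⟩
  · change x + g (e.symm (0, f x)) = x
    rw [← he0, e.left_inv hsource, map_zero, add_zero]
  · simp [g]
  · filter_upwards [e.open_target.mem_nhds (he0 ▸ e.map_source hsource)] with q hq
    exact ⟨congrArg Prod.snd (e.right_inv hq),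
      continuousAt_const.add (g.continuous.continuousAt.comp (e.continuousAt_symm hq))⟩

lemma exists_lift_curve {f : E → F} {f' : E →L[ℝ] F} {x ξ : E} (hf : HasStrictFDerivAt f f' x)
    (hsurj : Function.Surjective f') {y : ℝ → F} (hy : HasDerivAt y (f' ξ) 0) (hy0 : y 0 = f x) :
    ∃ c : ℝ → E, c 0 = x ∧ HasDerivAt c ξ 0 ∧ (∀ᶠ t in 𝓝 0, f (c t) = y t) ∧
      ((∀ᶠ t in 𝓝 0, ContinuousAt y t) → ∀ᶠ t in 𝓝 0, ContinuousAt c t) := by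
  obtain ⟨σ, σ', hσ, hσ0, hσξ, hsec⟩ := exists_localSection hf hsurj ξ
  rw [← hy0] at hσ hσ0 hsec
  have hgraph : HasDerivAt (fun t => (t, y t)) (1, f' ξ) 0 := (hasDerivAt_id 0).prodMk hy
  have hnear := hgraph.continuousAt.eventually hsec
  refine ⟨fun t => σ (t, y t), hσ0, ?_, hnear.mono fun t ht => ht.1, fun hcont => ?_⟩
  · rw [← hσξ]
    exact HasFDerivAt.comp_hasDerivAt (f := fun t => (t, y t)) 0 hσ hgraph
  · filter_upwards [hnear, hcont] with t ht hyt
    exact ContinuousAt.comp (f := fun t => (t, y t)) ht.2 (continuousAt_id.prodMk hyt)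

end Lift

section Submanifold

variable {B : Type*} [NormedAddCommGroup B] [NormedSpace ℝ B]
  {V : Type*} [TopologicalSpace V] [ChartedSpace B V]

lemma mdifferentiable_of_mem_maximalAtlas {φ : OpenPartialHomeomorph V B}
    (hφ : φ ∈ IsManifold.maximalAtlas 𝓘(ℝ, B) ∞ V) : φ.MDifferentiable 𝓘(ℝ, B) 𝓘(ℝ, B) :=
  ⟨(contMDiffOn_of_mem_maximalAtlas hφ).mdifferentiableOn (by simp),
    (contMDiffOn_symm_of_mem_maximalAtlas hφ).mdifferentiableOn (by simp)⟩

lemma exists_equiv_mfderiv_of_mem_maximalAtlas {φ : OpenPartialHomeomorph V B}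
    (hφ : φ ∈ IsManifold.maximalAtlas 𝓘(ℝ, B) ∞ V) {v : V} (hv : v ∈ φ.source) :
    ∃ e : B ≃L[ℝ] B, (∀ u : B, (mfderiv 𝓘(ℝ, B) 𝓘(ℝ, B) φ v u : B) = e u) ∧
      ∀ u : B, (mfderiv 𝓘(ℝ, B) 𝓘(ℝ, B) φ.symm (φ v) u : B) = e.symm u :=
  ⟨(mdifferentiable_of_mem_maximalAtlas hφ).mfderiv hv, fun _ => rfl, fun _ => rfl⟩

lemma hasVelocity_symm_comp {φ : OpenPartialHomeomorph V B}
    (hφ : φ ∈ IsManifold.maximalAtlas 𝓘(ℝ, B) ∞ V) {v : V} (hv : v ∈ φ.source) {l : ℝ → B}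
    (hl0 : l 0 = φ v) {u : B} (hl : HasDerivAt l (mfderiv 𝓘(ℝ, B) 𝓘(ℝ, B) φ v u : B) 0) :
    HasVelocity 𝓘(ℝ, B) (φ.symm ∘ l) univ 0 u := by
  obtain ⟨e, he, hesymm⟩ := exists_equiv_mfderiv_of_mem_maximalAtlas hφ hv
  have hvel := (hasVelocity_vector.2 hl.hasDerivWithinAt).comp_of_eq (s := univ) hl0
    ((mdifferentiable_of_mem_maximalAtlas hφ).mdifferentiableAt_symm (φ.map_source hv))
  have hcancel : (mfderiv 𝓘(ℝ, B) 𝓘(ℝ, B) φ.symm (φ v)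
      (mfderiv 𝓘(ℝ, B) 𝓘(ℝ, B) φ v u : B) : B) = u :=
    (hesymm _).trans ((congrArg e.symm (he u)).trans (e.symm_apply_apply u))
  rwa [← hcancel]

lemma hasDerivAt_add_smul (b w : B) : HasDerivAt (fun t : ℝ => b + t • w) w 0 := by
  simpa only [id_eq, one_smul] using ((hasDerivAt_id (0 : ℝ)).smul_const w).const_add b

section Chart

variable {A : Type*} [NormedAddCommGroup A] [NormedSpace ℝ A]
  {Q : Type*} [TopologicalSpace Q] [ChartedSpace A Q] {f : V → Q}
  {φ : OpenPartialHomeomorph V B} {v : V}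

lemma contDiffAt_extChartAt_comp_comp_symm
    (hf : ContMDiff 𝓘(ℝ, B) 𝓘(ℝ, A) ∞ f) (hφ : φ ∈ IsManifold.maximalAtlas 𝓘(ℝ, B) ∞ V)
    (hv : v ∈ φ.source) :
    ContDiffAt ℝ ∞ (extChartAt 𝓘(ℝ, A) (f v) ∘ f ∘ φ.symm) (φ v) := by
  rw [← contMDiffAt_iff_contDiffAt]
  refine ContMDiffAt.comp (I' := 𝓘(ℝ, A)) (φ v) ?_ ((hf _).comp (φ v)
    (contMDiffAt_symm_of_mem_maximalAtlas hφ (φ.map_source hv)))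
  simp only [Function.comp_apply, φ.left_inv hv]
  exact contMDiffAt_extChartAt

lemma fderiv_extChartAt_comp_comp_symm
    (hf : ContMDiff 𝓘(ℝ, B) 𝓘(ℝ, A) ∞ f) (hφ : φ ∈ IsManifold.maximalAtlas 𝓘(ℝ, B) ∞ V)
    (hv : v ∈ φ.source) (u : B) :
    fderiv ℝ (extChartAt 𝓘(ℝ, A) (f v) ∘ f ∘ φ.symm) (φ v)
      (mfderiv 𝓘(ℝ, B) 𝓘(ℝ, B) φ v u : B) = (mfderiv 𝓘(ℝ, B) 𝓘(ℝ, A) f v u : A) := by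
  set w : B := mfderiv 𝓘(ℝ, B) 𝓘(ℝ, B) φ v u
  have hline : φ v + (0 : ℝ) • w = φ v := by rw [zero_smul, add_zero]
  have hsymm : φ.symm (φ v + (0 : ℝ) • w) = v := by rw [hline, φ.left_inv hv]
  have hvel := (hasVelocity_symm_comp hφ hv hline (hasDerivAt_add_smul _ w)).comp_of_eq hsymm
    ((hf v).mdifferentiableAt (by simp))
  have hderiv := hasDerivWithinAt_univ.1 hvel.2
  simp only [Function.comp_apply, hsymm] at hderiv
  have hchart := ((contDiffAt_extChartAt_comp_comp_symm hf hφ hv).differentiableAt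
    (by simp)).hasFDerivAt
  rw [← hline] at hchart
  have hline_deriv := hchart.comp_hasDerivAt (0 : ℝ) (hasDerivAt_add_smul (φ v) w)
  rw [hline] at hline_deriv
  exact hline_deriv.unique hderiv

end Chart

variable [FiniteDimensional ℝ B]

lemma mem_submodule_of_hasDerivAt {L : Submodule ℝ B} {c : ℝ → B} {u : B}
    (hc : HasDerivAt c u 0) (hL : ∀ᶠ t in 𝓝 (0 : ℝ), c t ∈ L) : u ∈ L := by
  refine L.closed_of_finiteDimensional.mem_of_tendsto (hasDerivAt_iff_tendsto_slope.1 hc) ?_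
  filter_upwards [hL.filter_mono nhdsWithin_le_nhds] with t ht
  rw [slope_def_module]
  exact L.smul_mem _ (L.sub_mem ht hL.self_of_nhds)

lemma mem_tangentTo_submanifold_iff {S : Set V} {φ : OpenPartialHomeomorph V B}
    (hφ : φ ∈ IsManifold.maximalAtlas 𝓘(ℝ, B) ∞ V) {L : Submodule ℝ B}
    (hL : ∀ y ∈ φ.source, y ∈ S ↔ φ y ∈ L) {v : V} (hv : v ∈ φ.source) (hvS : v ∈ S) (u : B) :
    (⟨v, u⟩ : TangentBundle 𝓘(ℝ, B) V) ∈ tangentTo 𝓘(ℝ, B) S ↔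
      (mfderiv 𝓘(ℝ, B) 𝓘(ℝ, B) φ v u : B) ∈ L := by
  rw [mem_tangentTo_iff]
  constructor
  · rintro ⟨c, rfl, hc, hcS⟩
    have hvel := hc.comp ((mdifferentiable_of_mem_maximalAtlas hφ).mdifferentiableAt hv)
    refine mem_submodule_of_hasDerivAt (B := B)
      (hasDerivWithinAt_univ.1 (hasVelocity_vector.1 hvel)) ?_
    have hcont : ContinuousAt c 0 := (continuousWithinAt_univ _ _).1 hc.1
    filter_upwards [hcS, hcont.eventually_mem (φ.open_source.mem_nhds hv)] with t htS htφ
    exact (hL _ htφ).1 htS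
  · intro hu
    set w : B := mfderiv 𝓘(ℝ, B) 𝓘(ℝ, B) φ v u
    have hline : φ v + (0 : ℝ) • w = φ v := by rw [zero_smul, add_zero]
    have hderiv := hasDerivAt_add_smul (φ v) w
    refine ⟨φ.symm ∘ fun t => φ v + t • w, ?_, hasVelocity_symm_comp hφ hv hline hderiv, ?_⟩
    · rw [Function.comp_apply, hline, φ.left_inv hv]
    · filter_upwards [hderiv.continuousAt.eventually_mem
        (φ.open_target.mem_nhds (by rw [hline]; exact φ.map_source hv))] with t ht
      rw [Function.comp_apply, hL _ (φ.map_target ht), φ.right_inv ht]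
      exact L.add_mem ((hL v hv).1 hvS) (L.smul_mem _ hu)

lemma IsEmbeddedSubmanifold.exists_tangent {S : Set V} {d : ℕ}
    (hS : IsEmbeddedSubmanifold (E := B) S d) {v : V} (hv : v ∈ S) :
    ∃ T : Submodule ℝ B, Module.finrank ℝ T = d ∧
      ∀ u : B, (⟨v, u⟩ : TangentBundle 𝓘(ℝ, B) V) ∈ tangentTo 𝓘(ℝ, B) S ↔ u ∈ T := by
  obtain ⟨φ, hφ, hvφ, L, hLd, hL⟩ := hS v hv
  obtain ⟨e, he, -⟩ := exists_equiv_mfderiv_of_mem_maximalAtlas hφ hvφ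
  refine ⟨L.map (e.symm.toLinearEquiv : B →ₗ[ℝ] B), ?_, fun u => ?_⟩
  · rw [LinearEquiv.finrank_map_eq, hLd]
  · rw [mem_tangentTo_submanifold_iff hφ hL hvφ hv, he]
    exact (Submodule.mem_map_equiv (e := e.symm.toLinearEquiv) L).symm

variable {A : Type*} [NormedAddCommGroup A] [NormedSpace ℝ A] [FiniteDimensional ℝ A]
  {Q : Type*} [TopologicalSpace Q] [ChartedSpace A Q]

variable {S : Set V} {f : V → Q} {v : V} {u : B} {y : ℝ → Q}

lemma exists_lift_curve_chart (hf : ContMDiff 𝓘(ℝ, B) 𝓘(ℝ, A) ∞ f)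
    {φ : OpenPartialHomeomorph V B} (hφ : φ ∈ IsManifold.maximalAtlas 𝓘(ℝ, B) ∞ V)
    {L : Submodule ℝ B} (hL : ∀ y ∈ φ.source, y ∈ S ↔ φ y ∈ L) (hvφ : v ∈ φ.source) (hv : v ∈ S)
    (hsurj : ∀ a : A, ∃ u : B, (⟨v, u⟩ : TangentBundle 𝓘(ℝ, B) V) ∈ tangentTo 𝓘(ℝ, B) S ∧
      (mfderiv 𝓘(ℝ, B) 𝓘(ℝ, A) f v u : A) = a)
    (hu : (⟨v, u⟩ : TangentBundle 𝓘(ℝ, B) V) ∈ tangentTo 𝓘(ℝ, B) S)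
    (hy0 : y 0 = f v)
    (hy : HasVelocity 𝓘(ℝ, A) y univ 0 (mfderiv 𝓘(ℝ, B) 𝓘(ℝ, A) f v u : A)) :
    ∃ c : ℝ → L, (c 0 : B) = φ v ∧
      HasDerivAt (fun t => (c t : B)) (mfderiv 𝓘(ℝ, B) 𝓘(ℝ, B) φ v u : B) 0 ∧
      (∀ᶠ t in 𝓝 0, extChartAt 𝓘(ℝ, A) (f v) (f (φ.symm (c t))) =
        extChartAt 𝓘(ℝ, A) (f v) (y t)) ∧
      ((∀ᶠ t in 𝓝 0, ContinuousAt (extChartAt 𝓘(ℝ, A) (f v) ∘ y) t) →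
        ∀ᶠ t in 𝓝 0, ContinuousAt c t) := by
  set ψ := extChartAt 𝓘(ℝ, A) (f v)
  set f' := (fderiv ℝ (ψ ∘ f ∘ φ.symm) (φ v)).comp L.subtypeL
  have htangent := mem_tangentTo_submanifold_iff hφ hL hvφ hv
  have hstrict : HasStrictFDerivAt (fun l : L => ψ (f (φ.symm l))) f' ⟨φ v, (hL v hvφ).1 hv⟩ :=
    ((contDiffAt_extChartAt_comp_comp_symm hf hφ hvφ).hasStrictFDerivAt (by simp)).comp
      (⟨φ v, _⟩ : L) L.subtypeL.hasStrictFDerivAt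
  have hf' : ∀ u, (hu : (⟨v, u⟩ : TangentBundle 𝓘(ℝ, B) V) ∈ tangentTo 𝓘(ℝ, B) S) →
      f' ⟨_, (htangent u).1 hu⟩ = (mfderiv 𝓘(ℝ, B) 𝓘(ℝ, A) f v u : A) := fun u _ =>
    fderiv_extChartAt_comp_comp_symm hf hφ hvφ u
  have hsurj' : Function.Surjective f' := fun a => by
    obtain ⟨w, hw, rfl⟩ := hsurj a
    exact ⟨_, hf' w hw⟩
  have hyψ : HasDerivAt (ψ ∘ y) (f' ⟨_, (htangent u).1 hu⟩) 0 := by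
    rw [hf' u hu]
    have hderiv := hasDerivWithinAt_univ.1 hy.2
    rwa [hy0] at hderiv
  obtain ⟨c, hc0, hc, hcy, hcont⟩ := exists_lift_curve hstrict hsurj' hyψ
    (by rw [Function.comp_apply, hy0, φ.left_inv hvφ])
  exact ⟨c, congrArg Subtype.val hc0, L.subtypeL.hasFDerivAt.comp_hasDerivAt 0 hc, hcy, hcont⟩

lemma IsEmbeddedSubmanifold.exists_lift_curve {d : ℕ}
    (hS : IsEmbeddedSubmanifold (E := B) S d) (hf : ContMDiff 𝓘(ℝ, B) 𝓘(ℝ, A) ∞ f) (hv : v ∈ S)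
    (hsurj : ∀ a : A, ∃ u : B, (⟨v, u⟩ : TangentBundle 𝓘(ℝ, B) V) ∈ tangentTo 𝓘(ℝ, B) S ∧
      (mfderiv 𝓘(ℝ, B) 𝓘(ℝ, A) f v u : A) = a)
    (hu : (⟨v, u⟩ : TangentBundle 𝓘(ℝ, B) V) ∈ tangentTo 𝓘(ℝ, B) S)
    (hy0 : y 0 = f v)
    (hy : HasVelocity 𝓘(ℝ, A) y univ 0 (mfderiv 𝓘(ℝ, B) 𝓘(ℝ, A) f v u : A)) :
    ∃ c : ℝ → V, c 0 = v ∧ HasVelocity 𝓘(ℝ, B) c univ 0 u ∧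
      (∀ᶠ t in 𝓝 0, c t ∈ S ∧ f (c t) = y t) ∧
      ((∀ᶠ t in 𝓝 0, ContinuousAt y t) → ∀ᶠ t in 𝓝 0, ContinuousAt c t) := by
  obtain ⟨φ, hφ, hvφ, L, -, hL⟩ := hS v hv
  obtain ⟨l, hl0, hl, hly, hlcont⟩ :=
    exists_lift_curve_chart hf hφ hL hvφ hv hsurj hu hy0 hy
  set c : ℝ → V := φ.symm ∘ fun t => (l t : B)
  have hc0 : c 0 = v := (congrArg φ.symm hl0).trans (φ.left_inv hvφ)
  have hc : HasVelocity 𝓘(ℝ, B) c univ 0 u := hasVelocity_symm_comp hφ hvφ hl0 hl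
  have htarget : ∀ᶠ t in 𝓝 0, (l t : B) ∈ φ.target := hl.continuousAt.eventually_mem
    (φ.open_target.mem_nhds (by rw [hl0]; exact φ.map_source hvφ))
  have hsource : ∀ᶠ t in 𝓝 0, f (c t) ∈ (extChartAt 𝓘(ℝ, A) (f v)).source :=
    (hf.continuous.continuousAt.comp ((continuousWithinAt_univ _ _).1 hc.1)).eventually_mem
      (by rw [Function.comp_apply, hc0]; exact extChartAt_source_mem_nhds (f v))
  have hsource_y : ∀ᶠ t in 𝓝 0, y t ∈ (extChartAt 𝓘(ℝ, A) (f v)).source :=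
    ((continuousWithinAt_univ _ _).1 hy.1).eventually_mem
      (by rw [hy0]; exact extChartAt_source_mem_nhds (f v))
  refine ⟨c, hc0, hc, ?_, fun hycont => ?_⟩
  · filter_upwards [htarget, hly, hsource, hsource_y] with t ht hlyt htf hty
    refine ⟨(hL _ (φ.map_target ht)).2 ?_, (extChartAt 𝓘(ℝ, A) (f v)).injOn htf hty hlyt⟩
    rw [φ.right_inv ht]
    exact (l t).2
  · have hψy : ∀ᶠ t in 𝓝 0, ContinuousAt (extChartAt 𝓘(ℝ, A) (f v) ∘ y) t := by
      filter_upwards [hycont, hsource_y] with t hyt hty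
      exact (continuousAt_extChartAt' hty).comp hyt
    filter_upwards [hlcont hψy, htarget] with t hlt ht
    exact ContinuousAt.comp (f := fun t => (l t : B)) (φ.continuousAt_symm ht)
      (continuous_subtype_val.continuousAt.comp hlt)

end Submanifold

section Frame

variable {A : Type*} [NormedAddCommGroup A] [NormedSpace ℝ A]
  {P : Type*} [NormedAddCommGroup P] [NormedSpace ℝ P]

lemma exists_normalized_frame [CompleteSpace P] {p : A →L[ℝ] P} {T : A → P →L[ℝ] A} {W : Set A}
    (hW : IsOpen W) (hT : ContDiffOn ℝ ∞ T W) {z₀ : A} (hz₀ : z₀ ∈ W)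
    (hp : Function.LeftInverse p (T z₀)) :
    ∃ (G : A → P →L[ℝ] A) (W' : Set A), IsOpen W' ∧ z₀ ∈ W' ∧ W' ⊆ W ∧ ContDiffOn ℝ ∞ G W' ∧
      (∀ z ∈ W', ∀ h, p (G z h) = h) ∧ ∀ z ∈ W', ∀ w, w ∈ range (T z) ↔ G z (p w) = w := by
  set S : A → P →L[ℝ] P := fun z => p.comp (T z)
  have hS : ContDiffOn ℝ ∞ S W := contDiffOn_const.clm_comp hT
  have hright : ∀ z, IsUnit (S z) → ∀ h, p (T z (Ring.inverse (S z) h)) = h := fun z hz h =>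
    congrArg (fun g : P →L[ℝ] P => g h) (Ring.mul_inverse_cancel _ hz)
  have hleft : ∀ z, IsUnit (S z) → ∀ h, Ring.inverse (S z) (p (T z h)) = h := fun z hz h =>
    congrArg (fun g : P →L[ℝ] P => g h) (Ring.inverse_mul_cancel _ hz)
  refine ⟨fun z => (T z).comp (Ring.inverse (S z)), W ∩ S ⁻¹' {g | IsUnit g},
    hS.continuousOn.isOpen_inter_preimage hW Units.isOpen, ⟨hz₀, ?_⟩, inter_subset_left, ?_,
    fun z hz => hright z hz.2, fun z hz w => ⟨?_, fun hw => ⟨_, hw⟩⟩⟩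
  · have hone : S z₀ = 1 := ContinuousLinearMap.ext hp
    exact (hone ▸ isUnit_one : IsUnit (S z₀))
  · refine (hT.mono inter_subset_left).clm_comp fun z hz => ?_
    obtain ⟨a, ha⟩ := hz.2
    have hinverse : ContDiffAt ℝ ∞ Ring.inverse (S z) := ha ▸ contDiffAt_ringInverse ℝ a
    exact hinverse.comp_contDiffWithinAt z ((hS z hz.1).mono inter_subset_left)
  · rintro ⟨h, rfl⟩
    rw [ContinuousLinearMap.comp_apply, hleft z hz.2]

lemma exists_normalized_frame_of_fields [FiniteDimensional ℝ A] {r : ℕ} {W : Set A}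
    (hW : IsOpen W) {X : Fin r → A → A} (hX : ∀ i, ContDiffOn ℝ ∞ (X i) W) {z₀ : A} (hz₀ : z₀ ∈ W)
    (hli : LinearIndependent ℝ fun i => X i z₀) :
    ∃ (p : A →L[ℝ] (Fin r → ℝ)) (G : A → (Fin r → ℝ) →L[ℝ] A) (W' : Set A), IsOpen W' ∧
      z₀ ∈ W' ∧ W' ⊆ W ∧ ContDiffOn ℝ ∞ G W' ∧ (∀ z ∈ W', ∀ h, p (G z h) = h) ∧
      ∀ z ∈ W', ∀ w, w ∈ Submodule.span ℝ (range fun i => X i z) ↔ G z (p w) = w := by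
  set T : A → (Fin r → ℝ) →L[ℝ] A := fun z =>
    LinearMap.toContinuousLinearMap (Fintype.linearCombination ℝ fun i => X i z)
  have hT : ContDiffOn ℝ ∞ T W := contDiffOn_clm_apply.2 fun h =>
    (ContDiffOn.sum (s := Finset.univ) fun i _ => (hX i).const_smul (h i) :
      ContDiffOn ℝ ∞ (fun z => ∑ i, h i • X i z) W)
  obtain ⟨p, hp⟩ := LinearMap.exists_leftInverse_of_injective
    (Fintype.linearCombination ℝ fun i => X i z₀)
    (LinearMap.ker_eq_bot.2 (hli.fintypeLinearCombination_injective))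
  obtain ⟨G, W', hW', hzW', hW'W, hG, hpG, hrange⟩ :=
    exists_normalized_frame (p := LinearMap.toContinuousLinearMap p) hW hT hz₀
      (LinearMap.congr_fun hp)
  refine ⟨_, G, W', hW', hzW', hW'W, hG, hpG, fun z hz w => ?_⟩
  rw [← hrange z hz, ← Fintype.range_linearCombination]
  rfl

variable {Q : Type*} [TopologicalSpace Q] [ChartedSpace A Q]

/-- A frame of the distribution `F` on `U`, written in the preferred chart `φ` at `q`: for `x ∈ U`
the injective map `G (φ x)` parametrizes `F x`. The frame is normalized by a projection `p` which
does not depend on the point, `p ∘ G (φ x) = id`, so that `u ∈ F x` becomes an equation. -/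
structure IsChartFrame (F : ∀ q : Q, Submodule ℝ (TangentSpace 𝓘(ℝ, A) q)) (q : Q)
    (p : A →L[ℝ] P) (G : A → P →L[ℝ] A) (U : Set Q) : Prop where
  isOpen : IsOpen U
  subset_source : U ⊆ (extChartAt 𝓘(ℝ, A) q).source
  contDiffAt : ∀ x ∈ U, ContDiffAt ℝ ∞ G (extChartAt 𝓘(ℝ, A) q x)
  proj_apply : ∀ x ∈ U, ∀ h, p (G (extChartAt 𝓘(ℝ, A) q x) h) = h
  mem_iff : ∀ x ∈ U, ∀ u : A, u ∈ F x ↔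
    G (extChartAt 𝓘(ℝ, A) q x) (p (mfderiv 𝓘(ℝ, A) 𝓘(ℝ, A) (extChartAt 𝓘(ℝ, A) q) x u)) =
      (mfderiv 𝓘(ℝ, A) 𝓘(ℝ, A) (extChartAt 𝓘(ℝ, A) q) x u : A)

lemma eventually_extChartAt_symm_mem {q x : Q} {U : Set Q} (hU : U ∈ 𝓝 x)
    (hx : x ∈ (extChartAt 𝓘(ℝ, A) q).source) :
    ∀ᶠ z in 𝓝 (extChartAt 𝓘(ℝ, A) q x), z ∈ (extChartAt 𝓘(ℝ, A) q).target ∧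
      (extChartAt 𝓘(ℝ, A) q).symm z ∈ U := by
  refine Filter.Eventually.and
    ((isOpen_extChartAt_target q).mem_nhds ((extChartAt 𝓘(ℝ, A) q).map_source hx))
    ((continuousAt_extChartAt_symm' hx).eventually_mem ?_)
  rwa [(extChartAt 𝓘(ℝ, A) q).left_inv hx]

lemma mfderiv_extChartAt_mfderiv_symm [IsManifold 𝓘(ℝ, A) 1 Q] {q : Q} {z : A}
    (hz : z ∈ (extChartAt 𝓘(ℝ, A) q).target) (w : A) :
    (mfderiv 𝓘(ℝ, A) 𝓘(ℝ, A) (extChartAt 𝓘(ℝ, A) q) ((extChartAt 𝓘(ℝ, A) q).symm z)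
      (mfderiv 𝓘(ℝ, A) 𝓘(ℝ, A) (extChartAt 𝓘(ℝ, A) q).symm z w) : A) = w := by
  have hcomp := mfderiv_extChartAt_comp_mfderivWithin_extChartAt_symm (I := 𝓘(ℝ, A)) hz
  rw [ModelWithCorners.range_eq_univ, mfderivWithin_univ] at hcomp
  exact congrArg (fun T : A →L[ℝ] A => T w) hcomp

namespace IsChartFrame

variable {F : ∀ q : Q, Submodule ℝ (TangentSpace 𝓘(ℝ, A) q)} {q : Q} {p : A →L[ℝ] P}
  {G : A → P →L[ℝ] A} {U : Set Q}

lemma differentiableAt (hG : IsChartFrame F q p G U) {x : Q} (hx : x ∈ U) :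
    DifferentiableAt ℝ G (extChartAt 𝓘(ℝ, A) q x) :=
  (hG.contDiffAt x hx).differentiableAt (by simp)

lemma proj_fderiv_apply (hG : IsChartFrame F q p G U) {x : Q} (hx : x ∈ U) (w : A) (k : P) :
    p (fderiv ℝ G (extChartAt 𝓘(ℝ, A) q x) w k) = 0 := by
  have hconst : (fun z => p (G z k)) =ᶠ[𝓝 (extChartAt 𝓘(ℝ, A) q x)] fun _ => k := by
    filter_upwards [eventually_extChartAt_symm_mem (hG.isOpen.mem_nhds hx)
      (hG.subset_source hx)] with z hz
    have hproj := hG.proj_apply _ hz.2 k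
    rwa [(extChartAt 𝓘(ℝ, A) q).right_inv hz.1] at hproj
  have hderiv := (p.hasFDerivAt.comp _ ((hG.differentiableAt hx).hasFDerivAt.clm_apply
    (hasFDerivAt_const k _))).unique ((hasFDerivAt_const k _).congr_of_eventuallyEq hconst)
  simpa using congrArg (fun T : A →L[ℝ] P => T w) hderiv

end IsChartFrame

variable [IsManifold 𝓘(ℝ, A) ∞ Q]

lemma contMDiffOn_extChartAt' (q : Q) :
    ContMDiffOn 𝓘(ℝ, A) 𝓘(ℝ, A) ∞ (extChartAt 𝓘(ℝ, A) q) (extChartAt 𝓘(ℝ, A) q).source := by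
  rw [extChartAt_source]
  exact contMDiffOn_extChartAt

lemma contDiffOn_fieldDeriv_extChartAt_comp_symm {q : Q} {X : ∀ x : Q, TangentSpace 𝓘(ℝ, A) x}
    {U : Set Q} (hU : IsOpen U) (hUs : U ⊆ (extChartAt 𝓘(ℝ, A) q).source)
    (hX : SmoothFieldOn 𝓘(ℝ, A) X U) :
    ContDiffOn ℝ ∞ (fieldDeriv 𝓘(ℝ, A) (extChartAt 𝓘(ℝ, A) q) X ∘ (extChartAt 𝓘(ℝ, A) q).symm)
      ((extChartAt 𝓘(ℝ, A) q).target ∩ (extChartAt 𝓘(ℝ, A) q).symm ⁻¹' U) := by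
  rw [← contMDiffOn_iff_contDiffOn]
  exact (contMDiffOn_fieldDeriv hU ((contMDiffOn_extChartAt' q).mono hUs) hX).comp
    ((contMDiffOn_extChartAt_symm q).mono inter_subset_left) fun z hz => hz.2

lemma mfderiv_extChartAt_mem_span_iff {ι : Type*} {q x : Q}
    (hx : x ∈ (extChartAt 𝓘(ℝ, A) q).source) (X : ι → ∀ x : Q, TangentSpace 𝓘(ℝ, A) x) (u : A) :
    (mfderiv 𝓘(ℝ, A) 𝓘(ℝ, A) (extChartAt 𝓘(ℝ, A) q) x u : A) ∈ Submodule.span ℝ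
        (range fun i => fieldDeriv 𝓘(ℝ, A) (extChartAt 𝓘(ℝ, A) q) (X i) x) ↔
      u ∈ Submodule.span ℝ (range fun i => X i x) := by
  set D : TangentSpace 𝓘(ℝ, A) x →ₗ[ℝ] A :=
    (mfderiv 𝓘(ℝ, A) 𝓘(ℝ, A) (extChartAt 𝓘(ℝ, A) q) x).toLinearMap
  have hD : Function.Injective D := (isInvertible_mfderiv_extChartAt hx).injective
  have himage : Submodule.span ℝ
      (range fun i => fieldDeriv 𝓘(ℝ, A) (extChartAt 𝓘(ℝ, A) q) (X i) x) =
      (Submodule.span ℝ (range fun i => X i x)).map D := by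
    rw [Submodule.map_span, ← range_comp]
    rfl
  rw [himage]
  exact hD.mem_set_image (s := (Submodule.span ℝ (range fun i => X i x) : Set _))

lemma IsSmoothDistribution.exists_isChartFrame [FiniteDimensional ℝ A]
    {F : ∀ q : Q, Submodule ℝ (TangentSpace 𝓘(ℝ, A) q)} {r : ℕ}
    (hF : IsSmoothDistribution 𝓘(ℝ, A) F r) (q : Q) :
    ∃ (p : A →L[ℝ] (Fin r → ℝ)) (G : A → (Fin r → ℝ) →L[ℝ] A) (U : Set Q),
      q ∈ U ∧ IsChartFrame F q p G U := by
  obtain ⟨U₁, hU₁, hqU₁, X, hX, hXF⟩ := hF q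
  set φ := extChartAt 𝓘(ℝ, A) q
  have hqs : q ∈ φ.source := mem_extChartAt_source q
  have hsource : IsOpen φ.source := isOpen_extChartAt_source q
  have hU : IsOpen (U₁ ∩ φ.source) := hU₁.inter hsource
  have hinj : ∀ x ∈ φ.source, Function.Injective (mfderiv 𝓘(ℝ, A) 𝓘(ℝ, A) φ x) := fun x hx =>
    (isInvertible_mfderiv_extChartAt hx).injective
  have hli : LinearIndependent ℝ fun i =>
      (fieldDeriv 𝓘(ℝ, A) φ (X i) ∘ φ.symm) (φ q) := by
    simp only [Function.comp_apply, φ.left_inv hqs]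
    exact (hXF q hqU₁).1.map' (mfderiv 𝓘(ℝ, A) 𝓘(ℝ, A) φ q).toLinearMap
      (LinearMap.ker_eq_bot.2 (hinj q hqs))
  obtain ⟨p, G, W, hW, hqW, hWU, hG, hpG, hspan⟩ := exists_normalized_frame_of_fields
    ((continuousOn_extChartAt_symm q).isOpen_inter_preimage (isOpen_extChartAt_target q) hU)
    (fun i => contDiffOn_fieldDeriv_extChartAt_comp_symm hU inter_subset_right
      ((hX i).mono inter_subset_left))
    ⟨φ.map_source hqs, by rw [mem_preimage, φ.left_inv hqs]; exact ⟨hqU₁, hqs⟩⟩ hli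
  refine ⟨p, G, φ.source ∩ φ ⁻¹' W, ⟨hqs, hqW⟩,
    (continuousOn_extChartAt q).isOpen_inter_preimage hsource hW, inter_subset_left,
    fun x hx => (hG _ hx.2).contDiffAt (hW.mem_nhds hx.2), fun x hx => hpG _ hx.2,
    fun x hx u => Iff.trans ?_ (hspan _ hx.2 _)⟩
  have hxU₁ : x ∈ U₁ := by
    have hmem := (hWU hx.2).2.1
    rwa [φ.left_inv hx.1] at hmem
  have hleft : φ.symm (φ x) = x := φ.left_inv hx.1
  rw [← (hXF x hxU₁).2, ← mfderiv_extChartAt_mem_span_iff hx.1]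
  simp only [Function.comp_apply]
  rw [hleft]
  exact Iff.rfl

/-- The vector field with constant coefficients `h` in the frame `G`, which is written in the
preferred chart at `q`. -/
def frameField (q : Q) (G : A → P →L[ℝ] A) (h : P) : ∀ x : Q, TangentSpace 𝓘(ℝ, A) x :=
  VectorField.mpullback 𝓘(ℝ, A) 𝓘(ℝ, A) (extChartAt 𝓘(ℝ, A) q) fun z => (G z h : A)

namespace IsChartFrame

variable {F : ∀ q : Q, Submodule ℝ (TangentSpace 𝓘(ℝ, A) q)} {q : Q} {p : A →L[ℝ] P}
  {G : A → P →L[ℝ] A} {U : Set Q}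

lemma contMDiffAt_extChartAt (hG : IsChartFrame F q p G U) {x : Q} (hx : x ∈ U) :
    ContMDiffAt 𝓘(ℝ, A) 𝓘(ℝ, A) ∞ (extChartAt 𝓘(ℝ, A) q) x :=
  (contMDiffOn_extChartAt' q x (hG.subset_source hx)).contMDiffAt
    ((isOpen_extChartAt_source q).mem_nhds (hG.subset_source hx))

lemma fieldDeriv_frameField (hG : IsChartFrame F q p G U) (h : P) {x : Q} (hx : x ∈ U) :
    fieldDeriv 𝓘(ℝ, A) (extChartAt 𝓘(ℝ, A) q) (frameField q G h) x =
      G (extChartAt 𝓘(ℝ, A) q x) h :=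
  (isInvertible_mfderiv_extChartAt (hG.subset_source hx)).self_apply_inverse _

lemma frameField_mem (hG : IsChartFrame F q p G U) (h : P) {x : Q} (hx : x ∈ U) :
    frameField q G h x ∈ F x := by
  refine (hG.mem_iff x hx _).2 ?_
  have hchart := hG.fieldDeriv_frameField h hx
  exact (congrArg (fun w => G _ (p w)) hchart).trans
    ((congrArg (G _) (hG.proj_apply x hx h)).trans hchart.symm)

lemma fieldDeriv_fieldDeriv_frameField (hG : IsChartFrame F q p G U) (h k : P) {x : Q}
    (hx : x ∈ U) :
    fieldDeriv 𝓘(ℝ, A) (fieldDeriv 𝓘(ℝ, A) (extChartAt 𝓘(ℝ, A) q) (frameField q G k))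
      (frameField q G h) x =
      fderiv ℝ G (extChartAt 𝓘(ℝ, A) q x) (G (extChartAt 𝓘(ℝ, A) q x) h) k := by
  have hchart : fieldDeriv 𝓘(ℝ, A) (extChartAt 𝓘(ℝ, A) q) (frameField q G k)
      =ᶠ[𝓝 x] (fun z => G z k) ∘ extChartAt 𝓘(ℝ, A) q :=
    Filter.eventuallyEq_of_mem (hG.isOpen.mem_nhds hx) fun _ hy => hG.fieldDeriv_frameField k hy
  rw [fieldDeriv_congr hchart, fieldDeriv_comp
    ((hG.differentiableAt hx).clm_apply (differentiableAt_const k))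
    ((hG.contMDiffAt_extChartAt hx).mdifferentiableAt (by simp)), hG.fieldDeriv_frameField h hx,
    fderiv_clm_apply (hG.differentiableAt hx) (differentiableAt_const k)]
  simp

lemma exists_hasVelocity (hG : IsChartFrame F q p G U) {c : ℝ → A} {s : Set ℝ} {t : ℝ} {h : P}
    (hct : c t ∈ (extChartAt 𝓘(ℝ, A) q).target)
    (hctU : (extChartAt 𝓘(ℝ, A) q).symm (c t) ∈ U) (hc : HasDerivWithinAt c (G (c t) h) s t) :
    ∃ u : A, (mfderiv 𝓘(ℝ, A) 𝓘(ℝ, A) (extChartAt 𝓘(ℝ, A) q)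
        ((extChartAt 𝓘(ℝ, A) q).symm (c t)) u : A) = G (c t) h ∧
      u ∈ F ((extChartAt 𝓘(ℝ, A) q).symm (c t)) ∧
      HasVelocity 𝓘(ℝ, A) ((extChartAt 𝓘(ℝ, A) q).symm ∘ c) s t u := by
  have hchart := mfderiv_extChartAt_mfderiv_symm hct (G (c t) h)
  refine ⟨_, hchart, (hG.mem_iff _ hctU _).2 ?_,
    (hasVelocity_vector.2 hc).comp (mdifferentiableAt_extChartAt_symm' hct)⟩
  have hbase := (extChartAt 𝓘(ℝ, A) q).right_inv hct
  have hproj := hG.proj_apply _ hctU h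
  rw [hbase] at hproj
  exact (congrArg (fun z => G z _) hbase).trans
    ((congrArg (G (c t)) ((congrArg p hchart).trans hproj)).trans hchart.symm)

lemma hasDerivWithinAt_comp (hG : IsChartFrame F q p G U) {c : ℝ → Q} {s : Set ℝ} {t : ℝ} {u : A}
    (hc : HasVelocity 𝓘(ℝ, A) c s t u) (ht : c t ∈ U) :
    HasDerivWithinAt (extChartAt 𝓘(ℝ, A) q ∘ c)
      (mfderiv 𝓘(ℝ, A) 𝓘(ℝ, A) (extChartAt 𝓘(ℝ, A) q) (c t) u : A) s t :=
  hasVelocity_vector.1 (hc.comp ((hG.contMDiffAt_extChartAt ht).mdifferentiableAt (by simp)))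

variable [CompleteSpace A]

lemma smoothFieldOn_frameField (hG : IsChartFrame F q p G U) (h : P) :
    SmoothFieldOn 𝓘(ℝ, A) (frameField q G h) U := fun x hx =>
  (ContMDiffAt.mpullback_vectorField_preimage (n := ∞)
    (contMDiffAt_vectorSpace_iff_contDiffAt.2 ((hG.contDiffAt x hx).clm_apply contDiffAt_const))
    (hG.contMDiffAt_extChartAt hx) (isInvertible_mfderiv_extChartAt (hG.subset_source hx))
    (by simp)).contMDiffWithinAt

/-- In a normalized frame of an involutive distribution the coefficient fields commute: their
bracket lies in the distribution and is annihilated by the projection `p`. -/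
lemma fderiv_apply_comm (hG : IsChartFrame F q p G U) (hF : IsInvolutive 𝓘(ℝ, A) F) {x : Q}
    (hx : x ∈ U) (h k : P) :
    fderiv ℝ G (extChartAt 𝓘(ℝ, A) q x) (G (extChartAt 𝓘(ℝ, A) q x) h) k =
      fderiv ℝ G (extChartAt 𝓘(ℝ, A) q x) (G (extChartAt 𝓘(ℝ, A) q x) k) h := by
  have hbracket := fieldDeriv_mlieBracket hG.isOpen
    ((contMDiffOn_extChartAt' q).mono hG.subset_source) (hG.smoothFieldOn_frameField h)
    (hG.smoothFieldOn_frameField k) hx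
  rw [hG.fieldDeriv_fieldDeriv_frameField h k hx, hG.fieldDeriv_fieldDeriv_frameField k h hx]
    at hbracket
  have hmem : G (extChartAt 𝓘(ℝ, A) q x) (p (fieldDeriv 𝓘(ℝ, A) (extChartAt 𝓘(ℝ, A) q)
      (VectorField.mlieBracket 𝓘(ℝ, A) (frameField q G h) (frameField q G k)) x)) =
      fieldDeriv 𝓘(ℝ, A) (extChartAt 𝓘(ℝ, A) q)
        (VectorField.mlieBracket 𝓘(ℝ, A) (frameField q G h) (frameField q G k)) x :=
    (hG.mem_iff x hx _).1 (hF U hG.isOpen _ _ (hG.smoothFieldOn_frameField h)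
      (hG.smoothFieldOn_frameField k) (fun _ => hG.frameField_mem h)
      (fun _ => hG.frameField_mem k) x hx)
  rw [hbracket, map_sub, hG.proj_fderiv_apply hx, hG.proj_fderiv_apply hx, sub_zero,
    map_zero] at hmem
  exact sub_eq_zero.1 hmem.symm

lemma exists_isFlatFrame (hG : IsChartFrame F q p G U) (hF : IsInvolutive 𝓘(ℝ, A) F)
    (hq : q ∈ U) :
    ∃ ρ > 0, ∃ M : ℝ, IsFlatFrame p G (closedBall (extChartAt 𝓘(ℝ, A) q q) ρ) M := by
  have hnear := eventually_extChartAt_symm_mem (hG.isOpen.mem_nhds hq) (hG.subset_source hq)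
  refine DiscreteMechanics.exists_isFlatFrame ((hG.contDiffAt q hq).of_le (by norm_cast)) ?_ ?_
  · filter_upwards [hnear] with z hz
    have hproj := hG.proj_apply _ hz.2
    rwa [(extChartAt 𝓘(ℝ, A) q).right_inv hz.1] at hproj
  · filter_upwards [hnear] with z hz
    have hcomm := hG.fderiv_apply_comm hF hz.2
    rwa [(extChartAt 𝓘(ℝ, A) q).right_inv hz.1] at hcomm

end IsChartFrame

/-- `π` is, on `U`, a local first integral of the distribution `F`: the curves tangent to `F` are
the curves in the level sets of `π`, and the level sets are locally connected by such curves. -/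
structure IsFirstIntegral (F : ∀ q : Q, Submodule ℝ (TangentSpace 𝓘(ℝ, A) q)) (π : Q → A)
    (U : Set Q) : Prop where
  isOpen : IsOpen U
  continuousOn : ContinuousOn π U
  deriv_zero : ∀ (c : ℝ → Q) (s : Set ℝ) (t : ℝ) (u : A), HasVelocity 𝓘(ℝ, A) c s t u →
    c t ∈ U → u ∈ F (c t) → HasDerivWithinAt (π ∘ c) 0 s t
  mem_of_const : ∀ (c : ℝ → Q) (t : ℝ) (u : A), HasVelocity 𝓘(ℝ, A) c univ t u →
    c t ∈ U → (∀ᶠ τ in 𝓝 t, π (c τ) = π (c t)) → u ∈ F (c t)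
  joined : ∀ x ∈ U, ∀ O ∈ 𝓝 x, ∀ᶠ y in 𝓝 x, π y = π x → ∃ c : ℝ → Q, c 0 = x ∧ c 1 = y ∧
    ∀ t ∈ Icc (0 : ℝ) 1, c t ∈ O ∧ ∃ u : A, u ∈ F (c t) ∧ HasVelocity 𝓘(ℝ, A) c (Icc 0 1) t u

section Frobenius

variable {F : ∀ q : Q, Submodule ℝ (TangentSpace 𝓘(ℝ, A) q)}

lemma IsChartFrame.eventually_joined [CompleteSpace A] {q : Q} {p : A →L[ℝ] P}
    {G : A → P →L[ℝ] A} {U : Set Q} (hG : IsChartFrame F q p G U) {z₀ : A} {ρ M C : ℝ}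
    (hρ : 0 < ρ) (hflat : IsFlatFrame p G (closedBall z₀ ρ) M) {π : A → A} {W : Set A}
    (hW : IsOpen W) (hWρ : W ⊆ closedBall z₀ (ρ / 2))
    (hπ : IsQuantitativeFirstIntegral p G π W C) {x : Q} (hx : x ∈ U)
    (hxW : extChartAt 𝓘(ℝ, A) q x ∈ W) {O : Set Q} (hO : O ∈ 𝓝 x) :
    ∀ᶠ y in 𝓝 x, π (extChartAt 𝓘(ℝ, A) q y) = π (extChartAt 𝓘(ℝ, A) q x) →
      ∃ c : ℝ → Q, c 0 = x ∧ c 1 = y ∧ ∀ t ∈ Icc (0 : ℝ) 1, c t ∈ O ∧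
        ∃ u : A, u ∈ F (c t) ∧ HasVelocity 𝓘(ℝ, A) c (Icc 0 1) t u := by
  have hxs := hG.subset_source hx
  have hnear := eventually_extChartAt_symm_mem
    (Filter.inter_mem hO (hG.isOpen.mem_nhds hx)) hxs
  filter_upwards [(continuousAt_extChartAt' hxs).eventually
      (hflat.eventually_exists_flowArc hπ hρ hW hWρ hxW hnear),
    (isOpen_extChartAt_source q).mem_nhds hxs] with y hy hys hyx
  obtain ⟨h, c, hc, hc0, hc1⟩ := hy hyx
  refine ⟨(extChartAt 𝓘(ℝ, A) q).symm ∘ c, ?_, ?_, fun t ht => ?_⟩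
  · rw [Function.comp_apply, hc0, (extChartAt 𝓘(ℝ, A) q).left_inv hxs]
  · rw [Function.comp_apply, hc1, (extChartAt 𝓘(ℝ, A) q).left_inv hys]
  · obtain ⟨htarget, hctO, hctU⟩ := hc.mem t ht
    obtain ⟨u, -, hu⟩ := hG.exists_hasVelocity htarget hctU (hc.hasDerivWithinAt t ht)
    exact ⟨hctO, u, hu⟩

lemma IsChartFrame.isFirstIntegral [CompleteSpace A] {q : Q} {p : A →L[ℝ] P}
    {G : A → P →L[ℝ] A} {U : Set Q} (hG : IsChartFrame F q p G U) {z₀ : A} {ρ M C : ℝ}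
    (hρ : 0 < ρ) (hflat : IsFlatFrame p G (closedBall z₀ ρ) M) {π : A → A} {W : Set A}
    (hW : IsOpen W) (hWρ : W ⊆ closedBall z₀ (ρ / 2))
    (hπ : IsQuantitativeFirstIntegral p G π W C) :
    IsFirstIntegral F (π ∘ extChartAt 𝓘(ℝ, A) q) (U ∩ extChartAt 𝓘(ℝ, A) q ⁻¹' W) where
  isOpen := ((continuousOn_extChartAt q).mono hG.subset_source).isOpen_inter_preimage hG.isOpen hW
  continuousOn _ hx := ((hπ.continuousAt (hW.mem_nhds hx.2)).comp
    (continuousAt_extChartAt' (hG.subset_source hx.1))).continuousWithinAt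
  deriv_zero _ _ _ u hc ht hu := hπ.hasDerivWithinAt_zero (hG.hasDerivWithinAt_comp hc ht.1)
    (hW.mem_nhds ht.2) ((hG.mem_iff _ ht.1 u).1 hu)
  mem_of_const _ _ u hc ht hconst := (hG.mem_iff _ ht.1 u).2 <| hπ.apply_eq_of_eventually_eq
    (hasDerivWithinAt_univ.1 (hG.hasDerivWithinAt_comp hc ht.1)) (hW.mem_nhds ht.2) hconst
  joined _ hx _ hO := hG.eventually_joined hρ hflat hW hWρ hπ hx.1 hx.2 hO

variable [FiniteDimensional ℝ A] {r : ℕ}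

theorem IsInvolutive.exists_isFirstIntegral (hF : IsInvolutive 𝓘(ℝ, A) F)
    (hFr : IsSmoothDistribution 𝓘(ℝ, A) F r) (q : Q) :
    ∃ (π : Q → A) (U : Set Q), q ∈ U ∧ IsFirstIntegral F π U := by
  have : CompleteSpace A := FiniteDimensional.complete ℝ A
  obtain ⟨p, G, U, hq, hG⟩ := hFr.exists_isChartFrame q
  obtain ⟨ρ, hρ, M, hflat⟩ := hG.exists_isFlatFrame hF hq
  obtain ⟨π, W, C, hW, hqW, hWρ, hπ⟩ := hflat.exists_isQuantitativeFirstIntegral hρ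
  exact ⟨π ∘ extChartAt 𝓘(ℝ, A) q, U ∩ extChartAt 𝓘(ℝ, A) q ⁻¹' W, ⟨hq, hqW⟩,
    hG.isFirstIntegral hρ hflat hW hWρ hπ⟩

/-- The curve is the integral curve of a field with constant coefficients in a frame. -/
lemma IsSmoothDistribution.exists_curve (hF : IsSmoothDistribution 𝓘(ℝ, A) F r) {q : Q} {u : A}
    (hu : u ∈ F q) :
    ∃ c : ℝ → Q, c 0 = q ∧ HasVelocity 𝓘(ℝ, A) c univ 0 u ∧
      ∀ᶠ t in 𝓝 (0 : ℝ), ∃ u' : A, u' ∈ F (c t) ∧ HasVelocity 𝓘(ℝ, A) c univ t u' := by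
  have : CompleteSpace A := FiniteDimensional.complete ℝ A
  obtain ⟨p, G, U, hq, hG⟩ := hF.exists_isChartFrame q
  set φ := extChartAt 𝓘(ℝ, A) q
  have hqs : q ∈ φ.source := hG.subset_source hq
  set κ := p (mfderiv 𝓘(ℝ, A) 𝓘(ℝ, A) φ q u)
  have hGκ : ContDiffAt ℝ 1 (fun z => G z κ) (φ q) :=
    ((hG.contDiffAt q hq).of_le (by norm_cast)).clm_apply contDiffAt_const
  obtain ⟨c, hc0, ε, hε, hc⟩ :=
    hGκ.exists_forall_mem_closedBall_exists_eq_forall_mem_Ioo_hasDerivAt₀ 0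
  have hderiv : ∀ᶠ t in 𝓝 (0 : ℝ), HasDerivAt c (G (c t) κ) t :=
    Filter.eventually_of_mem (Ioo_mem_nhds (by linarith) (by linarith)) hc
  have hnear : ∀ᶠ t in 𝓝 (0 : ℝ), c t ∈ φ.target ∧ φ.symm (c t) ∈ U :=
    hderiv.self_of_nhds.continuousAt.eventually
      (hc0.symm ▸ eventually_extChartAt_symm_mem (hG.isOpen.mem_nhds hq) hqs)
  have hvel : ∀ᶠ t in 𝓝 (0 : ℝ), ∃ u' : A,
      (mfderiv 𝓘(ℝ, A) 𝓘(ℝ, A) φ (φ.symm (c t)) u' : A) = G (c t) κ ∧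
      u' ∈ F (φ.symm (c t)) ∧ HasVelocity 𝓘(ℝ, A) (φ.symm ∘ c) univ t u' := by
    filter_upwards [hnear, hderiv] with t ht hct
    exact hG.exists_hasVelocity ht.1 ht.2 hct.hasDerivWithinAt
  have hstart : φ.symm (c 0) = q := by rw [hc0, φ.left_inv hqs]
  refine ⟨φ.symm ∘ c, hstart, ?_, hvel.mono fun t ⟨u', _, hu'⟩ => ⟨u', hu'⟩⟩
  obtain ⟨u', hu', -, hv⟩ := hvel.self_of_nhds
  rw [hstart, hc0] at hu'
  have heq : u' = u := (isInvertible_mfderiv_extChartAt (I := 𝓘(ℝ, A)) hqs).injective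
    (hu'.trans ((hG.mem_iff q hq u).1 hu))
  rwa [heq] at hv

end Frobenius

end Frame

section Orbit

section SamePlaque

variable {ι X Y : Type*} {π : ι → X → Y} {U : ι → Set X}

/-- `x` and `y` lie on the same level set of one of the functions `π i` on `U i`. When these are
local first integrals of a distribution, the reflexive transitive closure of this relation describes
the leaves of the distribution. -/
def SamePlaque (π : ι → X → Y) (U : ι → Set X) (x y : X) : Prop :=
  ∃ i, x ∈ U i ∧ y ∈ U i ∧ π i x = π i y

lemma SamePlaque.symm {x y : X} : SamePlaque π U x y → SamePlaque π U y x :=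
  fun ⟨i, hx, hy, hxy⟩ => ⟨i, hy, hx, hxy.symm⟩

end SamePlaque

variable {A : Type*} [NormedAddCommGroup A] [NormedSpace ℝ A]
  {Q : Type*} [TopologicalSpace Q] [ChartedSpace A Q]
  {F : ∀ q : Q, Submodule ℝ (TangentSpace 𝓘(ℝ, A) q)}

lemma IsFirstIntegral.apply_eq_left {π : Q → A} {U : Set Q} (hπ : IsFirstIntegral F π U)
    {a b : ℝ} {c : ℝ → Q} (hcU : ∀ t ∈ Icc a b, c t ∈ U)
    (hc : ∀ t ∈ Icc a b, ∃ u : A, u ∈ F (c t) ∧ HasVelocity 𝓘(ℝ, A) c (Icc a b) t u)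
    {t : ℝ} (ht : t ∈ Icc a b) : π (c t) = π (c a) :=
  eq_left_of_hasDerivWithinAt_zero (f := π ∘ c) (fun s hs =>
    let ⟨u, hu, hv⟩ := hc s hs
    hπ.deriv_zero c _ s u hv (hcU s hs) hu) ht

lemma IsFirstIntegral.countable_image_levelSet [SecondCountableTopology Q] {π₁ π₂ : Q → A}
    {U₁ U₂ : Set Q} (hπ₁ : IsFirstIntegral F π₁ U₁) (hπ₂ : IsFirstIntegral F π₂ U₂) (a : A) :
    (π₂ '' {x | x ∈ U₁ ∧ x ∈ U₂ ∧ π₁ x = a}).Countable := by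
  have hlocal : ∀ x ∈ {x | x ∈ U₁ ∧ x ∈ U₂ ∧ π₁ x = a},
      {y | π₂ y = π₂ x} ∈ 𝓝[{x | x ∈ U₁ ∧ x ∈ U₂ ∧ π₁ x = a}] x := fun x hx => by
    refine mem_nhdsWithin_iff_eventually.2 ?_
    filter_upwards [hπ₁.joined x hx.1 U₂ (hπ₂.isOpen.mem_nhds hx.2.1)] with y hy hya
    obtain ⟨c, rfl, rfl, hc⟩ := hy (hya.2.2.trans hx.2.2.symm)
    exact hπ₂.apply_eq_left (fun t ht => (hc t ht).1) (fun t ht => (hc t ht).2)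
      ⟨zero_le_one, le_rfl⟩
  obtain ⟨t, -, ht, hcover⟩ := TopologicalSpace.countable_cover_nhdsWithin hlocal
  refine (ht.image π₂).mono ?_
  rintro _ ⟨x, hx, rfl⟩
  obtain ⟨y, hy, hxy⟩ := mem_iUnion₂.1 (hcover hx)
  exact ⟨y, hy, Eq.symm hxy⟩

variable {ι : Type*} {π : ι → Q → A} {U : ι → Set Q}

lemma countable_image_setOf_samePlaque [SecondCountableTopology Q] [Countable ι]
    (hπ : ∀ i, IsFirstIntegral F (π i) (U i)) {S : Set Q}
    (hS : ∀ i, (π i '' (U i ∩ S)).Countable) (j : ι) :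
    (π j '' (U j ∩ {z | ∃ y ∈ S, SamePlaque π U y z})).Countable := by
  refine Countable.mono ?_ (countable_iUnion fun i => (hS i).biUnion fun a _ =>
    (hπ i).countable_image_levelSet (hπ j) a)
  rintro _ ⟨z, ⟨hzj, y, hy, i, hyi, hzi, hyz⟩, rfl⟩
  exact mem_iUnion.2 ⟨i, mem_iUnion₂.2
    ⟨π i y, ⟨y, ⟨hyi, hy⟩, rfl⟩, ⟨z, ⟨hzi, hzj, hyz.symm⟩, rfl⟩⟩⟩

lemma countable_image_setOf_reflTransGen [SecondCountableTopology Q] [Countable ι]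
    (hπ : ∀ i, IsFirstIntegral F (π i) (U i)) (x : Q) (j : ι) :
    (π j '' (U j ∩ {y | Relation.ReflTransGen (SamePlaque π U) x y})).Countable := by
  set next : Set Q → Set Q := fun S => {z | ∃ y ∈ S, SamePlaque π U y z}
  have hcountable : ∀ n i, (π i '' (U i ∩ next^[n] {x})).Countable := fun n => by
    induction n with
    | zero => exact fun i => ((countable_singleton x).mono inter_subset_right).image _
    | succ n ih =>
      rw [Function.iterate_succ_apply']
      exact countable_image_setOf_samePlaque hπ ih
  have hreach : ∀ y, Relation.ReflTransGen (SamePlaque π U) x y → ∃ n, y ∈ next^[n] {x} :=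
    fun y hxy => by
      induction hxy with
      | refl => exact ⟨0, rfl⟩
      | tail _ hyz ih =>
        obtain ⟨n, hn⟩ := ih
        exact ⟨n + 1, (Function.iterate_succ_apply' next n {x}).symm ▸ ⟨_, hn, hyz⟩⟩
  refine (countable_iUnion fun n => hcountable n j).mono ?_
  rintro _ ⟨y, ⟨hyj, hxy⟩, rfl⟩
  obtain ⟨n, hn⟩ := hreach y hxy
  exact mem_iUnion.2 ⟨n, y, ⟨hyj, hn⟩, rfl⟩

lemma eventually_samePlaque_of_hasVelocity (hπ : ∀ i, IsFirstIntegral F (π i) (U i))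
    (hU : ∀ x, ∃ i, x ∈ U i) {a b : ℝ} {c : ℝ → Q}
    (hc : ∀ t ∈ Icc a b, ∃ u : A, u ∈ F (c t) ∧ HasVelocity 𝓘(ℝ, A) c (Icc a b) t u)
    {s : ℝ} (hs : s ∈ Icc a b) : ∀ᶠ t in 𝓝[Icc a b] s, SamePlaque π U (c s) (c t) := by
  obtain ⟨i, hi⟩ := hU (c s)
  obtain ⟨_, -, hcs⟩ := hc s hs
  obtain ⟨ε, hε, hsub⟩ := Metric.mem_nhdsWithin_iff.1
    (hcs.1.eventually_mem ((hπ i).isOpen.mem_nhds hi))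
  have hle : ∀ {σ τ}, σ ≤ τ → σ ∈ ball s ε ∩ Icc a b → τ ∈ ball s ε ∩ Icc a b →
      SamePlaque π U (c σ) (c τ) := fun {σ τ} hστ hσ hτ => by
    have hIcc : Icc σ τ ⊆ ball s ε ∩ Icc a b := by
      refine OrdConnected.out ?_ hσ hτ
      rw [Real.ball_eq_Ioo]
      infer_instance
    refine ⟨i, hsub hσ, hsub hτ, ((hπ i).apply_eq_left (fun θ hθ => hsub (hIcc hθ))
      (fun θ hθ => ?_) ⟨hστ, le_rfl⟩).symm⟩
    obtain ⟨u, huF, hu⟩ := hc θ (hIcc hθ).2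
    exact ⟨u, huF, hu.mono fun _ hη => (hIcc hη).2⟩
  have hsball : s ∈ ball s ε ∩ Icc a b := ⟨mem_ball_self hε, hs⟩
  refine Metric.mem_nhdsWithin_iff.2 ⟨ε, hε, fun t ht => ?_⟩
  rcases le_total s t with hst | hts
  · exact hle hst hsball ht
  · exact (hle hts ht hsball).symm

lemma reflTransGen_of_hasVelocity (hπ : ∀ i, IsFirstIntegral F (π i) (U i))
    (hU : ∀ x, ∃ i, x ∈ U i) {a b : ℝ} {c : ℝ → Q}
    (hc : ∀ t ∈ Icc a b, ∃ u : A, u ∈ F (c t) ∧ HasVelocity 𝓘(ℝ, A) c (Icc a b) t u)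
    {s t : ℝ} (hs : s ∈ Icc a b) (ht : t ∈ Icc a b) :
    Relation.ReflTransGen (SamePlaque π U) (c s) (c t) := by
  refine isPreconnected_Icc.induction₂'
    (fun s t => Relation.ReflTransGen (SamePlaque π U) (c s) (c t)) (fun s hs => ?_)
    (fun _ _ _ _ _ _ => Relation.ReflTransGen.trans) hs ht
  filter_upwards [eventually_samePlaque_of_hasVelocity hπ hU hc hs] with t hst
  exact ⟨.single hst, .single hst.symm⟩

lemma Reachable.reflTransGen (hπ : ∀ i, IsFirstIntegral F (π i) (U i))
    (hU : ∀ x, ∃ i, x ∈ U i) {x y : Q} (hxy : Reachable 𝓘(ℝ, A) F x y) :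
    Relation.ReflTransGen (SamePlaque π U) x y := by
  induction hxy with
  | refl => exact .refl
  | tail _ hyz ih =>
    obtain ⟨a, b, c, hab, hc, hcF, rfl, rfl⟩ := hyz
    exact ih.trans (reflTransGen_of_hasVelocity hπ hU (fun t ht => ⟨_, hcF t ht,
      hasVelocity_mfderivWithin ((hc t ht).mdifferentiableWithinAt (by simp))⟩)
      (left_mem_Icc.2 hab.le) (right_mem_Icc.2 hab.le))

/-- A leaf meets the domain of a first integral in countably many plaques, so a continuous curve in
the leaf stays in one of them. -/
lemma mem_of_eventually_reflTransGen [SecondCountableTopology Q] [Countable ι]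
    (hπ : ∀ i, IsFirstIntegral F (π i) (U i)) (hU : ∀ x, ∃ i, x ∈ U i) {x : Q} {c : ℝ → Q} {u : A}
    (hc : HasVelocity 𝓘(ℝ, A) c univ 0 u) (hcont : ∀ᶠ t in 𝓝 (0 : ℝ), ContinuousAt c t)
    (hx : ∀ᶠ t in 𝓝 (0 : ℝ), Relation.ReflTransGen (SamePlaque π U) x (c t)) : u ∈ F (c 0) := by
  obtain ⟨j, hj⟩ := hU (c 0)
  refine (hπ j).mem_of_const c 0 u hc hj ?_
  have hcU := hcont.self_of_nhds.eventually_mem ((hπ j).isOpen.mem_nhds hj)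
  obtain ⟨ε, hε, hball⟩ := Metric.eventually_nhds_iff_ball.1 ((hcont.and hcU).and hx)
  have hconnected : IsPreconnected (π j ∘ c '' ball (0 : ℝ) ε) :=
    (convex_ball (0 : ℝ) ε).isPreconnected.image _ fun t ht =>
      (((hπ j).continuousOn.continuousAt ((hπ j).isOpen.mem_nhds (hball t ht).1.2)).comp
        (hball t ht).1.1).continuousWithinAt
  have hcountable : (π j ∘ c '' ball (0 : ℝ) ε).Countable := by
    refine (countable_image_setOf_reflTransGen hπ x j).mono ?_
    rintro _ ⟨t, ht, rfl⟩
    exact ⟨c t, ⟨(hball t ht).1.2, (hball t ht).2⟩, rfl⟩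
  have hsubsingleton := hcountable.isTotallyDisconnected _ subset_rfl hconnected
  filter_upwards [ball_mem_nhds 0 hε] with t ht
  exact hsubsingleton ⟨t, ht, rfl⟩ ⟨0, mem_ball_self hε, rfl⟩

lemma IsInvolutive.exists_countable_isFirstIntegral [IsManifold 𝓘(ℝ, A) ∞ Q]
    [FiniteDimensional ℝ A] [SecondCountableTopology Q] {r : ℕ} (hF : IsInvolutive 𝓘(ℝ, A) F)
    (hFr : IsSmoothDistribution 𝓘(ℝ, A) F r) :
    ∃ (π : Q → Q → A) (U : Q → Set Q) (s : Set Q), s.Countable ∧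
      (∀ i : s, IsFirstIntegral F (π i) (U i)) ∧ ∀ x, ∃ i : s, x ∈ U i := by
  choose π U hqU hπ using hF.exists_isFirstIntegral hFr
  obtain ⟨s, hs, hcover⟩ := TopologicalSpace.countable_cover_nhds
    (fun q => (hπ q).isOpen.mem_nhds (hqU q))
  refine ⟨π, U, s, hs, fun i => hπ i, fun x => ?_⟩
  obtain ⟨i, hi, hxi⟩ := mem_iUnion₂.1 (hcover ▸ mem_univ x)
  exact ⟨⟨i, hi⟩, hxi⟩

theorem IsInvolutive.mem_of_reachable [IsManifold 𝓘(ℝ, A) ∞ Q] [FiniteDimensional ℝ A]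
    [SecondCountableTopology Q] {r : ℕ} (hF : IsInvolutive 𝓘(ℝ, A) F)
    (hFr : IsSmoothDistribution 𝓘(ℝ, A) F r) {x y : ℝ → Q} {u : A}
    (hx : ∀ᶠ t in 𝓝 (0 : ℝ), ∃ u' : A, u' ∈ F (x t) ∧ HasVelocity 𝓘(ℝ, A) x univ t u')
    (hxy : ∀ᶠ t in 𝓝 (0 : ℝ), Reachable 𝓘(ℝ, A) F (x t) (y t))
    (hy : HasVelocity 𝓘(ℝ, A) y univ 0 u) (hcont : ∀ᶠ t in 𝓝 (0 : ℝ), ContinuousAt y t) :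
    u ∈ F (y 0) := by
  obtain ⟨π, U, s, hs, hπ, hU⟩ := hF.exists_countable_isFirstIntegral hFr
  have : Countable s := hs.to_subtype
  refine mem_of_eventually_reflTransGen (x := x 0) hπ hU hy hcont ?_
  obtain ⟨ε, hε, hball⟩ := Metric.nhds_basis_closedBall.eventually_iff.1 hx
  filter_upwards [hxy, closedBall_mem_nhds (0 : ℝ) hε] with t ht htε
  refine Relation.ReflTransGen.trans ?_ (ht.reflTransGen hπ hU)
  have hzero : (0 : ℝ) ∈ closedBall 0 ε := mem_closedBall_self hε.le
  rw [Real.closedBall_eq_Icc] at hball htε hzero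
  refine reflTransGen_of_hasVelocity hπ hU (fun τ hτ => ?_) hzero htε
  obtain ⟨u', hu', hv⟩ := hball hτ
  exact ⟨u', hu', hv.mono (subset_univ _)⟩

end Orbit

section LinearAlgebra

variable {K A B : Type*} [Field K] [AddCommGroup A] [Module K A] [FiniteDimensional K A]
  [AddCommGroup B] [Module K B] [FiniteDimensional K B]

lemma finrank_comap_add_finrank {f : B →ₗ[K] A} (hf : Function.Surjective f)
    (F : Submodule K A) :
    Module.finrank K (F.comap f) + Module.finrank K A =
      Module.finrank K F + Module.finrank K B := by
  have hsurj : Function.Surjective (F.mkQ ∘ₗ f) := F.mkQ_surjective.comp hf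
  have hrank := (F.mkQ ∘ₗ f).finrank_range_add_finrank_ker
  rw [LinearMap.range_eq_top.2 hsurj, finrank_top,
    LinearMap.ker_comp, Submodule.ker_mkQ] at hrank
  have hquot := F.finrank_quotient_add_finrank
  omega

lemma finrank_inf_comap_add_finrank {f : B →ₗ[K] A} {T : Submodule K B} (F : Submodule K A)
    (hf : ∀ a, ∃ u ∈ T, f u = a) :
    Module.finrank K (T ⊓ F.comap f : Submodule K B) + Module.finrank K A =
      Module.finrank K F + Module.finrank K T := by
  have hsurj : Function.Surjective (f.domRestrict T) := fun a =>
    let ⟨u, hu, hua⟩ := hf a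
    ⟨⟨u, hu⟩, hua⟩
  have hmap : T ⊓ F.comap f = (F.comap (f.domRestrict T)).map T.subtype :=
    (Submodule.map_comap_subtype T (F.comap f)).symm
  rw [hmap, Submodule.finrank_map_subtype_eq, finrank_comap_add_finrank hsurj]

lemma finrank_submodule_prod (F₁ : Submodule K A) (F₂ : Submodule K B) :
    Module.finrank K (F₁.prod F₂) = Module.finrank K F₁ + Module.finrank K F₂ := by
  have hrange : F₁.prod F₂ = LinearMap.range (F₁.subtype.prodMap F₂.subtype) := by
    rw [LinearMap.range_prodMap, Submodule.range_subtype, Submodule.range_subtype]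
  rw [hrange, LinearMap.finrank_range_of_inj (Function.Injective.prodMap
    Subtype.val_injective Subtype.val_injective), Module.finrank_prod]

lemma surjective_prod_of_finrank_eq_two_mul {m p : B →ₗ[K] A}
    (hker : ∀ u, m u = 0 → p u = 0 → u = 0)
    (hB : Module.finrank K B = 2 * Module.finrank K A) : Function.Surjective (m.prod p) :=
  (LinearMap.injective_iff_surjective_of_finrank_eq_finrank
    (by rw [hB, Module.finrank_prod, two_mul])).1 <| (injective_iff_map_eq_zero _).2 fun u hu =>
      hker u (congrArg Prod.fst hu) (congrArg Prod.snd hu)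

lemma finrank_comap_inf_comap {m p : B →ₗ[K] A} (hker : ∀ u, m u = 0 → p u = 0 → u = 0)
    (hB : Module.finrank K B = 2 * Module.finrank K A) (F₁ F₂ : Submodule K A) :
    Module.finrank K (F₁.comap m ⊓ F₂.comap p : Submodule K B) =
      Module.finrank K F₁ + Module.finrank K F₂ := by
  have hcomap := finrank_comap_add_finrank (surjective_prod_of_finrank_eq_two_mul hker hB)
    (F₁.prod F₂)
  rw [Module.finrank_prod, finrank_submodule_prod] at hcomap
  have hinf : F₁.comap m ⊓ F₂.comap p = (F₁.prod F₂).comap (m.prod p) := rfl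
  rw [hinf]
  omega

/-- Both `T ⊓ m⁻¹ F₁` and `m⁻¹ F₁ ⊓ p⁻¹ F₂` have dimension `2 * r`, so that either inclusion makes
them equal. -/
lemma inf_comap_le_comap_iff {m p : B →ₗ[K] A} (hker : ∀ u, m u = 0 → p u = 0 → u = 0)
    (hB : Module.finrank K B = 2 * Module.finrank K A) {T : Submodule K B} {F₁ F₂ : Submodule K A}
    {r : ℕ} (hT : Module.finrank K T = Module.finrank K A + r) (hF₁ : Module.finrank K F₁ = r)
    (hF₂ : Module.finrank K F₂ = r) (hm : ∀ a, ∃ u ∈ T, m u = a) :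
    T ⊓ F₁.comap m ≤ F₂.comap p ↔ F₁.comap m ⊓ F₂.comap p ≤ T := by
  have hfinrank : Module.finrank K (T ⊓ F₁.comap m : Submodule K B) =
      Module.finrank K (F₁.comap m ⊓ F₂.comap p : Submodule K B) := by
    have hrank := finrank_inf_comap_add_finrank F₁ hm
    rw [finrank_comap_inf_comap hker hB]
    omega
  constructor
  · intro hle
    rw [← Submodule.eq_of_le_of_finrank_eq (le_inf inf_le_right hle) hfinrank]
    exact inf_le_left
  · intro hle
    rw [← Submodule.eq_of_le_of_finrank_eq (le_inf hle inf_le_left) hfinrank.symm]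
    exact inf_le_right

end LinearAlgebra

section Constraint

variable {A : Type*} [NormedAddCommGroup A] [NormedSpace ℝ A]
  {Q : Type*} [TopologicalSpace Q] [ChartedSpace A Q]
  {B : Type*} [NormedAddCommGroup B] [NormedSpace ℝ B]
  {V : Type*} [TopologicalSpace V] [ChartedSpace B V]

namespace DiscreteTangentBundle

variable (S : DiscreteTangentBundle A Q B V)

/-- The derivative of `∂⁺` at `v`, as a map between the model spaces. -/
def derivPlus (v : V) : B →L[ℝ] A := mfderiv 𝓘(ℝ, B) 𝓘(ℝ, A) S.dPlus v

/-- The derivative of `∂⁻` at `v`, as a map between the model spaces. -/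
def derivMinus (v : V) : B →L[ℝ] A := mfderiv 𝓘(ℝ, B) 𝓘(ℝ, A) S.dMinus v

lemma eq_zero_of_derivMinus_of_derivPlus {v : V} {u : B} (hminus : S.derivMinus v u = 0)
    (hplus : S.derivPlus v u = 0) : u = 0 :=
  S.ker_inf_ker v u hplus hminus

lemma exists_derivMinus_derivPlus [FiniteDimensional ℝ A] [FiniteDimensional ℝ B] (v : V)
    (a b : A) : ∃ u : B, S.derivMinus v u = a ∧ S.derivPlus v u = b := by
  obtain ⟨u, hu⟩ := surjective_prod_of_finrank_eq_two_mul (m := (S.derivMinus v).toLinearMap)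
    (p := (S.derivPlus v).toLinearMap) (fun _ => S.eq_zero_of_derivMinus_of_derivPlus) S.dim_eq
    (a, b)
  exact ⟨u, congrArg Prod.fst hu, congrArg Prod.snd hu⟩

variable {S}

lemma hasVelocity_dPlus {c : ℝ → V} {v : V} {u : B} (hc : HasVelocity 𝓘(ℝ, B) c univ 0 u)
    (hc0 : c 0 = v) : HasVelocity 𝓘(ℝ, A) (S.dPlus ∘ c) univ 0 (S.derivPlus v u) :=
  hc.comp_of_eq hc0 ((S.smooth_dPlus v).mdifferentiableAt (by simp))

lemma hasVelocity_dMinus {c : ℝ → V} {v : V} {u : B} (hc : HasVelocity 𝓘(ℝ, B) c univ 0 u)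
    (hc0 : c 0 = v) : HasVelocity 𝓘(ℝ, A) (S.dMinus ∘ c) univ 0 (S.derivMinus v u) :=
  hc.comp_of_eq hc0 ((S.smooth_dMinus v).mdifferentiableAt (by simp))

end DiscreteTangentBundle

variable [IsManifold 𝓘(ℝ, A) ∞ Q]
  {F : ∀ q : Q, Submodule ℝ (TangentSpace 𝓘(ℝ, A) q)} {r : ℕ}

lemma IsSmoothDistribution.finrank_eq (hF : IsSmoothDistribution 𝓘(ℝ, A) F r) (q : Q) :
    Module.finrank ℝ (F q) = r := by
  obtain ⟨U, -, hq, X, -, hX⟩ := hF q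
  rw [← (hX q hq).2, finrank_span_eq_card (hX q hq).1, Fintype.card_fin]

variable [IsManifold 𝓘(ℝ, B) ∞ V]

namespace DCLS

variable (S : DCLS A Q B V)

/-- The constraint distribution `F` is transported along `D_d`: a tangent vector of `D_d` whose
projection by `T∂⁻` lies in `F` also has its projection by `T∂⁺` in `F`. This infinitesimal
condition mediates between the four conditions of the theorem. -/
def TransportsConstraint (F : ∀ q : Q, Submodule ℝ (TangentSpace 𝓘(ℝ, A) q)) : Prop :=
  ∀ v ∈ S.D, ∀ u : B, (⟨v, u⟩ : TangentBundle 𝓘(ℝ, B) V) ∈ tangentTo 𝓘(ℝ, B) S.D →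
    S.derivMinus v u ∈ F (S.dMinus v) → S.derivPlus v u ∈ F (S.dPlus v)

variable {S} [FiniteDimensional ℝ A] [FiniteDimensional ℝ B]

lemma HasLinearConstraints.transportsConstraint_iff (hF : S.HasLinearConstraints F r) :
    S.TransportsConstraint F ↔ ∀ v ∈ S.D, ∀ u : B, S.derivMinus v u ∈ F (S.dMinus v) →
      S.derivPlus v u ∈ F (S.dPlus v) →
      (⟨v, u⟩ : TangentBundle 𝓘(ℝ, B) V) ∈ tangentTo 𝓘(ℝ, B) S.D := by
  refine forall₂_congr fun v hv => ?_
  obtain ⟨T, hTd, hT⟩ := S.submanifold_D.exists_tangent hv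
  have hdim := inf_comap_le_comap_iff (m := (S.derivMinus v).toLinearMap)
    (p := (S.derivPlus v).toLinearMap) (fun _ => S.eq_zero_of_derivMinus_of_derivPlus) S.dim_eq
    (hTd.trans hF.dim_eq) (F₁ := F (S.dMinus v)) (F₂ := F (S.dPlus v))
    (hF.smooth.finrank_eq _) (hF.smooth.finrank_eq _) fun a =>
      let ⟨u, hu, hua⟩ := S.submersion_dMinus_D v hv a
      ⟨u, (hT u).1 hu, hua⟩
  refine Iff.trans ?_ (hdim.trans ?_)
  · exact ⟨fun h u hu => h u ((hT u).2 hu.1) hu.2, fun h u hu hm => h ⟨(hT u).1 hu, hm⟩⟩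
  · exact ⟨fun h u hm hp => (hT u).2 (h ⟨hm, hp⟩), fun h u hu => (hT u).1 (h u hu.1 hu.2)⟩

theorem HasLinearConstraints.transportsConstraint_of_isInvolutive [SecondCountableTopology Q]
    (hF : S.HasLinearConstraints F r) (hinv : IsInvolutive 𝓘(ℝ, A) F) :
    S.TransportsConstraint F := by
  intro v hv u hu hm
  obtain ⟨y, hy0, hy, hyF⟩ := hF.smooth.exists_curve hm
  obtain ⟨c, rfl, hc, hcD, hcont⟩ := S.submanifold_D.exists_lift_curve S.smooth_dMinus hv
    (S.submersion_dMinus_D v hv) hu hy0 hy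
  have hreach : ∀ᶠ t in 𝓝 (0 : ℝ), Reachable 𝓘(ℝ, A) F (y t) (S.dPlus (c t)) :=
    hcD.mono fun t ⟨hctD, hty⟩ => hty ▸ hF.reachable _ hctD
  exact hinv.mem_of_reachable hF.smooth hyF hreach
    (DiscreteTangentBundle.hasVelocity_dPlus hc rfl)
    ((hcont (hyF.mono fun t ⟨_, _, hv⟩ => (continuousWithinAt_univ _ _).1 hv.1)).mono
      fun t ht => S.smooth_dPlus.continuous.continuousAt.comp ht)

end DCLS

end Constraint

lemma exists_fin_chain {α : Type*} {N : ℕ} {p : Fin N → α → Prop} {R : α → α → Prop}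
    (hzero : ∀ k : Fin N, (k : ℕ) = 0 → ∃ a, p k a)
    (hstep : ∀ k l : Fin N, (l : ℕ) = k + 1 → ∀ a, p k a → ∃ b, p l b ∧ R a b) :
    ∃ f : Fin N → α, (∀ k, p k (f k)) ∧ ∀ k l : Fin N, (l : ℕ) = k + 1 → R (f k) (f l) := by
  cases N with
  | zero => exact ⟨fun k => k.elim0, fun k => k.elim0, fun k => k.elim0⟩
  | succ N =>
    obtain ⟨a, ha⟩ := hzero 0 rfl
    choose next hp hR using fun k : Fin N => hstep k.castSucc k.succ rfl
    let f : ∀ k, {a // p k a} :=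
      Fin.induction ⟨a, ha⟩ fun k b => ⟨next k b.1 b.2, hp k b.1 b.2⟩
    refine ⟨fun k => (f k).1, fun k => (f k).2, fun k l hkl => ?_⟩
    obtain ⟨l, rfl⟩ := Fin.eq_succ_of_ne_zero (show l ≠ 0 from fun h => by simp [h] at hkl)
    obtain rfl : k = l.castSucc := Fin.ext (by simpa using hkl.symm)
    exact hR l _ (f l.castSucc).2

section Chain

variable {A : Type*} [NormedAddCommGroup A] [NormedSpace ℝ A]
  {Q : Type*} [TopologicalSpace Q] [ChartedSpace A Q]
  {B : Type*} [NormedAddCommGroup B] [NormedSpace ℝ B]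
  {V : Type*} [TopologicalSpace V] [ChartedSpace B V]
  {F : ∀ q : Q, Submodule ℝ (TangentSpace 𝓘(ℝ, A) q)} {r N : ℕ}

lemma mem_distribution_of_eq {q q' : Q} (h : q = q') {a : A} (ha : a ∈ F q) : a ∈ F q' :=
  h ▸ ha

/-- The linearization at `w` of the equations `∂⁺(w(k)) = ∂⁻(w(k+1))` that define `C_{d,N}`. It
characterizes the tangent vectors of `C_{d,N}` among the sequences `δ` of vectors of the model
space. -/
def DiscreteTangentBundle.LinearizedFirstOrder (S : DiscreteTangentBundle A Q B V)
    (w : Fin N → V) (δ : Fin N → B) : Prop :=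
  ∀ k l : Fin N, (l : ℕ) = k + 1 → S.derivPlus (w k) (δ k) = S.derivMinus (w l) (δ l)

variable [IsManifold 𝓘(ℝ, B) ∞ V]

lemma isEmbeddedSubmanifold_univ :
    IsEmbeddedSubmanifold (E := B) (univ : Set V) (Module.finrank ℝ B) := fun x _ =>
  ⟨chartAt B x, IsManifold.chart_mem_maximalAtlas x, mem_chart_source B x, ⊤, finrank_top ℝ B,
    fun _ _ => iff_of_true trivial trivial⟩

lemma mem_tangentTo_univ [FiniteDimensional ℝ B] (v : V) (u : B) :
    (⟨v, u⟩ : TangentBundle 𝓘(ℝ, B) V) ∈ tangentTo 𝓘(ℝ, B) (univ : Set V) :=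
  (mem_tangentTo_submanifold_iff (L := ⊤) (IsManifold.chart_mem_maximalAtlas v)
    (fun _ _ => iff_of_true trivial trivial) (mem_chart_source B v) (mem_univ v) u).2 trivial

variable [IsManifold 𝓘(ℝ, A) ∞ Q]

namespace DCLS

variable {S : DCLS A Q B V}

lemma tPlus_mk (w : Fin N → V) (δ : Fin N → B) (k : Fin N) :
    (S.tPlus (⟨w, δ⟩ : TangentBundle (powModel B N) (Fin N → V)) k : A) =
      S.derivPlus (w k) (δ k) :=
  congrArg (S.derivPlus (w k)) (entry_mk w δ k)

lemma tMinus_mk (w : Fin N → V) (δ : Fin N → B) (k : Fin N) :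
    (S.tMinus (⟨w, δ⟩ : TangentBundle (powModel B N) (Fin N → V)) k : A) =
      S.derivMinus (w k) (δ k) :=
  congrArg (S.derivMinus (w k)) (entry_mk w δ k)

lemma mem_fixedEndpoints {w : Fin N → V} {δ : Fin N → B} :
    (⟨w, δ⟩ : TangentBundle (powModel B N) (Fin N → V)) ∈ S.fixedEndpoints N ↔
      (∀ k : Fin N, (k : ℕ) = 0 → S.derivMinus (w k) (δ k) = 0) ∧
      ∀ k : Fin N, (k : ℕ) + 1 = N → S.derivPlus (w k) (δ k) = 0 :=
  and_congr
    (forall₂_congr fun k _ => iff_of_eq (congrArg (fun a : A => a = 0) (tMinus_mk w δ k)))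
    (forall₂_congr fun k _ => iff_of_eq (congrArg (fun a : A => a = 0) (tPlus_mk w δ k)))

lemma TransportsConstraint.derivPlus_mem (hP : S.TransportsConstraint F) {w : Fin N → V}
    (hw : w ∈ S.constrained N) {δ : Fin N → B}
    (hδD : ∀ k, (⟨w k, δ k⟩ : TangentBundle 𝓘(ℝ, B) V) ∈ tangentTo 𝓘(ℝ, B) S.D)
    (hδ : S.LinearizedFirstOrder w δ)
    (hzero : ∀ k : Fin N, (k : ℕ) = 0 → S.derivMinus (w k) (δ k) = 0) (k : Fin N) :
    S.derivPlus (w k) (δ k) ∈ F (S.dPlus (w k)) := by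
  obtain ⟨k, hk⟩ := k
  refine hP _ (hw.2 _) _ (hδD _) ?_
  induction k with
  | zero =>
    rw [hzero _ rfl]
    exact (F _).zero_mem
  | succ k ih =>
    rw [← hδ ⟨k, by omega⟩ _ rfl]
    exact mem_distribution_of_eq (hw.1 _ _ rfl) (hP _ (hw.2 _) _ (hδD _) (ih (by omega)))

lemma exists_constrained (hD : ∀ q : Q, ∃ v ∈ S.D, S.dMinus v = q) (hN : 2 ≤ N) {a b : V}
    (ha : a ∈ S.D) (hb : b ∈ S.D) (hab : S.dPlus a = S.dMinus b) :
    ∃ w ∈ S.constrained N, w ⟨0, by omega⟩ = a ∧ w ⟨1, by omega⟩ = b := by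
  obtain ⟨w, hw, hfirst⟩ := exists_fin_chain (N := N)
    (p := fun k v => v ∈ S.D ∧ ((k : ℕ) = 0 → v = a) ∧ ((k : ℕ) = 1 → v = b))
    (R := fun v v' => S.dPlus v = S.dMinus v')
    (fun k hk => ⟨a, ha, fun _ => rfl, fun h => by omega⟩) fun k l hkl v hv => by
      by_cases hl : (l : ℕ) = 1
      · obtain rfl := hv.2.1 (by omega)
        exact ⟨b, ⟨hb, fun h => by omega, fun _ => rfl⟩, hab⟩
      · obtain ⟨v', hv', hvv'⟩ := hD (S.dPlus v)
        exact ⟨v', ⟨hv', fun h => by omega, fun h => absurd h hl⟩, hvv'.symm⟩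
  exact ⟨w, ⟨hfirst, fun k => (hw k).1⟩, (hw _).2.1 rfl, (hw _).2.2 rfl⟩

lemma mem_tangentTo_and_linearizedFirstOrder {T : Set V} {w : Fin N → V} {δ : Fin N → B}
    (h : (⟨w, δ⟩ : TangentBundle (powModel B N) (Fin N → V)) ∈
      tangentTo (powModel B N) {w | w ∈ S.firstOrder N ∧ ∀ k, w k ∈ T}) :
    (∀ k, (⟨w k, δ k⟩ : TangentBundle 𝓘(ℝ, B) V) ∈ tangentTo 𝓘(ℝ, B) T) ∧
      S.LinearizedFirstOrder w δ := by
  obtain ⟨c, hc0, hc, hcT⟩ := mem_tangentTo_iff.1 h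
  have hck := hasVelocity_pow.1 hc
  refine ⟨fun k => mem_tangentTo_iff.2 ⟨fun t => c t k, congrFun hc0 k, hck k,
    hcT.mono fun t ht => ht.2 k⟩, fun k l hkl => ?_⟩
  refine (DiscreteTangentBundle.hasVelocity_dPlus (hck k) (congrFun hc0 k)).unique
    ((DiscreteTangentBundle.hasVelocity_dMinus (hck l) (congrFun hc0 l)).congr ?_)
  exact hcT.mono fun t ht => ht.1 k l hkl

variable [FiniteDimensional ℝ A] [FiniteDimensional ℝ B]

/-- A curve with velocity `δ` is built entry by entry: since `∂⁻` restricts to a submersion of `T`,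
the curve `∂⁺ ∘ c_k` lifts to a curve `c_{k+1}` in `T`. -/
lemma mem_tangentTo_chain_of_linearizedFirstOrder {T : Set V} {d : ℕ}
    (hT : IsEmbeddedSubmanifold (E := B) T d)
    (hsurj : ∀ v ∈ T, ∀ a : A, ∃ u : B,
      (⟨v, u⟩ : TangentBundle 𝓘(ℝ, B) V) ∈ tangentTo 𝓘(ℝ, B) T ∧ S.derivMinus v u = a)
    {w : Fin N → V} (hw : w ∈ S.firstOrder N) (hwT : ∀ k, w k ∈ T) {δ : Fin N → B}
    (hδT : ∀ k, (⟨w k, δ k⟩ : TangentBundle 𝓘(ℝ, B) V) ∈ tangentTo 𝓘(ℝ, B) T)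
    (hδ : S.LinearizedFirstOrder w δ) :
    (⟨w, δ⟩ : TangentBundle (powModel B N) (Fin N → V)) ∈
      tangentTo (powModel B N) {w | w ∈ S.firstOrder N ∧ ∀ k, w k ∈ T} := by
  obtain ⟨c, hc, hfirst⟩ := exists_fin_chain
    (p := fun (k : Fin N) (c : ℝ → V) => c 0 = w k ∧ HasVelocity 𝓘(ℝ, B) c univ 0 (δ k) ∧
      ∀ᶠ t in 𝓝 0, c t ∈ T)
    (R := fun c c' => ∀ᶠ t in 𝓝 0, S.dPlus (c t) = S.dMinus (c' t))
    (fun k _ => mem_tangentTo_iff.1 (hδT k)) fun k l hkl c ⟨hc0, hc, _⟩ => by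
      have hy0 : (S.dPlus ∘ c) 0 = S.dMinus (w l) :=
        (congrArg S.dPlus hc0).trans (hw k l hkl)
      have hy : HasVelocity 𝓘(ℝ, A) (S.dPlus ∘ c) univ 0 (S.derivMinus (w l) (δ l)) :=
        hδ k l hkl ▸ DiscreteTangentBundle.hasVelocity_dPlus hc hc0
      obtain ⟨c', hc'0, hc', hc'T, -⟩ := hT.exists_lift_curve S.smooth_dMinus (hwT l)
        (hsurj _ (hwT l)) (hδT l) hy0 hy
      exact ⟨c', ⟨hc'0, hc', hc'T.mono fun t ht => ht.1⟩, hc'T.mono fun t ht => ht.2.symm⟩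
  refine mem_tangentTo_iff.2 ⟨fun t k => c k t, funext fun k => (hc k).1,
    hasVelocity_pow.2 fun k => (hc k).2.1, Filter.Eventually.and ?_ ?_⟩
  · exact Filter.eventually_all.2 fun k => Filter.eventually_all.2 fun l =>
      Filter.eventually_imp_distrib_left.2 (hfirst k l)
  · exact Filter.eventually_all.2 fun k => (hc k).2.2

lemma mem_tangentTo_firstOrder {w : Fin N → V} (hw : w ∈ S.firstOrder N) {δ : Fin N → B} :
    (⟨w, δ⟩ : TangentBundle (powModel B N) (Fin N → V)) ∈
      tangentTo (powModel B N) (S.firstOrder N) ↔ S.LinearizedFirstOrder w δ := by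
  have huniv : S.firstOrder N = {w | w ∈ S.firstOrder N ∧ ∀ k, w k ∈ (univ : Set V)} :=
    ext fun w => (and_iff_left fun k => mem_univ (w k)).symm
  rw [huniv]
  refine ⟨fun h => (mem_tangentTo_and_linearizedFirstOrder h).2, fun hδ => ?_⟩
  refine mem_tangentTo_chain_of_linearizedFirstOrder isEmbeddedSubmanifold_univ
    (fun v _ a => ?_) hw (fun _ => mem_univ _) (fun _ => mem_tangentTo_univ _ _) hδ
  obtain ⟨u, hu, -⟩ := S.exists_derivMinus_derivPlus v a 0
  exact ⟨u, mem_tangentTo_univ v u, hu⟩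

lemma mem_tangentTo_constrained {w : Fin N → V} (hw : w ∈ S.constrained N) {δ : Fin N → B} :
    (⟨w, δ⟩ : TangentBundle (powModel B N) (Fin N → V)) ∈
        tangentTo (powModel B N) (S.constrained N) ↔
      (∀ k, (⟨w k, δ k⟩ : TangentBundle 𝓘(ℝ, B) V) ∈ tangentTo 𝓘(ℝ, B) S.D) ∧
        S.LinearizedFirstOrder w δ :=
  ⟨mem_tangentTo_and_linearizedFirstOrder, fun h => mem_tangentTo_chain_of_linearizedFirstOrder
    S.submanifold_D S.submersion_dMinus_D hw.1 hw.2 h.1 h.2⟩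

lemma HasLinearConstraints.mem_variations (hF : S.HasLinearConstraints F r) {w : Fin N → V}
    (hw : w ∈ S.constrained N) {δ : Fin N → B} :
    (⟨w, δ⟩ : TangentBundle (powModel B N) (Fin N → V)) ∈ S.variations N ↔
      S.LinearizedFirstOrder w δ ∧
      ((∀ k : Fin N, (k : ℕ) = 0 → S.derivMinus (w k) (δ k) = 0) ∧
        ∀ k : Fin N, (k : ℕ) + 1 = N → S.derivPlus (w k) (δ k) = 0) ∧
      ∀ k, S.derivPlus (w k) (δ k) ∈ F (S.dPlus (w k)) := by
  refine and_congr (mem_tangentTo_firstOrder hw.1) (and_congr mem_fixedEndpoints ?_)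
  have hE : ∀ k, S.tPlus (⟨w, δ⟩ : TangentBundle (powModel B N) (Fin N → V)) k ∈
      S.E ⟨w k, hw.2 k⟩ ↔ S.derivPlus (w k) (δ k) ∈ F (S.dPlus (w k)) := fun k => by
    rw [hF.E_eq]
    exact iff_of_eq (congrArg (fun a : A => a ∈ F (S.dPlus (w k))) (tPlus_mk w δ k))
  exact ⟨fun ⟨_, h⟩ k => (hE k).1 (h k), fun h => ⟨hw, fun k => (hE k).2 (h k)⟩⟩

lemma HasLinearConstraints.derivMinus_mem_of_mem_variations (hF : S.HasLinearConstraints F r)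
    {w : Fin N → V} (hw : w ∈ S.constrained N) {δ : Fin N → B}
    (hδ : (⟨w, δ⟩ : TangentBundle (powModel B N) (Fin N → V)) ∈ S.variations N) (k : Fin N) :
    S.derivMinus (w k) (δ k) ∈ F (S.dMinus (w k)) := by
  obtain ⟨hfirst, ⟨hzero, -⟩, hplus⟩ := (hF.mem_variations hw).1 hδ
  obtain ⟨k, hk⟩ := k
  cases k with
  | zero =>
    rw [hzero _ rfl]
    exact (F _).zero_mem
  | succ k =>
    rw [← hfirst ⟨k, by omega⟩ _ rfl]
    exact mem_distribution_of_eq (hw.1 _ _ rfl) (hplus _)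

theorem HasLinearConstraints.variations_eq (hF : S.HasLinearConstraints F r)
    (hP : S.TransportsConstraint F) :
    S.variations N = {δ | δ ∈ tangentTo (powModel B N) (S.constrained N) ∧
      δ ∈ S.fixedEndpoints N} := by
  ext ⟨w, δ⟩
  constructor
  · intro hδ
    have hw : w ∈ S.constrained N := hδ.2.2.1
    obtain ⟨hfirst, -, hplus⟩ := (hF.mem_variations hw).1 hδ
    refine ⟨(mem_tangentTo_constrained hw).2 ⟨fun k => ?_, hfirst⟩, hδ.2.1⟩
    exact hF.transportsConstraint_iff.1 hP _ (hw.2 k) _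
      (hF.derivMinus_mem_of_mem_variations hw hδ k) (hplus k)
  · rintro ⟨hδ, hend⟩
    have hw : w ∈ S.constrained N := base_mem_of_mem_tangentTo hδ
    obtain ⟨hδD, hfirst⟩ := (mem_tangentTo_constrained hw).1 hδ
    have hends := mem_fixedEndpoints.1 hend
    exact (hF.mem_variations hw).2 ⟨hfirst, hends, hP.derivPlus_mem hw hδD hfirst hends.1⟩

/-- The sequence `(x, y, 0, …, 0)` is a variation of a constrained sequence `(a, b, …)`. -/
lemma HasLinearConstraints.mem_tangentTo_of_variations_subset (hF : S.HasLinearConstraints F r)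
    (hD : ∀ q : Q, ∃ v ∈ S.D, S.dMinus v = q) (hN : 2 ≤ N)
    (hW : S.variations N ⊆ tangentTo (powModel B N) (S.constrained N)) {a b : V}
    (ha : a ∈ S.D) (hb : b ∈ S.D) (hab : S.dPlus a = S.dMinus b) {x y : B}
    (hx : S.derivMinus a x = 0) (hxy : S.derivPlus a x = S.derivMinus b y)
    (hy : S.derivPlus b y = 0) (hmem : S.derivPlus a x ∈ F (S.dPlus a)) :
    (⟨a, x⟩ : TangentBundle 𝓘(ℝ, B) V) ∈ tangentTo 𝓘(ℝ, B) S.D ∧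
      (⟨b, y⟩ : TangentBundle 𝓘(ℝ, B) V) ∈ tangentTo 𝓘(ℝ, B) S.D := by
  obtain ⟨w, hw, rfl, rfl⟩ := exists_constrained hD hN ha hb hab
  let δ : ℕ → B
    | 0 => x
    | 1 => y
    | _ + 2 => 0
  have hδ : (⟨w, fun k => δ k⟩ : TangentBundle (powModel B N) (Fin N → V)) ∈ S.variations N := by
    refine (hF.mem_variations (δ := fun k => δ k) hw).2 ⟨?_, ⟨?_, ?_⟩, ?_⟩
    · rintro ⟨k, hk⟩ ⟨l, hl⟩ (rfl : l = k + 1)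
      rcases k with _ | _ | k
      · exact hxy
      · exact hy.trans (map_zero _).symm
      · exact (map_zero _).trans (map_zero _).symm
    · rintro ⟨k, hk⟩ (rfl : k = 0)
      exact hx
    · rintro ⟨k, hk⟩ hkN
      rcases k with _ | _ | k
      · exact absurd (show 0 + 1 = N from hkN) (by omega)
      · exact hy
      · exact map_zero _
    · rintro ⟨k, hk⟩
      rcases k with _ | _ | k
      · exact hmem
      · exact hy ▸ (F _).zero_mem
      · exact (map_zero (S.derivPlus (w ⟨k + 2, hk⟩))).symm ▸ (F _).zero_mem
  have hδD := ((mem_tangentTo_constrained (δ := fun k => δ k) hw).1 (hW hδ)).1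
  exact ⟨hδD ⟨0, by omega⟩, hδD ⟨1, by omega⟩⟩

/-- Split `u` with both projections in `F` as `x + y` with `T∂⁻ x = 0` and `T∂⁺ y = 0`: then `x` is
the first entry of a variation, and `y` is the second entry of another one. -/
theorem HasLinearConstraints.transportsConstraint_of_variations_subset
    (hF : S.HasLinearConstraints F r)
    (hD : ∀ q : Q, ∃ v ∈ S.D, ∃ v' ∈ S.D, S.dPlus v = q ∧ S.dMinus v' = q) (hN : 2 ≤ N)
    (hW : S.variations N ⊆ tangentTo (powModel B N) (S.constrained N)) :
    S.TransportsConstraint F := by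
  have hstart : ∀ q : Q, ∃ v ∈ S.D, S.dMinus v = q := fun q =>
    let ⟨_, _, v, hv, _, hq⟩ := hD q
    ⟨v, hv, hq⟩
  refine hF.transportsConstraint_iff.2 fun v hv u hminus hplus => ?_
  obtain ⟨x, hxminus, hxplus⟩ := S.exists_derivMinus_derivPlus v 0 (S.derivPlus v u)
  obtain ⟨y, hyminus, hyplus⟩ := S.exists_derivMinus_derivPlus v (S.derivMinus v u) 0
  have hu : u = x + y := by
    refine sub_eq_zero.1 (S.eq_zero_of_derivMinus_of_derivPlus (v := v) ?_ ?_)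
    · rw [map_sub, map_add, hxminus, hyminus, zero_add, sub_self]
    · rw [map_sub, map_add, hxplus, hyplus, add_zero, sub_self]
  have hx : (⟨v, x⟩ : TangentBundle 𝓘(ℝ, B) V) ∈ tangentTo 𝓘(ℝ, B) S.D := by
    obtain ⟨b, hb, hvb⟩ := hstart (S.dPlus v)
    obtain ⟨z, hzminus, hzplus⟩ := S.exists_derivMinus_derivPlus b (S.derivPlus v x) 0
    exact (hF.mem_tangentTo_of_variations_subset hstart hN hW hv hb hvb.symm hxminus
      hzminus.symm hzplus (hxplus ▸ hplus)).1
  have hy : (⟨v, y⟩ : TangentBundle 𝓘(ℝ, B) V) ∈ tangentTo 𝓘(ℝ, B) S.D := by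
    obtain ⟨a, ha, -, -, hav, -⟩ := hD (S.dMinus v)
    obtain ⟨z, hzminus, hzplus⟩ := S.exists_derivMinus_derivPlus a 0 (S.derivMinus v y)
    exact (hF.mem_tangentTo_of_variations_subset hstart hN hW ha hv hav hzminus hzplus hyplus
      (mem_distribution_of_eq hav.symm (hzplus.trans hyminus ▸ hminus))).2
  obtain ⟨T, -, hT⟩ := S.submanifold_D.exists_tangent hv
  rw [hT, hu]
  exact T.add_mem ((hT x).1 hx) ((hT y).1 hy)

end DCLS

end Chain

section Bracket

variable {E : Type*} [NormedAddCommGroup E] [NormedSpace ℝ E]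
  {H : Type*} [TopologicalSpace H] {I : ModelWithCorners ℝ E H}
  {M : Type*} [TopologicalSpace M] [ChartedSpace H M]
  {G : Type*} [NormedAddCommGroup G] [NormedSpace ℝ G]
  {X Y : ∀ x : M, TangentSpace I x} {U S : Set M} {x : M}

lemma fieldDeriv_const (a : G) : fieldDeriv I (fun _ : M => a) X x = 0 := by
  have hconst : mfderiv I 𝓘(ℝ, G) (fun _ : M => a) x = 0 := mfderiv_const
  exact congrArg (fun T : E →L[ℝ] G => T (X x)) hconst

lemma fieldDeriv_eq_of_mem_tangentTo {g g' : M → G} (hU : IsOpen U) (hx : x ∈ U)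
    (hg : MDifferentiableAt I 𝓘(ℝ, G) g x) (hg' : MDifferentiableAt I 𝓘(ℝ, G) g' x)
    (hX : (⟨x, X x⟩ : TangentBundle I M) ∈ tangentTo I S) (hgg' : EqOn g g' (U ∩ S)) :
    fieldDeriv I g X x = fieldDeriv I g' X x := by
  obtain ⟨c, hc0, hc, hcS⟩ := mem_tangentTo_iff.1 hX
  have hcU : ∀ᶠ t in 𝓝 0, c t ∈ U :=
    ((continuousWithinAt_univ _ _).1 hc.1).eventually_mem (hU.mem_nhds (by rwa [hc0]))
  refine (hc.comp_of_eq hc0 hg).unique ((hc.comp_of_eq hc0 hg').congr ?_)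
  exact (hcU.and hcS).mono fun t ht => hgg' ht

variable {A : Type*} [NormedAddCommGroup A] [NormedSpace ℝ A]
  {Q : Type*} [TopologicalSpace Q] [ChartedSpace A Q] {f f' : M → Q}

lemma fieldDeriv_comp_map {h : Q → G} (hh : MDifferentiableAt 𝓘(ℝ, A) 𝓘(ℝ, G) h (f x))
    (hf : MDifferentiableAt I 𝓘(ℝ, A) f x) :
    fieldDeriv I (h ∘ f) X x = (mfderiv 𝓘(ℝ, A) 𝓘(ℝ, G) h (f x)
      (mfderiv I 𝓘(ℝ, A) f x (X x)) : G) :=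
  congrArg (fun T : E →L[ℝ] G => T (X x)) (mfderiv_comp x hh hf)

lemma mfderiv_apply_congr {h : Q → G} {y y' : Q} (hy : y = y') {a a' : A} (ha : a = a') :
    (mfderiv 𝓘(ℝ, A) 𝓘(ℝ, G) h y a : G) = mfderiv 𝓘(ℝ, A) 𝓘(ℝ, G) h y' a' := by
  subst hy ha
  rfl

lemma fieldDeriv_comp_map_of_contMDiff {h : Q → G} {W : Set Q} (hW : IsOpen W)
    (hh : ContMDiffOn 𝓘(ℝ, A) 𝓘(ℝ, G) ∞ h W) (hf : ContMDiff I 𝓘(ℝ, A) ∞ f) (hx : f x ∈ W) :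
    fieldDeriv I (h ∘ f) X x = (mfderiv 𝓘(ℝ, A) 𝓘(ℝ, G) h (f x)
      (mfderiv I 𝓘(ℝ, A) f x (X x)) : G) :=
  fieldDeriv_comp_map (((hh _ hx).contMDiffAt (hW.mem_nhds hx)).mdifferentiableAt (by simp))
    ((hf x).mdifferentiableAt (by simp))

variable [IsManifold I ∞ M] [I.Boundaryless] [CompleteSpace E]

lemma fieldDeriv_mlieBracket_eq {g g' : M → G} (hU : IsOpen U)
    (hg : ContMDiffOn I 𝓘(ℝ, G) ∞ g U) (hg' : ContMDiffOn I 𝓘(ℝ, G) ∞ g' U)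
    (hX : SmoothFieldOn I X U) (hY : SmoothFieldOn I Y U) (hx : x ∈ U)
    (hXS : (⟨x, X x⟩ : TangentBundle I M) ∈ tangentTo I S)
    (hYS : (⟨x, Y x⟩ : TangentBundle I M) ∈ tangentTo I S)
    (hgX : EqOn (fieldDeriv I g X) (fieldDeriv I g' X) (U ∩ S))
    (hgY : EqOn (fieldDeriv I g Y) (fieldDeriv I g' Y) (U ∩ S)) :
    fieldDeriv I g (VectorField.mlieBracket I X Y) x =
      fieldDeriv I g' (VectorField.mlieBracket I X Y) x := by
  have hdiff : ∀ {g : M → G}, ContMDiffOn I 𝓘(ℝ, G) ∞ g U → ∀ {Z : ∀ x : M, TangentSpace I x},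
      SmoothFieldOn I Z U → MDifferentiableAt I 𝓘(ℝ, G) (fieldDeriv I g Z) x := fun hg _ hZ =>
    ((contMDiffOn_fieldDeriv hU hg hZ x hx).contMDiffAt (hU.mem_nhds hx)).mdifferentiableAt
      (by simp)
  rw [fieldDeriv_mlieBracket hU hg hX hY hx, fieldDeriv_mlieBracket hU hg' hX hY hx,
    fieldDeriv_eq_of_mem_tangentTo hU hx (hdiff hg hY) (hdiff hg' hY) hXS hgY,
    fieldDeriv_eq_of_mem_tangentTo hU hx (hdiff hg hX) (hdiff hg' hX) hYS hgX]

lemma mfderiv_comp_map_mlieBracket_eq_zero {h : Q → G} {W : Set Q} (hW : IsOpen W)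
    (hh : ContMDiffOn 𝓘(ℝ, A) 𝓘(ℝ, G) ∞ h W) (hf : ContMDiff I 𝓘(ℝ, A) ∞ f) (hU : IsOpen U)
    (hX : SmoothFieldOn I X U) (hY : SmoothFieldOn I Y U) (hx : x ∈ U) (hfx : f x ∈ W)
    (hXS : (⟨x, X x⟩ : TangentBundle I M) ∈ tangentTo I S)
    (hYS : (⟨x, Y x⟩ : TangentBundle I M) ∈ tangentTo I S)
    (hfX : ∀ y ∈ U ∩ S, f y ∈ W → (mfderiv 𝓘(ℝ, A) 𝓘(ℝ, G) h (f y)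
      (mfderiv I 𝓘(ℝ, A) f y (X y)) : G) = 0)
    (hfY : ∀ y ∈ U ∩ S, f y ∈ W → (mfderiv 𝓘(ℝ, A) 𝓘(ℝ, G) h (f y)
      (mfderiv I 𝓘(ℝ, A) f y (Y y)) : G) = 0) :
    (mfderiv 𝓘(ℝ, A) 𝓘(ℝ, G) h (f x)
      (mfderiv I 𝓘(ℝ, A) f x (VectorField.mlieBracket I X Y x)) : G) = 0 := by
  have hUW : IsOpen (U ∩ f ⁻¹' W) := hU.inter (hW.preimage hf.continuous)
  have hbracket := fieldDeriv_mlieBracket_eq (S := S) (g := h ∘ f) (g' := fun _ => 0) hUW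
    (hh.comp hf.contMDiffOn fun _ hy => hy.2) contMDiffOn_const (hX.mono inter_subset_left)
    (hY.mono inter_subset_left) ⟨hx, hfx⟩ hXS hYS
    (fun y hy => (fieldDeriv_comp_map_of_contMDiff hW hh hf hy.1.2).trans
      ((hfX y ⟨hy.1.1, hy.2⟩ hy.1.2).trans (fieldDeriv_const (0 : G)).symm))
    (fun y hy => (fieldDeriv_comp_map_of_contMDiff hW hh hf hy.1.2).trans
      ((hfY y ⟨hy.1.1, hy.2⟩ hy.1.2).trans (fieldDeriv_const (0 : G)).symm))
  exact (fieldDeriv_comp_map_of_contMDiff hW hh hf hfx).symm.trans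
    (hbracket.trans (fieldDeriv_const (0 : G)))

section Submanifold

variable [FiniteDimensional ℝ A]

lemma exists_ker_eq (L : Submodule ℝ A) : ∃ P : A →L[ℝ] A, ∀ u, P u = 0 ↔ u ∈ L := by
  obtain ⟨L', hL'⟩ := L.exists_isCompl
  exact ⟨LinearMap.toContinuousLinearMap (L'.projection L hL'.symm),
    fun u => Submodule.projection_apply_eq_zero_iff hL'.symm⟩

lemma IsEmbeddedSubmanifold.exists_definingMap {T : Set Q} {d : ℕ}
    (hT : IsEmbeddedSubmanifold (E := A) T d) {q : Q} (hq : q ∈ T) :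
    ∃ W : Set Q, IsOpen W ∧ q ∈ W ∧ ∃ h : Q → A, ContMDiffOn 𝓘(ℝ, A) 𝓘(ℝ, A) ∞ h W ∧
      ∀ y ∈ W, y ∈ T → ∀ u : A, (⟨y, u⟩ : TangentBundle 𝓘(ℝ, A) Q) ∈ tangentTo 𝓘(ℝ, A) T ↔
        (mfderiv 𝓘(ℝ, A) 𝓘(ℝ, A) h y u : A) = 0 := by
  obtain ⟨φ, hφ, hqφ, L, -, hL⟩ := hT q hq
  obtain ⟨P, hP⟩ := exists_ker_eq L
  have hφsmooth := contMDiffOn_of_mem_maximalAtlas hφ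
  refine ⟨φ.source, φ.open_source, hqφ, P ∘ φ, P.contMDiff.comp_contMDiffOn hφsmooth,
    fun y hyφ hyT u => ?_⟩
  have hφdiff : MDifferentiableAt 𝓘(ℝ, A) 𝓘(ℝ, A) φ y :=
    ((hφsmooth y hyφ).contMDiffAt (φ.open_source.mem_nhds hyφ)).mdifferentiableAt (by simp)
  have hcomp : mfderiv 𝓘(ℝ, A) 𝓘(ℝ, A) (P ∘ φ) y =
      P.comp (mfderiv 𝓘(ℝ, A) 𝓘(ℝ, A) φ y : A →L[ℝ] A) :=
    (P.hasMFDerivAt.comp y hφdiff.hasMFDerivAt).mfderiv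
  exact ((mem_tangentTo_submanifold_iff hφ hL hyφ hyT u).trans (hP _).symm).trans
    (iff_of_eq (congrArg (fun T : A →L[ℝ] A => T u = 0) hcomp.symm))

lemma mfderiv_mlieBracket_mem_tangentTo {T : Set Q} {d : ℕ}
    (hT : IsEmbeddedSubmanifold (E := A) T d) (hf : ContMDiff I 𝓘(ℝ, A) ∞ f) (hU : IsOpen U)
    (hX : SmoothFieldOn I X U) (hY : SmoothFieldOn I Y U) (hx : x ∈ U)
    (hXS : (⟨x, X x⟩ : TangentBundle I M) ∈ tangentTo I S)
    (hYS : (⟨x, Y x⟩ : TangentBundle I M) ∈ tangentTo I S) (hS : MapsTo f S T)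
    (hfX : ∀ y ∈ U ∩ S, (⟨f y, mfderiv I 𝓘(ℝ, A) f y (X y)⟩ : TangentBundle 𝓘(ℝ, A) Q) ∈
      tangentTo 𝓘(ℝ, A) T)
    (hfY : ∀ y ∈ U ∩ S, (⟨f y, mfderiv I 𝓘(ℝ, A) f y (Y y)⟩ : TangentBundle 𝓘(ℝ, A) Q) ∈
      tangentTo 𝓘(ℝ, A) T) :
    (⟨f x, mfderiv I 𝓘(ℝ, A) f x (VectorField.mlieBracket I X Y x)⟩ : TangentBundle 𝓘(ℝ, A) Q) ∈
      tangentTo 𝓘(ℝ, A) T := by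
  have hxT : f x ∈ T := hS (base_mem_of_mem_tangentTo hXS)
  obtain ⟨W, hW, hxW, h, hh, htangent⟩ := hT.exists_definingMap hxT
  exact (htangent _ hxW hxT _).2 (mfderiv_comp_map_mlieBracket_eq_zero hW hh hf hU hX hY hx hxW
    hXS hYS (fun y hy hyW => (htangent _ hyW (hS hy.2) _).1 (hfX y hy))
    (fun y hy hyW => (htangent _ hyW (hS hy.2) _).1 (hfY y hy)))

end Submanifold

variable [IsManifold 𝓘(ℝ, A) ∞ Q]

lemma mfderiv_mlieBracket_eq_zero (hf : ContMDiff I 𝓘(ℝ, A) ∞ f) (hU : IsOpen U)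
    (hX : SmoothFieldOn I X U) (hY : SmoothFieldOn I Y U) (hx : x ∈ U)
    (hXS : (⟨x, X x⟩ : TangentBundle I M) ∈ tangentTo I S)
    (hYS : (⟨x, Y x⟩ : TangentBundle I M) ∈ tangentTo I S)
    (hfX : ∀ y ∈ U ∩ S, (mfderiv I 𝓘(ℝ, A) f y (X y) : A) = 0)
    (hfY : ∀ y ∈ U ∩ S, (mfderiv I 𝓘(ℝ, A) f y (Y y) : A) = 0) :
    (mfderiv I 𝓘(ℝ, A) f x (VectorField.mlieBracket I X Y x) : A) = 0 := by
  have hsource : f x ∈ (extChartAt 𝓘(ℝ, A) (f x)).source := mem_extChartAt_source (f x)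
  refine (isInvertible_mfderiv_extChartAt (I := 𝓘(ℝ, A)) hsource).injective
    ((mfderiv_comp_map_mlieBracket_eq_zero (isOpen_extChartAt_source (f x))
      (contMDiffOn_extChartAt' (f x)) hf hU hX hY hx hsource hXS hYS ?_ ?_).trans
        (map_zero _).symm)
  · exact fun y hy _ => (congrArg _ (hfX y hy)).trans (map_zero _)
  · exact fun y hy _ => (congrArg _ (hfY y hy)).trans (map_zero _)

lemma mfderiv_mlieBracket_eq (hf : ContMDiff I 𝓘(ℝ, A) ∞ f) (hf' : ContMDiff I 𝓘(ℝ, A) ∞ f')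
    (hU : IsOpen U) (hX : SmoothFieldOn I X U) (hY : SmoothFieldOn I Y U) (hx : x ∈ U)
    (hXS : (⟨x, X x⟩ : TangentBundle I M) ∈ tangentTo I S)
    (hYS : (⟨x, Y x⟩ : TangentBundle I M) ∈ tangentTo I S) (hff' : EqOn f f' S)
    (hfX : ∀ y ∈ U ∩ S, (mfderiv I 𝓘(ℝ, A) f y (X y) : A) = mfderiv I 𝓘(ℝ, A) f' y (X y))
    (hfY : ∀ y ∈ U ∩ S, (mfderiv I 𝓘(ℝ, A) f y (Y y) : A) = mfderiv I 𝓘(ℝ, A) f' y (Y y)) :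
    (mfderiv I 𝓘(ℝ, A) f x (VectorField.mlieBracket I X Y x) : A) =
      mfderiv I 𝓘(ℝ, A) f' x (VectorField.mlieBracket I X Y x) := by
  have hxx' : f x = f' x := hff' (base_mem_of_mem_tangentTo hXS)
  have hsource : f x ∈ (extChartAt 𝓘(ℝ, A) (f x)).source := mem_extChartAt_source (f x)
  have hsource' : f' x ∈ (extChartAt 𝓘(ℝ, A) (f x)).source := hxx' ▸ hsource
  have hopen := isOpen_extChartAt_source (I := 𝓘(ℝ, A)) (f x)
  have hchart := contMDiffOn_extChartAt' (A := A) (f x)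
  have hbracket := fieldDeriv_mlieBracket_eq (S := S) (g := extChartAt 𝓘(ℝ, A) (f x) ∘ f)
    (g' := extChartAt 𝓘(ℝ, A) (f x) ∘ f')
    ((hU.inter (hopen.preimage hf.continuous)).inter (hopen.preimage hf'.continuous))
    (hchart.comp hf.contMDiffOn fun _ hy => hy.1.2) (hchart.comp hf'.contMDiffOn fun _ hy => hy.2)
    (hX.mono fun _ hy => hy.1.1) (hY.mono fun _ hy => hy.1.1) ⟨⟨hx, hsource⟩, hsource'⟩ hXS hYS
    (fun y hy => (fieldDeriv_comp_map_of_contMDiff hopen hchart hf hy.1.1.2).trans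
      ((mfderiv_apply_congr (A := A) (hff' hy.2) (hfX y ⟨hy.1.1.1, hy.2⟩)).trans
        (fieldDeriv_comp_map_of_contMDiff hopen hchart hf' hy.1.2).symm))
    (fun y hy => (fieldDeriv_comp_map_of_contMDiff hopen hchart hf hy.1.1.2).trans
      ((mfderiv_apply_congr (A := A) (hff' hy.2) (hfY y ⟨hy.1.1.1, hy.2⟩)).trans
        (fieldDeriv_comp_map_of_contMDiff hopen hchart hf' hy.1.2).symm))
  refine (isInvertible_mfderiv_extChartAt (I := 𝓘(ℝ, A)) hsource).injective ?_
  exact (fieldDeriv_comp_map_of_contMDiff hopen hchart hf hsource).symm.trans (hbracket.trans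
    ((fieldDeriv_comp_map_of_contMDiff hopen hchart hf' hsource').trans
      (mfderiv_apply_congr hxx'.symm rfl)))

end Bracket

section Involutive

variable {A : Type*} [NormedAddCommGroup A] [NormedSpace ℝ A]
  {Q : Type*} [TopologicalSpace Q] [ChartedSpace A Q]
  {B : Type*} [NormedAddCommGroup B] [NormedSpace ℝ B]
  {V : Type*} [TopologicalSpace V] [ChartedSpace B V]
  {F : ∀ q : Q, Submodule ℝ (TangentSpace 𝓘(ℝ, A) q)} {r N : ℕ}

lemma mfderiv_comp_eval {p : V → Q} (hp : MDifferentiable 𝓘(ℝ, B) 𝓘(ℝ, A) p) (k : Fin N)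
    (w : Fin N → V) (δ : Fin N → B) :
    (mfderiv (powModel B N) 𝓘(ℝ, A) (fun w : Fin N → V => p (w k)) w δ : A) =
      mfderiv 𝓘(ℝ, B) 𝓘(ℝ, A) p (w k) (δ k) := by
  have hcomp := mfderiv_comp w (hp (w k)) ((contMDiff_eval k w).mdifferentiableAt (by simp))
  refine (congrArg (fun T : (Fin N → B) →L[ℝ] A => T δ) hcomp).trans ?_
  exact congrArg (fun T : (Fin N → B) →L[ℝ] B => (mfderiv 𝓘(ℝ, B) 𝓘(ℝ, A) p (w k) (T δ) : A))
    (mfderiv_eval k w)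

namespace DiscreteTangentBundle

variable (S : DiscreteTangentBundle A Q B V)

lemma mfderiv_dPlus_eval (k : Fin N) (w : Fin N → V) (δ : Fin N → B) :
    (mfderiv (powModel B N) 𝓘(ℝ, A) (fun w : Fin N → V => S.dPlus (w k)) w δ : A) =
      S.derivPlus (w k) (δ k) :=
  mfderiv_comp_eval (S.smooth_dPlus.mdifferentiable (by simp)) k w δ

lemma mfderiv_dMinus_eval (k : Fin N) (w : Fin N → V) (δ : Fin N → B) :
    (mfderiv (powModel B N) 𝓘(ℝ, A) (fun w : Fin N → V => S.dMinus (w k)) w δ : A) =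
      S.derivMinus (w k) (δ k) :=
  mfderiv_comp_eval (S.smooth_dMinus.mdifferentiable (by simp)) k w δ

end DiscreteTangentBundle

variable [IsManifold 𝓘(ℝ, A) ∞ Q] [IsManifold 𝓘(ℝ, B) ∞ V]

namespace DCLS

variable {S : DCLS A Q B V} {X Y : ∀ w : Fin N → V, TangentSpace (powModel B N) w}
  {U : Set (Fin N → V)} {w : Fin N → V}

lemma mlieBracket_mem_fixedEndpoints [CompleteSpace B] {R : Set (Fin N → V)} (hU : IsOpen U)
    (hX : SmoothFieldOn (powModel B N) X U) (hY : SmoothFieldOn (powModel B N) Y U) (hw : w ∈ U)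
    (hXR : (⟨w, X w⟩ : TangentBundle (powModel B N) (Fin N → V)) ∈ tangentTo (powModel B N) R)
    (hYR : (⟨w, Y w⟩ : TangentBundle (powModel B N) (Fin N → V)) ∈ tangentTo (powModel B N) R)
    (hXend : ∀ w ∈ U ∩ R,
      (⟨w, X w⟩ : TangentBundle (powModel B N) (Fin N → V)) ∈ S.fixedEndpoints N)
    (hYend : ∀ w ∈ U ∩ R,
      (⟨w, Y w⟩ : TangentBundle (powModel B N) (Fin N → V)) ∈ S.fixedEndpoints N) :
    (⟨w, VectorField.mlieBracket (powModel B N) X Y w⟩ :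
      TangentBundle (powModel B N) (Fin N → V)) ∈ S.fixedEndpoints N := by
  refine mem_fixedEndpoints.2 ⟨fun k hk => ?_, fun k hk => ?_⟩
  · refine (S.mfderiv_dMinus_eval k w _).symm.trans (mfderiv_mlieBracket_eq_zero
      (S.smooth_dMinus.comp (contMDiff_eval k)) hU hX hY hw hXR hYR (fun y hy => ?_) fun y hy => ?_)
    · exact (S.mfderiv_dMinus_eval k y _).trans ((mem_fixedEndpoints.1 (hXend y hy)).1 k hk)
    · exact (S.mfderiv_dMinus_eval k y _).trans ((mem_fixedEndpoints.1 (hYend y hy)).1 k hk)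
  · refine (S.mfderiv_dPlus_eval k w _).symm.trans (mfderiv_mlieBracket_eq_zero
      (S.smooth_dPlus.comp (contMDiff_eval k)) hU hX hY hw hXR hYR (fun y hy => ?_) fun y hy => ?_)
    · exact (S.mfderiv_dPlus_eval k y _).trans ((mem_fixedEndpoints.1 (hXend y hy)).2 k hk)
    · exact (S.mfderiv_dPlus_eval k y _).trans ((mem_fixedEndpoints.1 (hYend y hy)).2 k hk)

variable [FiniteDimensional ℝ A] [FiniteDimensional ℝ B]

lemma mlieBracket_mem_tangentTo_constrained (hU : IsOpen U)
    (hX : SmoothFieldOn (powModel B N) X U) (hY : SmoothFieldOn (powModel B N) Y U)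
    (hXtangent : ∀ w ∈ U ∩ S.constrained N, (⟨w, X w⟩ :
      TangentBundle (powModel B N) (Fin N → V)) ∈ tangentTo (powModel B N) (S.constrained N))
    (hYtangent : ∀ w ∈ U ∩ S.constrained N, (⟨w, Y w⟩ :
      TangentBundle (powModel B N) (Fin N → V)) ∈ tangentTo (powModel B N) (S.constrained N))
    (hw : w ∈ U ∩ S.constrained N) :
    (⟨w, VectorField.mlieBracket (powModel B N) X Y w⟩ :
      TangentBundle (powModel B N) (Fin N → V)) ∈ tangentTo (powModel B N) (S.constrained N) := by
  have heval : ∀ (k : Fin N) (w : Fin N → V) (δ : Fin N → B),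
      ((⟨w k, mfderiv (powModel B N) 𝓘(ℝ, B) (fun w : Fin N → V => w k) w δ⟩ :
        TangentBundle 𝓘(ℝ, B) V) ∈ tangentTo 𝓘(ℝ, B) S.D) =
      ((⟨w k, δ k⟩ : TangentBundle 𝓘(ℝ, B) V) ∈ tangentTo 𝓘(ℝ, B) S.D) := fun k w δ =>
    congrArg (fun T : (Fin N → B) →L[ℝ] B =>
      (⟨w k, T δ⟩ : TangentBundle 𝓘(ℝ, B) V) ∈ tangentTo 𝓘(ℝ, B) S.D) (mfderiv_eval k w)
  refine (mem_tangentTo_constrained hw.2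
    (δ := VectorField.mlieBracket (powModel B N) X Y w)).2 ⟨fun k => ?_, fun k l hkl => ?_⟩
  · refine (heval k w _).mp (mfderiv_mlieBracket_mem_tangentTo S.submanifold_D (contMDiff_eval k)
      hU hX hY hw.1 (hXtangent w hw) (hYtangent w hw) (fun y hy => hy.2 k) (fun y hy => ?_)
      fun y hy => ?_)
    · exact (heval k y _).mpr (((mem_tangentTo_constrained hy.2).1 (hXtangent y hy)).1 k)
    · exact (heval k y _).mpr (((mem_tangentTo_constrained hy.2).1 (hYtangent y hy)).1 k)
  · refine (S.mfderiv_dPlus_eval k w _).symm.trans ((mfderiv_mlieBracket_eq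
      (S.smooth_dPlus.comp (contMDiff_eval k)) (S.smooth_dMinus.comp (contMDiff_eval l)) hU hX hY
      hw.1 (hXtangent w hw) (hYtangent w hw) (fun y hy => hy.1 k l hkl) (fun y hy => ?_)
      fun y hy => ?_).trans (S.mfderiv_dMinus_eval l w _))
    · exact (S.mfderiv_dPlus_eval k y _).trans
        ((((mem_tangentTo_constrained hy.2).1 (hXtangent y hy)).2 k l hkl).trans
          (S.mfderiv_dMinus_eval l y _).symm)
    · exact (S.mfderiv_dPlus_eval k y _).trans
        ((((mem_tangentTo_constrained hy.2).1 (hYtangent y hy)).2 k l hkl).trans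
          (S.mfderiv_dMinus_eval l y _).symm)

theorem HasLinearConstraints.isInvolutiveAlong (hF : S.HasLinearConstraints F r)
    (hP : S.TransportsConstraint F) :
    IsInvolutiveAlong (powModel B N) (S.firstOrder N) (S.constrained N) (S.variations N) := by
  rw [hF.variations_eq hP]
  intro U hU X Y hX hY _ _ hXW hYW w hw
  have hXtangent := fun y hy => (hXW y hy).1
  have hYtangent := fun y hy => (hYW y hy).1
  exact ⟨mlieBracket_mem_tangentTo_constrained hU hX hY hXtangent hYtangent hw,
    mlieBracket_mem_fixedEndpoints hU hX hY hw.1 (hXtangent w hw) (hYtangent w hw)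
      (fun y hy => (hXW y hy).2) fun y hy => (hYW y hy).2⟩

end DCLS

end Involutive

section Related

variable {E : Type*} [NormedAddCommGroup E] [NormedSpace ℝ E]
  {H : Type*} [TopologicalSpace H] {I : ModelWithCorners ℝ E H}
  {M : Type*} [TopologicalSpace M] [ChartedSpace H M]
  {A : Type*} [NormedAddCommGroup A] [NormedSpace ℝ A]
  {Q : Type*} [TopologicalSpace Q] [ChartedSpace A Q]
  {G : Type*} [NormedAddCommGroup G] [NormedSpace ℝ G]
  {p : M → Q} {X Y : ∀ x : M, TangentSpace I x} {ξ η : ∀ q : Q, TangentSpace 𝓘(ℝ, A) q}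
  {h : Q → G} {U : Set M} {W : Set Q} {x : M}

lemma fieldDeriv_comp_of_related (hW : IsOpen W) (hh : ContMDiffOn 𝓘(ℝ, A) 𝓘(ℝ, G) ∞ h W)
    (hp : ContMDiff I 𝓘(ℝ, A) ∞ p) (hx : p x ∈ W)
    (hX : (mfderiv I 𝓘(ℝ, A) p x (X x) : A) = ξ (p x)) :
    fieldDeriv I (h ∘ p) X x = fieldDeriv 𝓘(ℝ, A) h ξ (p x) :=
  (fieldDeriv_comp_map_of_contMDiff hW hh hp hx).trans (mfderiv_apply_congr (A := A) rfl hX)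

variable [IsManifold 𝓘(ℝ, A) ∞ Q]

lemma fieldDeriv_fieldDeriv_comp_of_related (hU : IsOpen U) (hW : IsOpen W) (hUW : MapsTo p U W)
    (hh : ContMDiffOn 𝓘(ℝ, A) 𝓘(ℝ, G) ∞ h W) (hp : ContMDiff I 𝓘(ℝ, A) ∞ p)
    (hη : SmoothFieldOn 𝓘(ℝ, A) η W) (hX : (mfderiv I 𝓘(ℝ, A) p x (X x) : A) = ξ (p x))
    (hY : ∀ y ∈ U, (mfderiv I 𝓘(ℝ, A) p y (Y y) : A) = η (p y)) (hx : x ∈ U) :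
    fieldDeriv I (fieldDeriv I (h ∘ p) Y) X x =
      fieldDeriv 𝓘(ℝ, A) (fieldDeriv 𝓘(ℝ, A) h η) ξ (p x) := by
  have hfirst : fieldDeriv I (h ∘ p) Y =ᶠ[𝓝 x] fieldDeriv 𝓘(ℝ, A) h η ∘ p :=
    Filter.eventuallyEq_of_mem (hU.mem_nhds hx) fun y hy =>
      fieldDeriv_comp_of_related hW hh hp (hUW hy) (hY y hy)
  rw [fieldDeriv_congr hfirst]
  exact fieldDeriv_comp_of_related hW (contMDiffOn_fieldDeriv hW hh hη) hp (hUW hx) hX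

variable [I.Boundaryless] [IsManifold I ∞ M] [CompleteSpace E] [CompleteSpace A]

theorem mfderiv_mlieBracket_of_related (hU : IsOpen U) (hW : IsOpen W) (hUW : MapsTo p U W)
    (hp : ContMDiff I 𝓘(ℝ, A) ∞ p) (hX : SmoothFieldOn I X U) (hY : SmoothFieldOn I Y U)
    (hξ : SmoothFieldOn 𝓘(ℝ, A) ξ W) (hη : SmoothFieldOn 𝓘(ℝ, A) η W)
    (hXξ : ∀ y ∈ U, (mfderiv I 𝓘(ℝ, A) p y (X y) : A) = ξ (p y))
    (hYη : ∀ y ∈ U, (mfderiv I 𝓘(ℝ, A) p y (Y y) : A) = η (p y)) (hx : x ∈ U) :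
    (mfderiv I 𝓘(ℝ, A) p x (VectorField.mlieBracket I X Y x) : A) =
      VectorField.mlieBracket 𝓘(ℝ, A) ξ η (p x) := by
  set φ := extChartAt 𝓘(ℝ, A) (p x)
  have hsource : IsOpen φ.source := isOpen_extChartAt_source (p x)
  have hxsource : p x ∈ φ.source := mem_extChartAt_source (p x)
  have hφ : ContMDiffOn 𝓘(ℝ, A) 𝓘(ℝ, A) ∞ φ φ.source := contMDiffOn_extChartAt' (p x)
  have hφW := hφ.mono (inter_subset_right (s := W))
  have hUφ : IsOpen (U ∩ p ⁻¹' φ.source) := hU.inter (hsource.preimage hp.continuous)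
  have hWφ : IsOpen (W ∩ φ.source) := hW.inter hsource
  have hUWφ : MapsTo p (U ∩ p ⁻¹' φ.source) (W ∩ φ.source) := fun y hy => ⟨hUW hy.1, hy.2⟩
  have hbracket : fieldDeriv I (φ ∘ p) (VectorField.mlieBracket I X Y) x =
      fieldDeriv 𝓘(ℝ, A) φ (VectorField.mlieBracket 𝓘(ℝ, A) ξ η) (p x) := by
    rw [fieldDeriv_mlieBracket hUφ (hφ.comp hp.contMDiffOn fun _ hy => hy.2)
        (hX.mono inter_subset_left) (hY.mono inter_subset_left) ⟨hx, hxsource⟩,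
      fieldDeriv_mlieBracket hWφ hφW (hξ.mono inter_subset_left) (hη.mono inter_subset_left)
        ⟨hUW hx, hxsource⟩,
      fieldDeriv_fieldDeriv_comp_of_related hUφ hWφ hUWφ hφW hp (hη.mono inter_subset_left)
        (hXξ x hx) (fun y hy => hYη y hy.1) ⟨hx, hxsource⟩,
      fieldDeriv_fieldDeriv_comp_of_related hUφ hWφ hUWφ hφW hp (hξ.mono inter_subset_left)
        (hYη x hx) (fun y hy => hXξ y hy.1) ⟨hx, hxsource⟩]
  exact (isInvertible_mfderiv_extChartAt (I := 𝓘(ℝ, A)) hxsource).injective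
    ((fieldDeriv_comp_map_of_contMDiff hsource hφ hp hxsource).symm.trans hbracket)

end Related

lemma isInvertible_of_injective {E E' : Type*} [NormedAddCommGroup E] [NormedSpace ℝ E]
    [FiniteDimensional ℝ E] [NormedAddCommGroup E'] [NormedSpace ℝ E'] [FiniteDimensional ℝ E']
    {f : E →L[ℝ] E'} (hf : Function.Injective f)
    (hrank : Module.finrank ℝ E = Module.finrank ℝ E') : f.IsInvertible :=
  ⟨(LinearMap.linearEquivOfInjective f.toLinearMap hf hrank).toContinuousLinearEquiv, rfl⟩

section Coordinates

variable {E : Type*} [NormedAddCommGroup E] [NormedSpace ℝ E] [CompleteSpace E]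
  {H : Type*} [TopologicalSpace H] {I : ModelWithCorners ℝ E H}
  {M : Type*} [TopologicalSpace M] [ChartedSpace H M] [IsManifold I ∞ M]
  {G : Type*} [NormedAddCommGroup G] [NormedSpace ℝ G] [FiniteDimensional ℝ G]

/-- The solution `X` is a combination, with coefficients the coordinates of `ζ`, of the pullbacks
by `Ψ` of constant vector fields. -/
lemma exists_smoothFieldOn_fieldDeriv_eq {Ψ ζ : M → G} {U : Set M} (hU : IsOpen U)
    (hΨ : ContMDiffOn I 𝓘(ℝ, G) ∞ Ψ U)
    (hinv : ∀ x ∈ U, (mfderiv I 𝓘(ℝ, G) Ψ x).IsInvertible) (hζ : ContMDiffOn I 𝓘(ℝ, G) ∞ ζ U) :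
    ∃ X : ∀ x : M, TangentSpace I x, SmoothFieldOn I X U ∧ EqOn (fieldDeriv I Ψ X) ζ U := by
  let b := Module.finBasis ℝ G
  let pullback : Fin (Module.finrank ℝ G) → ∀ x : M, TangentSpace I x := fun i =>
    VectorField.mpullback I 𝓘(ℝ, G) Ψ fun _ => b i
  have hpullback : ∀ i, SmoothFieldOn I (pullback i) U := fun i x hx =>
    (ContMDiffAt.mpullback_vectorField_preimage (n := ∞)
      (contMDiffAt_vectorSpace_iff_contDiffAt.2 contDiffAt_const)
      ((hΨ x hx).contMDiffAt (hU.mem_nhds hx)) (hinv x hx) (by simp)).contMDiffWithinAt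
  have hcoord : ∀ i, ContMDiffOn I 𝓘(ℝ, ℝ) ∞ (fun x => b.coord i (ζ x)) U := fun i =>
    (LinearMap.toContinuousLinearMap (b.coord i)).contMDiff.comp_contMDiffOn hζ
  refine ⟨fun x => ∑ i, b.coord i (ζ x) • pullback i x,
    ContMDiffOn.sum_section fun i _ => (hcoord i).smul_section (hpullback i), fun x hx => ?_⟩
  have hderiv : ∀ i, (mfderiv I 𝓘(ℝ, G) Ψ x (pullback i x) : G) = b i := fun i =>
    (hinv x hx).self_apply_inverse _
  refine (map_sum _ _ _).trans (Eq.trans ?_ (b.sum_repr (ζ x)))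
  exact Finset.sum_congr rfl fun i _ =>
    (map_smul _ _ _).trans (congrArg (b.coord i (ζ x) • ·) (hderiv i))

end Coordinates

section Lift

variable {A : Type*} [NormedAddCommGroup A] [NormedSpace ℝ A]
  {Q : Type*} [TopologicalSpace Q] [ChartedSpace A Q]
  {B : Type*} [NormedAddCommGroup B] [NormedSpace ℝ B]
  {V : Type*} [TopologicalSpace V] [ChartedSpace B V] {N : ℕ}

namespace DiscreteTangentBundle

variable (S : DiscreteTangentBundle A Q B V)

/-- The sequences `w` whose projections `∂⁻(w(k))` and `∂⁺(w(k))` lie in the preferred charts at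
those of the sequence `w₀`. -/
def endpointChartDomain (w₀ : Fin N → V) : Set (Fin N → V) :=
  {w | ∀ k, S.dMinus (w k) ∈ (extChartAt 𝓘(ℝ, A) (S.dMinus (w₀ k))).source ∧
    S.dPlus (w k) ∈ (extChartAt 𝓘(ℝ, A) (S.dPlus (w₀ k))).source}

/-- The coordinates of the projections `∂⁻(w(k))` and `∂⁺(w(k))`. Since `(∂⁻, ∂⁺)` is a local
diffeomorphism from `V` to `Q × Q`, these are local coordinates of `w`. -/
def endpointCoords (w₀ w : Fin N → V) : Fin N → A × A := fun k =>
  (extChartAt 𝓘(ℝ, A) (S.dMinus (w₀ k)) (S.dMinus (w k)),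
    extChartAt 𝓘(ℝ, A) (S.dPlus (w₀ k)) (S.dPlus (w k)))

/-- The tangent vector `δ` at `w` moves the endpoint `∂⁺(w(i)) = ∂⁻(w(j))`, where `j = i + 1`, with
the velocity prescribed by `ξ`, and fixes all other endpoints. -/
def MovesEndpoint (i j : Fin N) (ξ : ∀ q : Q, TangentSpace 𝓘(ℝ, A) q) (w : Fin N → V)
    (δ : Fin N → B) : Prop :=
  ∀ k, S.derivMinus (w k) (δ k) = (if k = j then ξ (S.dMinus (w k)) else 0 : A) ∧
    S.derivPlus (w k) (δ k) = (if k = i then ξ (S.dPlus (w k)) else 0 : A)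

variable {S} {w₀ w : Fin N → V} {i j : Fin N} {ξ : ∀ q : Q, TangentSpace 𝓘(ℝ, A) q}
  {δ : Fin N → B}

lemma mem_endpointChartDomain_self : w₀ ∈ S.endpointChartDomain w₀ := fun _ =>
  ⟨mem_extChartAt_source _, mem_extChartAt_source _⟩

lemma isOpen_endpointChartDomain : IsOpen (S.endpointChartDomain w₀) := by
  simp only [endpointChartDomain, Set.ofPred_forall]
  exact isOpen_iInter_of_finite fun k =>
    ((isOpen_extChartAt_source _).preimage
      (S.smooth_dMinus.continuous.comp (continuous_apply k))).inter
    ((isOpen_extChartAt_source _).preimage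
      (S.smooth_dPlus.continuous.comp (continuous_apply k)))

lemma MovesEndpoint.linearizedFirstOrder (h : S.MovesEndpoint i j ξ w δ) (hij : (j : ℕ) = i + 1)
    (hw : ∀ k l : Fin N, (l : ℕ) = k + 1 → S.dPlus (w k) = S.dMinus (w l)) :
    S.LinearizedFirstOrder w δ := by
  intro k l hkl
  have hkj : k = i ↔ l = j := by simp only [Fin.ext_iff]; omega
  rw [(h k).2, (h l).1, hw k l hkl]
  simp only [hkj]

variable [IsManifold 𝓘(ℝ, A) ∞ Q]

lemma contMDiffOn_endpointCoords :
    ContMDiffOn (powModel B N) 𝓘(ℝ, Fin N → A × A) ∞ (S.endpointCoords w₀)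
      (S.endpointChartDomain w₀) :=
  contMDiffOn_pi_space.2 fun k =>
    ((contMDiffOn_extChartAt' _).comp (S.smooth_dMinus.comp (contMDiff_eval k)).contMDiffOn
      fun _ hw => (hw k).1).prodMk_space
    ((contMDiffOn_extChartAt' _).comp (S.smooth_dPlus.comp (contMDiff_eval k)).contMDiffOn
      fun _ hw => (hw k).2)

lemma mfderiv_endpointCoords (hw : w ∈ S.endpointChartDomain w₀) (δ : Fin N → B) :
    (mfderiv (powModel B N) 𝓘(ℝ, Fin N → A × A) (S.endpointCoords w₀) w δ : Fin N → A × A) =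
      fun k => ((mfderiv 𝓘(ℝ, A) 𝓘(ℝ, A) (extChartAt 𝓘(ℝ, A) (S.dMinus (w₀ k))) (S.dMinus (w k))
          (S.derivMinus (w k) (δ k)) : A),
        (mfderiv 𝓘(ℝ, A) 𝓘(ℝ, A) (extChartAt 𝓘(ℝ, A) (S.dPlus (w₀ k))) (S.dPlus (w k))
          (S.derivPlus (w k) (δ k)) : A)) := by
  have hdiff : MDifferentiableAt (powModel B N) 𝓘(ℝ, Fin N → A × A) (S.endpointCoords w₀) w :=
    ((contMDiffOn_endpointCoords w hw).contMDiffAt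
      (isOpen_endpointChartDomain.mem_nhds hw)).mdifferentiableAt (by simp)
  have hlinear : ∀ L : (Fin N → A × A) →L[ℝ] A,
      L (mfderiv (powModel B N) 𝓘(ℝ, Fin N → A × A) (S.endpointCoords w₀) w δ) =
        fieldDeriv (powModel B N) (L ∘ S.endpointCoords w₀) (fun _ => δ) w := fun L =>
    ((fieldDeriv_comp L.differentiableAt hdiff _).trans
      (congrArg (fun T : (Fin N → A × A) →L[ℝ] A =>
        T (mfderiv (powModel B N) 𝓘(ℝ, Fin N → A × A) (S.endpointCoords w₀) w δ)) L.fderiv)).symm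
  have hproj : ∀ {p : V → Q}, ContMDiff 𝓘(ℝ, B) 𝓘(ℝ, A) ∞ p → ∀ {q : Q} {k : Fin N},
      p (w k) ∈ (extChartAt 𝓘(ℝ, A) q).source →
      fieldDeriv (powModel B N) (fun w : Fin N → V => extChartAt 𝓘(ℝ, A) q (p (w k)))
        (fun _ => δ) w = (mfderiv 𝓘(ℝ, A) 𝓘(ℝ, A) (extChartAt 𝓘(ℝ, A) q) (p (w k))
          (mfderiv 𝓘(ℝ, B) 𝓘(ℝ, A) p (w k) (δ k)) : A) := fun hp _ k hq =>
    (fieldDeriv_comp_map_of_contMDiff (isOpen_extChartAt_source _) (contMDiffOn_extChartAt' _)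
      (hp.comp (contMDiff_eval k)) hq).trans
      (mfderiv_apply_congr (A := A) rfl (mfderiv_comp_eval (hp.mdifferentiable (by simp)) k w δ))
  refine funext fun k => Prod.ext ?_ ?_
  · exact (hlinear ((ContinuousLinearMap.fst ℝ A A).comp (ContinuousLinearMap.proj k))).trans
      (hproj S.smooth_dMinus (hw k).1)
  · exact (hlinear ((ContinuousLinearMap.snd ℝ A A).comp (ContinuousLinearMap.proj k))).trans
      (hproj S.smooth_dPlus (hw k).2)

variable [FiniteDimensional ℝ A] [FiniteDimensional ℝ B]

lemma isInvertible_mfderiv_endpointCoords (hw : w ∈ S.endpointChartDomain w₀) :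
    (mfderiv (powModel B N) 𝓘(ℝ, Fin N → A × A) (S.endpointCoords w₀) w).IsInvertible := by
  refine isInvertible_of_injective (E := Fin N → B) (E' := Fin N → A × A)
    ((injective_iff_map_eq_zero _).2 fun δ hδ => ?_) ?_
  · have hcoords := (mfderiv_endpointCoords hw δ).symm.trans hδ
    refine funext fun k => S.eq_zero_of_derivMinus_of_derivPlus (v := w k) ?_ ?_
    · exact (isInvertible_mfderiv_extChartAt (I := 𝓘(ℝ, A)) (hw k).1).injective
        ((congrArg Prod.fst (congrFun hcoords k)).trans (map_zero _).symm)
    · exact (isInvertible_mfderiv_extChartAt (I := 𝓘(ℝ, A)) (hw k).2).injective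
        ((congrArg Prod.snd (congrFun hcoords k)).trans (map_zero _).symm)
  · simp only [Module.finrank_pi_fintype, Module.finrank_prod, S.dim_eq, two_mul]

variable [IsManifold 𝓘(ℝ, B) ∞ V]

theorem exists_smoothFieldOn_derivMinus_derivPlus {U : Set (Fin N → V)}
    {a : ∀ (w : Fin N → V) (k : Fin N), TangentSpace 𝓘(ℝ, A) (S.dMinus (w k))}
    {b : ∀ (w : Fin N → V) (k : Fin N), TangentSpace 𝓘(ℝ, A) (S.dPlus (w k))}
    (hU : IsOpen U)
    (ha : ∀ k, ContMDiffOn (powModel B N) 𝓘(ℝ, A).tangent ∞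
      (fun w => (⟨S.dMinus (w k), a w k⟩ : TangentBundle 𝓘(ℝ, A) Q)) U)
    (hb : ∀ k, ContMDiffOn (powModel B N) 𝓘(ℝ, A).tangent ∞
      (fun w => (⟨S.dPlus (w k), b w k⟩ : TangentBundle 𝓘(ℝ, A) Q)) U) (hw₀ : w₀ ∈ U) :
    ∃ U' ⊆ U, IsOpen U' ∧ w₀ ∈ U' ∧ ∃ X : ∀ w : Fin N → V, TangentSpace (powModel B N) w,
      SmoothFieldOn (powModel B N) X U' ∧ ∀ w ∈ U', ∀ k,
        S.derivMinus (w k) ((X w : Fin N → B) k) = a w k ∧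
        S.derivPlus (w k) ((X w : Fin N → B) k) = b w k := by
  have hopen : IsOpen (U ∩ S.endpointChartDomain w₀) := hU.inter isOpen_endpointChartDomain
  obtain ⟨X, hX, hcoords⟩ := exists_smoothFieldOn_fieldDeriv_eq (I := powModel B N) hopen
    (contMDiffOn_endpointCoords.mono inter_subset_right)
    (fun w hw => isInvertible_mfderiv_endpointCoords hw.2)
    (contMDiffOn_pi_space.2 fun k =>
      (contMDiffOn_mfderiv_apply (isOpen_extChartAt_source (S.dMinus (w₀ k)))
        (contMDiffOn_extChartAt' _) ((ha k).mono inter_subset_left)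
        fun w hw => (hw.2 k).1).prodMk_space
      (contMDiffOn_mfderiv_apply (isOpen_extChartAt_source (S.dPlus (w₀ k)))
        (contMDiffOn_extChartAt' _) ((hb k).mono inter_subset_left) fun w hw => (hw.2 k).2))
  refine ⟨_, inter_subset_left, hopen, ⟨hw₀, mem_endpointChartDomain_self⟩, X, hX,
    fun w hw k => ?_⟩
  have hk := congrFun ((mfderiv_endpointCoords hw.2 (X w)).symm.trans (hcoords hw)) k
  exact ⟨(isInvertible_mfderiv_extChartAt (I := 𝓘(ℝ, A)) (hw.2 k).1).injective
      (congrArg Prod.fst hk),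
    (isInvertible_mfderiv_extChartAt (I := 𝓘(ℝ, A)) (hw.2 k).2).injective (congrArg Prod.snd hk)⟩

lemma exists_smoothFieldOn_movesEndpoint {W : Set Q} (hW : IsOpen W)
    (hξ : SmoothFieldOn 𝓘(ℝ, A) ξ W) (hi : S.dPlus (w₀ i) ∈ W) (hj : S.dMinus (w₀ j) ∈ W) :
    ∃ U : Set (Fin N → V), IsOpen U ∧ w₀ ∈ U ∧ MapsTo (fun w => S.dPlus (w i)) U W ∧
      ∃ X : ∀ w : Fin N → V, TangentSpace (powModel B N) w,
        SmoothFieldOn (powModel B N) X U ∧ ∀ w ∈ U, S.MovesEndpoint i j ξ w (X w) := by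
  have hplus : ∀ k, ContMDiff (powModel B N) 𝓘(ℝ, A) ∞ (fun w : Fin N → V => S.dPlus (w k)) :=
    fun k => S.smooth_dPlus.comp (contMDiff_eval k)
  have hminus : ∀ k, ContMDiff (powModel B N) 𝓘(ℝ, A) ∞ (fun w : Fin N → V => S.dMinus (w k)) :=
    fun k => S.smooth_dMinus.comp (contMDiff_eval k)
  have hzero : ContMDiff 𝓘(ℝ, A) 𝓘(ℝ, A).tangent ∞
      (fun q : Q => (⟨q, 0⟩ : TangentBundle 𝓘(ℝ, A) Q)) :=
    Bundle.contMDiff_zeroSection ℝ (TangentSpace 𝓘(ℝ, A) : Q → Type _)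
  obtain ⟨U, hUW, hU, hw₀, X, hX, hderiv⟩ := exists_smoothFieldOn_derivMinus_derivPlus (S := S)
    (U := (fun w => S.dPlus (w i)) ⁻¹' W ∩ (fun w => S.dMinus (w j)) ⁻¹' W)
    (a := fun w k => if k = j then ξ (S.dMinus (w k)) else 0)
    (b := fun w k => if k = i then ξ (S.dPlus (w k)) else 0)
    ((hW.preimage (hplus i).continuous).inter (hW.preimage (hminus j).continuous))
    (fun k => by
      split_ifs with hk
      · exact hξ.comp (hminus k).contMDiffOn fun w hw => by rw [hk]; exact hw.2
      · exact (hzero.comp (hminus k)).contMDiffOn)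
    (fun k => by
      split_ifs with hk
      · exact hξ.comp (hplus k).contMDiffOn fun w hw => by rw [hk]; exact hw.1
      · exact (hzero.comp (hplus k)).contMDiffOn)
    ⟨hi, hj⟩
  exact ⟨U, hU, hw₀, fun w hw => (hUW hw).1, X, hX, hderiv⟩

end DiscreteTangentBundle

namespace DCLS

variable [IsManifold 𝓘(ℝ, A) ∞ Q] [IsManifold 𝓘(ℝ, B) ∞ V]
  [FiniteDimensional ℝ A] [FiniteDimensional ℝ B]
  {S : DCLS A Q B V} {F : ∀ q : Q, Submodule ℝ (TangentSpace 𝓘(ℝ, A) q)} {r : ℕ}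
  {w : Fin N → V} {i j : Fin N} {ξ : ∀ q : Q, TangentSpace 𝓘(ℝ, A) q} {δ : Fin N → B}

lemma HasLinearConstraints.mem_variations_of_movesEndpoint
    (hF : S.HasLinearConstraints F r) (hw : w ∈ S.constrained N) (h : S.MovesEndpoint i j ξ w δ)
    (hij : (j : ℕ) = i + 1) (hξ : ξ (S.dPlus (w i)) ∈ F (S.dPlus (w i))) :
    (⟨w, δ⟩ : TangentBundle (powModel B N) (Fin N → V)) ∈ S.variations N := by
  refine (hF.mem_variations hw).2 ⟨h.linearizedFirstOrder hij hw.1,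
    ⟨fun k hk => ?_, fun k hk => ?_⟩, fun k => ?_⟩
  · exact (h k).1.trans (if_neg fun hkj => by subst hkj; omega)
  · exact (h k).2.trans (if_neg fun hki => by subst hki; omega)
  · by_cases hki : k = i
    · subst hki
      exact (congrArg (fun a : A => a ∈ F (S.dPlus (w k))) ((h k).2.trans (if_pos rfl))).mpr hξ
    · exact (congrArg (fun a : A => a ∈ F (S.dPlus (w k))) ((h k).2.trans (if_neg hki))).mpr
        (F _).zero_mem

theorem HasLinearConstraints.isInvolutive (hF : S.HasLinearConstraints F r)
    (hD : ∀ q : Q, ∃ v ∈ S.D, ∃ v' ∈ S.D, S.dPlus v = q ∧ S.dMinus v' = q) (hN : 2 ≤ N)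
    (h : IsInvolutiveAlong (powModel B N) (S.firstOrder N) (S.constrained N) (S.variations N)) :
    IsInvolutive 𝓘(ℝ, A) F := by
  intro W hW ξ η hξ hη hξF hηF q hq
  obtain ⟨a, ha, b, hb, rfl, hab⟩ := hD q
  obtain ⟨w₀, hw₀, rfl, rfl⟩ := exists_constrained (N := N) (S := S)
    (fun q => let ⟨_, _, v, hv, _, hvq⟩ := hD q; ⟨v, hv, hvq⟩) hN ha hb hab.symm
  have hj : S.dMinus (w₀ ⟨1, by omega⟩) ∈ W := hab ▸ hq
  obtain ⟨U, hU, hw₀U, hUW, X, hX, hXmoves⟩ :=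
    DiscreteTangentBundle.exists_smoothFieldOn_movesEndpoint hW hξ hq hj
  obtain ⟨U', hU', hw₀U', -, Y, hY, hYmoves⟩ :=
    DiscreteTangentBundle.exists_smoothFieldOn_movesEndpoint hW hη hq hj
  have hbracket := h (U ∩ U') (hU.inter hU') X Y
    (hX.mono inter_subset_left) (hY.mono inter_subset_right)
    (fun w hw => (mem_tangentTo_firstOrder hw.2).2
      ((hXmoves w hw.1.1).linearizedFirstOrder rfl hw.2))
    (fun w hw => (mem_tangentTo_firstOrder hw.2).2
      ((hYmoves w hw.1.2).linearizedFirstOrder rfl hw.2))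
    (fun w hw => hF.mem_variations_of_movesEndpoint hw.2 (hXmoves w hw.1.1) rfl
      (hξF _ (hUW hw.1.1)))
    (fun w hw => hF.mem_variations_of_movesEndpoint hw.2 (hYmoves w hw.1.2) rfl
      (hηF _ (hUW hw.1.1))) w₀ ⟨⟨hw₀U, hw₀U'⟩, hw₀⟩
  have hrelated := mfderiv_mlieBracket_of_related (hU.inter hU') hW
    (hUW.mono_left inter_subset_left) (S.smooth_dPlus.comp (contMDiff_eval ⟨0, by omega⟩))
    (hX.mono inter_subset_left) (hY.mono inter_subset_right) hξ hη
    (fun w hw => (S.mfderiv_dPlus_eval _ w (X w)).trans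
      ((hXmoves w hw.1 _).2.trans (if_pos rfl)))
    (fun w hw => (S.mfderiv_dPlus_eval _ w (Y w)).trans
      ((hYmoves w hw.2 _).2.trans (if_pos rfl))) ⟨hw₀U, hw₀U'⟩
  exact (congrArg (fun a : A => a ∈ F (S.dPlus (w₀ ⟨0, by omega⟩)))
    ((S.mfderiv_dPlus_eval _ w₀ _).symm.trans hrelated)).mp
    (((hF.mem_variations hw₀).1 hbracket).2.2 ⟨0, by omega⟩)

end DCLS

end Lift

end

end DiscreteMechanics

theorem mainTheorem6_general
    {A : Type*} [NormedAddCommGroup A] [NormedSpace ℝ A] [FiniteDimensional ℝ A]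
    {Q : Type*} [TopologicalSpace Q] [ChartedSpace A Q] [IsManifold 𝓘(ℝ, A) ∞ Q]
    [SecondCountableTopology Q]
    {B : Type*} [NormedAddCommGroup B] [NormedSpace ℝ B] [FiniteDimensional ℝ B]
    {V : Type*} [TopologicalSpace V] [ChartedSpace B V] [IsManifold 𝓘(ℝ, B) ∞ V]
    (S : DiscreteMechanics.DCLS A Q B V)
    (F : ∀ q : Q, Submodule ℝ (TangentSpace 𝓘(ℝ, A) q)) (r : ℕ)
    (hF : S.HasLinearConstraints F r)
    (hD : ∀ q : Q, ∃ v ∈ S.D, ∃ v' ∈ S.D, S.dPlus v = q ∧ S.dMinus v' = q)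
    (N : ℕ) (hN : 2 ≤ N) :
    List.TFAE [
      DiscreteMechanics.IsInvolutive 𝓘(ℝ, A) F,
      DiscreteMechanics.IsInvolutiveAlong (DiscreteMechanics.powModel B N)
        (S.firstOrder N) (S.constrained N) (S.variations N),
      S.variations N =
        {δ | δ ∈ DiscreteMechanics.tangentTo (DiscreteMechanics.powModel B N) (S.constrained N) ∧
          δ ∈ S.fixedEndpoints N},
      S.variations N ⊆
        DiscreteMechanics.tangentTo (DiscreteMechanics.powModel B N) (S.constrained N)] := by
  tfae_have 1 → 3 := fun h => hF.variations_eq (hF.transportsConstraint_of_isInvolutive h)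
  tfae_have 3 → 4 := fun h => h.trans_subset fun _ hδ => hδ.1
  tfae_have 4 → 3 := fun h =>
    hF.variations_eq (hF.transportsConstraint_of_variations_subset hD hN h)
  tfae_have 4 → 2 := fun h =>
    hF.isInvolutiveAlong (hF.transportsConstraint_of_variations_subset hD hN h)
  tfae_have 2 → 1 := hF.isInvolutive hD hN
  tfae_finish

theorem mainTheorem6
    {A : Type*} [NormedAddCommGroup A] [NormedSpace ℝ A] [FiniteDimensional ℝ A]
    {Q : Type*} [TopologicalSpace Q] [ChartedSpace A Q] [IsManifold 𝓘(ℝ, A) ∞ Q]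
    [T2Space Q] [SecondCountableTopology Q]
    {B : Type*} [NormedAddCommGroup B] [NormedSpace ℝ B] [FiniteDimensional ℝ B]
    {V : Type*} [TopologicalSpace V] [ChartedSpace B V] [IsManifold 𝓘(ℝ, B) ∞ V]
    [T2Space V] [SecondCountableTopology V]
    (S : DiscreteMechanics.DCLS A Q B V)
    (F : ∀ q : Q, Submodule ℝ (TangentSpace 𝓘(ℝ, A) q)) (r : ℕ)
    (hF : S.HasLinearConstraints F r)
    (hD : ∀ q : Q, ∃ v ∈ S.D, ∃ v' ∈ S.D, S.dPlus v = q ∧ S.dMinus v' = q)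
    (N : ℕ) (hN : 2 ≤ N) :
    List.TFAE [
      DiscreteMechanics.IsInvolutive 𝓘(ℝ, A) F,
      DiscreteMechanics.IsInvolutiveAlong (DiscreteMechanics.powModel B N)
        (S.firstOrder N) (S.constrained N) (S.variations N),
      S.variations N =
        {δ | δ ∈ DiscreteMechanics.tangentTo (DiscreteMechanics.powModel B N) (S.constrained N) ∧
          δ ∈ S.fixedEndpoints N},
      S.variations N ⊆
        DiscreteMechanics.tangentTo (DiscreteMechanics.powModel B N) (S.constrained N)] :=
  mainTheorem6_general S F r hF hD N hN
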